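/- Consider $\min_{x\in\mathbb R^p}\Phi(x):=f(x,y^*(x))$ with $y^*(x)=\operatorname{arg\,min}_{y\in\mathbb R^q}g(x,y)$, where $f(x,y)=\mathbb E_\xi[F(x,y;\xi)]$ and $g(x,y)=\mathbb E_\zeta[G(x,y;\zeta)]$ ($\Phi$ need not be convex). Norms are Euclidean, for matrices spectral. $\nabla_x\nabla_y h$ is the Jacobian of $\nabla_x h$ with respect to $y$. Assume: 1. $f$ and every $F(\cdot;\xi)$ are $C^1$, $g$ and every $G(\cdot;\zeta)$ are $C^2$, $g(x,\cdot)$ and $G(x,\cdot;\zeta)$ are $\mu$-strongly convex ($\mu>0$), and $\inf\Phi>-\infty$. 2. $f$ and $\nabla f$ are $C_f$- and $L_f$-Lipschitz, and $\nabla g$, $\nabla_x\nabla_y g$, $\nabla_y^2 g$ are $L_g$-, $L_{gxy}$-, $L_{gyy}$-Lipschitz in $(x,y)$ (with $L_f,L_g>0$ and $C_f,L_{gxy},L_{gyy}\ge0$); for all $\xi,\zeta$ the same holds for $F(\cdot;\xi)$ and $G(\cdot;\zeta)$. 3. $\nabla F,\nabla G,\nabla_x\nabla_yG,\nabla_y^2G$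 are unbiased estimates of $\nabla f,\nabla g,\nabla_x\nabla_yg,\nabla_y^2g$ with variances at most $\sigma_f^2,\sigma_g^2,\sigma_{gxy}^2,\sigma_{gyy}^2$. Let $M\ge C_f/\mu$ and $\Omega=\{v\in\mathbb R^q:\|v\|\le M\}$. For samples $\xi,\delta$ of $\xi,\zeta$ put $D_y=\nabla_yG(x,y;\delta)$, $D_v=\nabla_y^2G(x,y;\delta)v-\nabla_yF(x,y;\xi)$, $D_x=\nabla_xF(x,y;\xi)-\nabla_x\nabla_yG(x,y;\delta)v$; the value of $D_\bullet$ on a batch of samples is the average over the batch. ALS-SPIDER, with positive integers $K,T,J,q_1,S_1,S_2$, step sizes $\lambda_1,\lambda_2,\alpha,\beta,\eta$ and a start $x_0\in\mathbb R^p$, $y_0\in\mathbb R^q$, $v_0\in\Omega$, does the following for $k=0,\dots,K-1$. - If $q_1\mid k$, set $D^x_k,D^y_k,D^v_k$ to the values of $D_x,D_y,D_v$ at $(x_k,y_k,v_k)$ on three fresh batches of size $S_1$. Otherwise set $D^x_k=D^x_{k-1,J-1}$, $D^y_k=D^y_{k-1,T-1}$, $D^v_k=D^v_{k-1,J-1}$.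 - Set $x_{k+1}=x_k-\alpha D^x_k$. - Starting from $(\bar x_{k,-1},\bar y_{k,-1},D^y_{k,-1})=(x_k,y_k,D^y_k)$, for $t=0,\dots,T-1$ set $\bar x_{k,t}=x_{k+1}$, $\bar y_{k,t}=\bar y_{k,t-1}-\lambda_1\beta D^y_{k,t-1}$ and, with a fresh batch $\mathcal S$ of size $S_2$, $D^y_{k,t}=D_y(\bar x_{k,t},\bar y_{k,t};\mathcal S)+D^y_{k,t-1}-D_y(\bar x_{k,t-1},\bar y_{k,t-1};\mathcal S)$. Set $y_{k+1}=\bar y_{k,T-1}$. - Starting from $u_{k,-1}=(x_k,y_k,v_k)$, $v_{k,-1}=v_k$, $D^x_{k,-1}=D^x_k$, $D^v_{k,-1}=D^v_k$, for $j=0,\dots,J-1$ set $v_{k,j}=\mathrm{proj}_\Omega(v_{k,j-1}-\lambda_2\eta D^v_{k,j-1})$, $u_{k,j}=(x_{k+1},y_{k+1},v_{k,j})$ and, with fresh batches $\mathcal S_x,\mathcal S_v$ of size $S_2$, $D^\bullet_{k,j}=D_\bullet(u_{k,j};\mathcal S_\bullet)+D^\bullet_{k,j-1}-D_\bullet(u_{k,j-1};\mathcal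 S_\bullet)$ for $\bullet\in\{x,v\}$. Set $v_{k+1}=v_{k,J-1}$. All samples are mutually independent (within one pair $(\xi,\delta)$ independence is not required). The output $\bar x$ is uniform on $\{x_0,\dots,x_{K-1}\}$, with an index independent of the samples. Let $0<\beta,\eta<1$, $S_2=q_1$, $r=S_2/q_1$, $L_{gg}=\max\{L_{gxy},L_{gyy}\}$, $\bar M_1=4L_f^2+4M^2L_{gg}^2$, $C_3=J^2+J^2M^2+2T^2$, $C_y=L_g/\mu$, $C_v=\big(\frac{L_f}{\mu}+\frac{C_fL_{gg}}{\mu^2}\big)\big(1+\frac{L_g}{\mu}\big)$, $$L_\Phi=L_f+\frac{2L_fL_{gg}+C_f^2L_{gg}}{\mu}+\frac{L_fL_g^2+2C_fL_gL_{gg}}{\mu^2}+\frac{C_fL_g^2L_{gg}}{\mu^3},$$ $$\lambda_1=\min\Big\{\tfrac1{2L_g+2\mu},\tfrac{(1/2)^{2T+5}\mu r}{TL_g^2\beta^2C_3}\Big\},\qquad \lambda_2=\min\Big\{\tfrac1{2L_g+2\mu},\tfrac{\mu^2\lambda_1\beta}{128\bar M_1J\eta},\tfrac{(1/2)^{2(T+J)+6}\mu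 r}{J(L_g^2\eta^2+T\bar M_1\beta\eta)}\Big\},$$ $C_4=192\lambda_1\beta L_g^2(1+r^{-1}C_3)$, $C_5=192\lambda_2\eta\bar M_1(1+C_y^2+r^{-1}J)$ and $$\alpha=\min\Big\{\tfrac{\mu\lambda_1\beta}{96C_y^2+8\bar M_1},\tfrac{\mu\lambda_2\eta}{48(L_g^2+C_v^2)},\tfrac1{6L_\Phi},\tfrac{\sqrt r}{12\sqrt{\bar M_1}},\tfrac{\mu}{C_4},\tfrac{\mu}{C_5},\tfrac{(1/2)^{2(T+J)+3}r}{\bar M_1T\beta+L_g^2\eta}\Big\}.$$ Then for all positive integers $T,J$ there is $b>0$ such that for every $C\ge b$ there is $B$ with the following property; $b$ and $B$ do not depend on $\epsilon$. For every $\epsilon\in(0,1]$ and all integers $K,S_1\in[b/\epsilon,\,C/\epsilon]$, ALS-SPIDER with $S_2=q_1=\lceil S_1^{1/2}\rceil$ outputs an $\epsilon$-stationary point: $\Phi$ is differentiable and $\mathbb E\|\nabla\Phi(\bar x)\|^2\le\epsilon$. Moreover, the total number of evaluations of sample gradients $\nabla_xF,\nabla_yF,\nabla_yG$, Jacobian-vector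 products $\nabla_x\nabla_yG\,v$ and Hessian-vector products $\nabla_y^2G\,v$ made in the $K$ iterations is at most $B\epsilon^{-1.5}$. -/

import Mathlib

open MeasureTheory ProbabilityTheory
open scoped ENNReal

namespace ALSSpider

/-! ### The space `ℝ^p × ℝ^q` and partial derivatives -/

/-- `ℝⁿ` with the Euclidean norm. -/
abbrev Vec (n : ℕ) : Type := EuclideanSpace ℝ (Fin n)

/-- `ℝ^p × ℝ^q` with the Euclidean norm `‖(x, y)‖² = ‖x‖² + ‖y‖²`. -/
abbrev Pair (p q : ℕ) : Type := WithLp 2 (Vec p × Vec q)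

/-- The point `(x, y)`. -/
abbrev pt {p q : ℕ} (x : Vec p) (y : Vec q) : Pair p q := WithLp.toLp 2 (x, y)

/-- `∇ₓ h (x, y)`, for `z = (x, y)`. -/
noncomputable def gradX {p q : ℕ} (h : Pair p q → ℝ) (z : Pair p q) : Vec p :=
  gradient (fun x => h (pt x z.snd)) z.fst

/-- `∇_y h (x, y)`, for `z = (x, y)`. -/
noncomputable def gradY {p q : ℕ} (h : Pair p q → ℝ) (z : Pair p q) : Vec q :=
  gradient (fun y => h (pt z.fst y)) z.snd

/-- `∇ₓ∇_y h (x, y)`: the Jacobian of `∇ₓ h` with respect to `y`, a `p × q` matrix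
with the spectral norm. -/
noncomputable def jacXY {p q : ℕ} (h : Pair p q → ℝ) (z : Pair p q) : Vec q →L[ℝ] Vec p :=
  fderiv ℝ (fun y => gradX h (pt z.fst y)) z.snd

/-- `∇_y² h (x, y)`: the Hessian of `h` with respect to `y`, a `q × q` matrix
with the spectral norm. -/
noncomputable def hessYY {p q : ℕ} (h : Pair p q → ℝ) (z : Pair p q) : Vec q →L[ℝ] Vec q :=
  fderiv ℝ (fun y => gradY h (pt z.fst y)) z.snd

/-- Lipschitz continuity with a real constant. -/
def LipReal {E V : Type*} [NormedAddCommGroup E] [NormedAddCommGroup V] (L : ℝ) (h : E → V) :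
    Prop :=
  ∀ z w : E, ‖h z - h w‖ ≤ L * ‖z - w‖

/-! ### The stochastic bilevel problem -/

/-- The data of the problem: the laws of `ξ` and `ζ` and the functions
`F (x, y; ξ)` and `G (x, y; ζ)`. -/
structure Problem (p q : ℕ) (Ξ Z : Type*) [MeasurableSpace Ξ] [MeasurableSpace Z] where
  lawXi : Measure Ξ
  lawZeta : Measure Z
  probXi : IsProbabilityMeasure lawXi
  probZeta : IsProbabilityMeasure lawZeta
  F : Pair p q → Ξ → ℝ
  G : Pair p q → Z → ℝ

section Problem

variable {p q : ℕ} {Ξ Z : Type*} [MeasurableSpace Ξ] [MeasurableSpace Z]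

/-- `f (x, y) = E_ξ [F (x, y; ξ)]`. -/
noncomputable def Problem.f (Q : Problem p q Ξ Z) (z : Pair p q) : ℝ :=
  ∫ ξ, Q.F z ξ ∂Q.lawXi

/-- `g (x, y) = E_ζ [G (x, y; ζ)]`. -/
noncomputable def Problem.g (Q : Problem p q Ξ Z) (z : Pair p q) : ℝ :=
  ∫ ζ, Q.G z ζ ∂Q.lawZeta

/-- `y*(x)`, the minimizer of `g (x, ·)` (it exists and is unique when `g (x, ·)` is continuous
and strongly convex). -/
noncomputable def Problem.yStar (Q : Problem p q Ξ Z) (x : Vec p) : Vec q :=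
  Classical.epsilon fun y => ∀ y' : Vec q, Q.g (pt x y) ≤ Q.g (pt x y')

/-- `Φ x = f (x, y*(x))`. -/
noncomputable def Problem.Phi (Q : Problem p q Ξ Z) (x : Vec p) : ℝ :=
  Q.f (pt x (Q.yStar x))

/-- The constants in the assumptions. -/
structure Consts where
  mu : ℝ
  Cf : ℝ
  Lf : ℝ
  Lg : ℝ
  Lgxy : ℝ
  Lgyy : ℝ
  sigf : ℝ
  sigg : ℝ
  siggxy : ℝ
  siggyy : ℝ

/-- Signs of the constants. (`Lf` and `Lg` occur in denominators of the step sizes.) -/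
structure Consts.Admissible (c : Consts) : Prop where
  mu_pos : 0 < c.mu
  Cf_nonneg : 0 ≤ c.Cf
  Lf_pos : 0 < c.Lf
  Lg_pos : 0 < c.Lg
  Lgxy_nonneg : 0 ≤ c.Lgxy
  Lgyy_nonneg : 0 ≤ c.Lgyy

/-- Regularity, strong convexity in `y` and boundedness of `Φ` from below (together with the
existence of the expectations that define `f` and `g`). -/
structure Regular (Q : Problem p q Ξ Z) (c : Consts) : Prop where
  measurable_F : ∀ z, Measurable fun ξ => Q.F z ξ
  measurable_G : ∀ z, Measurable fun ζ => Q.G z ζ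
  integrable_F : ∀ z, Integrable (fun ξ => Q.F z ξ) Q.lawXi
  integrable_G : ∀ z, Integrable (fun ζ => Q.G z ζ) Q.lawZeta
  contDiff_f : ContDiff ℝ 1 Q.f
  contDiff_F : ∀ ξ, ContDiff ℝ 1 fun z => Q.F z ξ
  contDiff_g : ContDiff ℝ 2 Q.g
  contDiff_G : ∀ ζ, ContDiff ℝ 2 fun z => Q.G z ζ
  strongConvex_g : ∀ x : Vec p, StrongConvexOn Set.univ c.mu fun y : Vec q => Q.g (pt x y)
  strongConvex_G : ∀ (ζ : Z) (x : Vec p),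
    StrongConvexOn Set.univ c.mu fun y : Vec q => Q.G (pt x y) ζ
  bddBelow_Phi : BddBelow (Set.range Q.Phi)

/-- The Lipschitz conditions on an upper-level function `f` and a lower-level function `g`. -/
structure LipschitzConds (c : Consts) (f g : Pair p q → ℝ) : Prop where
  f_lip : LipReal c.Cf f
  grad_f_lip : LipReal c.Lf (gradient f)
  grad_g_lip : LipReal c.Lg (gradient g)
  jac_g_lip : LipReal c.Lgxy (jacXY g)
  hess_g_lip : LipReal c.Lgyy (hessYY g)

/-- The integrable random vector `X` is an unbiased estimate of `m`. -/
def Unbiased {S V : Type*} [MeasurableSpace S] [NormedAddCommGroup V] [NormedSpace ℝ V]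
    (ν : Measure S) (X : S → V) (m : V) : Prop :=
  Integrable X ν ∧ ∫ s, X s ∂ν = m

/-- `E ‖X - m‖² ≤ σ²`. -/
def VarianceLe {S V : Type*} [MeasurableSpace S] [NormedAddCommGroup V]
    (ν : Measure S) (X : S → V) (m : V) (σ : ℝ) : Prop :=
  Integrable (fun s => ‖X s - m‖ ^ 2) ν ∧ ∫ s, ‖X s - m‖ ^ 2 ∂ν ≤ σ ^ 2

/-- Unbiasedness and bounded variance of the stochastic derivatives. -/
structure NoiseConds (Q : Problem p q Ξ Z) (c : Consts) : Prop where
  unbiased_F : ∀ z, Unbiased Q.lawXi (fun ξ => gradient (fun w => Q.F w ξ) z) (gradient Q.f z)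
  unbiased_G : ∀ z, Unbiased Q.lawZeta (fun ζ => gradient (fun w => Q.G w ζ) z) (gradient Q.g z)
  unbiased_jac : ∀ z, Unbiased Q.lawZeta (fun ζ => jacXY (fun w => Q.G w ζ) z) (jacXY Q.g z)
  unbiased_hess : ∀ z, Unbiased Q.lawZeta (fun ζ => hessYY (fun w => Q.G w ζ) z) (hessYY Q.g z)
  var_F : ∀ z,
    VarianceLe Q.lawXi (fun ξ => gradient (fun w => Q.F w ξ) z) (gradient Q.f z) c.sigf
  var_G : ∀ z,
    VarianceLe Q.lawZeta (fun ζ => gradient (fun w => Q.G w ζ) z) (gradient Q.g z) c.sigg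
  var_jac : ∀ z,
    VarianceLe Q.lawZeta (fun ζ => jacXY (fun w => Q.G w ζ) z) (jacXY Q.g z) c.siggxy
  var_hess : ∀ z,
    VarianceLe Q.lawZeta (fun ζ => hessYY (fun w => Q.G w ζ) z) (hessYY Q.g z) c.siggyy

/-- All standing assumptions on the problem. -/
structure Assumptions (Q : Problem p q Ξ Z) (c : Consts) : Prop where
  admissible : c.Admissible
  regular : Regular Q c
  lipschitz : LipschitzConds c Q.f Q.g
  noise : NoiseConds Q c
  lipschitz_sample : ∀ (ξ : Ξ) (ζ : Z),
    LipschitzConds c (fun z => Q.F z ξ) (fun z => Q.G z ζ)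

end Problem

/-! ### The algorithm, with its evaluation counters -/

/-- Numbers of evaluations: partial gradients `∇ₓF`, `∇_yF` (`gradF`), gradients `∇_yG` (`gradG`),
products `∇ₓ∇_yG · v` (`jacVec`) and products `∇_y²G · v` (`hessVec`), each at one sample. -/
@[ext]
structure Count where
  gradF : ℕ
  gradG : ℕ
  jacVec : ℕ
  hessVec : ℕ

instance : Zero Count := ⟨⟨0, 0, 0, 0⟩⟩

instance : Add Count :=
  ⟨fun a b => ⟨a.gradF + b.gradF, a.gradG + b.gradG, a.jacVec + b.jacVec, a.hessVec + b.hessVec⟩⟩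

/-- `n` times a count. -/
def Count.times (n : ℕ) (a : Count) : Count :=
  ⟨n * a.gradF, n * a.gradG, n * a.jacVec, n * a.hessVec⟩

/-- The total number of evaluations. -/
def Count.total (a : Count) : ℕ := a.gradF + a.gradG + a.jacVec + a.hessVec

/-- Labels of the samples drawn in a run: `i` is the position in the batch, `k` the outer
iteration, `t` and `j` the inner iterations. -/
inductive Slot where
  /-- the batch `S_{1,x}` at outer iteration `k` -/
  | outerX (k i : ℕ)
  /-- the batch `S_{1,y}` at outer iteration `k` -/
  | outerY (k i : ℕ)
  /-- the batch `S_{1,v}` at outer iteration `k` -/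
  | outerV (k i : ℕ)
  /-- the batch `S_{2,y}` at inner iteration `t` of outer iteration `k` -/
  | innerY (k t i : ℕ)
  /-- the batch `S_{2,x}` at inner iteration `j` of outer iteration `k` -/
  | innerX (k j i : ℕ)
  /-- the batch `S_{2,v}` at inner iteration `j` of outer iteration `k` -/
  | innerV (k j i : ℕ)

/-- The input parameters of the algorithm; `M` is the radius of the ball `Ω`. -/
structure Params where
  T : ℕ
  J : ℕ
  q1 : ℕ
  S1 : ℕ
  S2 : ℕ
  lam1 : ℝ
  lam2 : ℝ
  alpha : ℝ
  beta : ℝ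
  eta : ℝ
  M : ℝ

/-- The projection onto the ball `Ω = {v | ‖v‖ ≤ M}`. -/
noncomputable def projBall {q : ℕ} (M : ℝ) (v : Vec q) : Vec q :=
  if ‖v‖ ≤ M then v else (M / ‖v‖) • v

section Algorithm

variable {p q : ℕ} {Ξ Z : Type*} [MeasurableSpace Ξ] [MeasurableSpace Z]

/-- `D_y (x, y; δ) = ∇_y G (x, y; δ)`. -/
noncomputable def sampleDy (Q : Problem p q Ξ Z) (x : Vec p) (y : Vec q) (s : Ξ × Z) : Vec q :=
  gradY (fun w => Q.G w s.2) (pt x y)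

/-- `D_v (x, y, v; ξ, δ) = ∇_y² G (x, y; δ) v - ∇_y F (x, y; ξ)`. -/
noncomputable def sampleDv (Q : Problem p q Ξ Z) (x : Vec p) (y v : Vec q) (s : Ξ × Z) : Vec q :=
  hessYY (fun w => Q.G w s.2) (pt x y) v - gradY (fun w => Q.F w s.1) (pt x y)

/-- `D_x (x, y, v; ξ, δ) = ∇ₓ F (x, y; ξ) - ∇ₓ∇_y G (x, y; δ) v`. -/
noncomputable def sampleDx (Q : Problem p q Ξ Z) (x : Vec p) (y v : Vec q) (s : Ξ × Z) : Vec p :=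
  gradX (fun w => Q.F w s.1) (pt x y) - jacXY (fun w => Q.G w s.2) (pt x y) v

/-- The average of `D` over a batch of `S` samples. -/
noncomputable def batchMean {V : Type*} [AddCommGroup V] [Module ℝ V]
    (S : ℕ) (D : Ξ × Z → V) (batch : ℕ → Ξ × Z) : V :=
  (S : ℝ)⁻¹ • ∑ i ∈ Finset.range S, D (batch i)

/-- Mini-batch evaluation of `D_y`, with its cost. -/
noncomputable def evalDy (Q : Problem p q Ξ Z) (S : ℕ) (batch : ℕ → Ξ × Z)
    (x : Vec p) (y : Vec q) : Vec q × Count :=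
  (batchMean S (sampleDy Q x y) batch, Count.times S ⟨0, 1, 0, 0⟩)

/-- Mini-batch evaluation of `D_v`, with its cost. -/
noncomputable def evalDv (Q : Problem p q Ξ Z) (S : ℕ) (batch : ℕ → Ξ × Z)
    (x : Vec p) (y v : Vec q) : Vec q × Count :=
  (batchMean S (sampleDv Q x y v) batch, Count.times S ⟨1, 0, 0, 1⟩)

/-- Mini-batch evaluation of `D_x`, with its cost. -/
noncomputable def evalDx (Q : Problem p q Ξ Z) (S : ℕ) (batch : ℕ → Ξ × Z)
    (x : Vec p) (y v : Vec q) : Vec p × Count :=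
  (batchMean S (sampleDx Q x y v) batch, Count.times S ⟨1, 0, 1, 0⟩)

/-- State of the loop on `y`: the current point `(x, y)`, the estimate at that point and the
evaluations spent. -/
structure YState (p q : ℕ) where
  x : Vec p
  y : Vec q
  Dy : Vec q
  count : Count

/-- One variance-reduced step on `y`, towards the new upper-level point `xNew`. -/
noncomputable def yStep (Q : Problem p q Ξ Z) (a : Params) (batch : ℕ → Ξ × Z) (xNew : Vec p)
    (s : YState p q) : YState p q :=
  let yNew := s.y - (a.lam1 * a.beta) • s.Dy
  let eNew := evalDy Q a.S2 batch xNew yNew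
  let eOld := evalDy Q a.S2 batch s.x s.y
  { x := xNew
    y := yNew
    Dy := eNew.1 + (s.Dy - eOld.1)
    count := s.count + eNew.2 + eOld.2 }

/-- The state after `t` steps on `y` in outer iteration `k`. -/
noncomputable def yLoop (Q : Problem p q Ξ Z) (a : Params) (smp : Slot → Ξ × Z) (k : ℕ)
    (xNew : Vec p) (s : YState p q) : ℕ → YState p q
  | 0 => s
  | t + 1 => yStep Q a (fun i => smp (Slot.innerY k t i)) xNew (yLoop Q a smp k xNew s t)

/-- State of the loop on `v`: the current point `(x, y, v)`, the estimates at that point and the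
evaluations spent. -/
structure VState (p q : ℕ) where
  x : Vec p
  y : Vec q
  v : Vec q
  Dx : Vec p
  Dv : Vec q
  count : Count

/-- One projected variance-reduced step on `v`, with the new point `(xNew, yNew)`. -/
noncomputable def vStep (Q : Problem p q Ξ Z) (a : Params) (batchX batchV : ℕ → Ξ × Z)
    (xNew : Vec p) (yNew : Vec q) (s : VState p q) : VState p q :=
  let vNew := projBall a.M (s.v - (a.lam2 * a.eta) • s.Dv)
  let exNew := evalDx Q a.S2 batchX xNew yNew vNew
  let exOld := evalDx Q a.S2 batchX s.x s.y s.v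
  let evNew := evalDv Q a.S2 batchV xNew yNew vNew
  let evOld := evalDv Q a.S2 batchV s.x s.y s.v
  { x := xNew
    y := yNew
    v := vNew
    Dx := exNew.1 + (s.Dx - exOld.1)
    Dv := evNew.1 + (s.Dv - evOld.1)
    count := s.count + exNew.2 + exOld.2 + evNew.2 + evOld.2 }

/-- The state after `j` steps on `v` in outer iteration `k`. -/
noncomputable def vLoop (Q : Problem p q Ξ Z) (a : Params) (smp : Slot → Ξ × Z) (k : ℕ)
    (xNew : Vec p) (yNew : Vec q) (s : VState p q) : ℕ → VState p q
  | 0 => s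
  | j + 1 =>
    vStep Q a (fun i => smp (Slot.innerX k j i)) (fun i => smp (Slot.innerV k j i)) xNew yNew
      (vLoop Q a smp k xNew yNew s j)

/-- State of the outer loop: the iterates, the estimates returned by the inner loops of the
previous outer iteration, and the evaluations spent so far. -/
structure State (p q : ℕ) where
  x : Vec p
  y : Vec q
  v : Vec q
  Dx : Vec p
  Dy : Vec q
  Dv : Vec q
  count : Count

/-- The estimates used at outer iteration `k`: recomputed on large batches when `q1 ∣ k`,
otherwise those returned by the previous inner loops. -/
noncomputable def refresh (Q : Problem p q Ξ Z) (a : Params) (smp : Slot → Ξ × Z) (k : ℕ)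
    (s : State p q) : State p q :=
  if k % a.q1 = 0 then
    let ex := evalDx Q a.S1 (fun i => smp (Slot.outerX k i)) s.x s.y s.v
    let ey := evalDy Q a.S1 (fun i => smp (Slot.outerY k i)) s.x s.y
    let ev := evalDv Q a.S1 (fun i => smp (Slot.outerV k i)) s.x s.y s.v
    { s with Dx := ex.1, Dy := ey.1, Dv := ev.1, count := s.count + ex.2 + ey.2 + ev.2 }
  else s

/-- Outer iteration `k`. -/
noncomputable def outerStep (Q : Problem p q Ξ Z) (a : Params) (smp : Slot → Ξ × Z) (k : ℕ)
    (s : State p q) : State p q :=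
  let s' := refresh Q a smp k s
  let xNew := s'.x - a.alpha • s'.Dx
  let ys := yLoop Q a smp k xNew ⟨s'.x, s'.y, s'.Dy, s'.count⟩ a.T
  let vs := vLoop Q a smp k xNew ys.y ⟨s'.x, s'.y, s'.v, s'.Dx, s'.Dv, ys.count⟩ a.J
  { x := xNew
    y := ys.y
    v := vs.v
    Dx := vs.Dx
    Dy := ys.Dy
    Dv := vs.Dv
    count := vs.count }

/-- ALS-SPIDER: the state after `k` outer iterations on the sample realization `smp`, started at
`(x0, y0, v0)`. (The initial estimates are irrelevant: they are recomputed at `k = 0`.) -/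
noncomputable def run (Q : Problem p q Ξ Z) (a : Params) (x0 : Vec p) (y0 v0 : Vec q)
    (smp : Slot → Ξ × Z) : ℕ → State p q
  | 0 => ⟨x0, y0, v0, 0, 0, 0, 0⟩
  | k + 1 => outerStep Q a smp k (run Q a x0 y0 v0 smp k)

/-- The random objects of a run with `K` outer iterations. Each `smp s` is a pair `(ξ, δ)` with
the prescribed laws of the components, the pairs are mutually independent, and `κ` is the index
of the output: uniform on `{0, …, K - 1}` and independent of all the samples. -/
structure IsSampling {Ω : Type*} [MeasurableSpace Ω] (Q : Problem p q Ξ Z) (P : Measure Ω)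
    (smp : Slot → Ω → Ξ × Z) (K : ℕ) (κ : Ω → Fin K) : Prop where
  measurable_smp : ∀ s, Measurable (smp s)
  law_xi : ∀ s, P.map (fun ω => (smp s ω).1) = Q.lawXi
  law_delta : ∀ s, P.map (fun ω => (smp s ω).2) = Q.lawZeta
  indep : iIndepFun smp P
  measurable_index : Measurable κ
  uniform_index : ∀ k : Fin K, P (κ ⁻¹' {k}) = (K : ℝ≥0∞)⁻¹
  indep_index : IndepFun κ (fun ω s => smp s ω) P

/-- The random point `xbar` is an `ε`-stationary point of the bilevel problem:
`Φ` is differentiable and `E ‖∇Φ (xbar)‖² ≤ ε`. -/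
def IsEpsStationary {Ω : Type*} [MeasurableSpace Ω] (Q : Problem p q Ξ Z) (P : Measure Ω)
    (xbar : Ω → Vec p) (ε : ℝ) : Prop :=
  Differentiable ℝ Q.Phi ∧
  Integrable (fun ω => ‖gradient Q.Phi (xbar ω)‖ ^ 2) P ∧
  ∫ ω, ‖gradient Q.Phi (xbar ω)‖ ^ 2 ∂P ≤ ε

end Algorithm

/-! ### The prescribed step sizes -/

namespace Consts

/-- `L_gg = max {L_gxy, L_gyy}`. -/
noncomputable def Lgg (c : Consts) : ℝ := max c.Lgxy c.Lgyy

/-- The constant `L_Φ`. -/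
noncomputable def LPhi (c : Consts) : ℝ :=
  c.Lf + (2 * c.Lf * c.Lgg + c.Cf ^ 2 * c.Lgg) / c.mu
    + (c.Lf * c.Lg ^ 2 + 2 * c.Cf * c.Lg * c.Lgg) / c.mu ^ 2
    + c.Cf * c.Lg ^ 2 * c.Lgg / c.mu ^ 3

/-- The Lipschitz constant `C_y` of `y*`. -/
noncomputable def Cy (c : Consts) : ℝ := c.Lg / c.mu

/-- The Lipschitz constant `C_v` of `v*`. -/
noncomputable def Cv (c : Consts) : ℝ :=
  (c.Lf / c.mu + c.Cf * c.Lgg / c.mu ^ 2) * (1 + c.Lg / c.mu)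

/-- `M̄₁ = 4 L_f² + 4 M² L_gg²`. -/
noncomputable def Mbar (c : Consts) (M : ℝ) : ℝ := 4 * c.Lf ^ 2 + 4 * M ^ 2 * c.Lgg ^ 2

/-- `C₃ = J² + J² M² + 2 T²`. -/
noncomputable def C3 (M : ℝ) (T J : ℕ) : ℝ := (J : ℝ) ^ 2 + (J : ℝ) ^ 2 * M ^ 2 + 2 * (T : ℝ) ^ 2

/-- The step size `λ₁`; here and below `r = S₂ / q₁`. -/
noncomputable def lam1 (c : Consts) (M β : ℝ) (T J : ℕ) (r : ℝ) : ℝ :=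
  min (1 / (2 * c.Lg + 2 * c.mu))
    ((1 / 2 : ℝ) ^ (2 * T + 5) * c.mu * r / (T * c.Lg ^ 2 * β ^ 2 * C3 M T J))

/-- The step size `λ₂`. -/
noncomputable def lam2 (c : Consts) (M β η : ℝ) (T J : ℕ) (r : ℝ) : ℝ :=
  min (1 / (2 * c.Lg + 2 * c.mu))
    (min (c.mu ^ 2 * c.lam1 M β T J r * β / (128 * c.Mbar M * J * η))
      ((1 / 2 : ℝ) ^ (2 * (T + J) + 6) * c.mu * r
        / (J * (c.Lg ^ 2 * η ^ 2 + T * c.Mbar M * β * η))))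

/-- `C₄`. -/
noncomputable def C4 (c : Consts) (M β : ℝ) (T J : ℕ) (r : ℝ) : ℝ :=
  192 * c.lam1 M β T J r * β * c.Lg ^ 2 * (1 + r⁻¹ * C3 M T J)

/-- `C₅`. -/
noncomputable def C5 (c : Consts) (M β η : ℝ) (T J : ℕ) (r : ℝ) : ℝ :=
  192 * c.lam2 M β η T J r * η * c.Mbar M * (1 + c.Cy ^ 2 + r⁻¹ * J)

/-- The step size `α`, the minimum of seven numbers. -/
noncomputable def alpha (c : Consts) (M β η : ℝ) (T J : ℕ) (r : ℝ) : ℝ :=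
  min (c.mu * c.lam1 M β T J r * β / (96 * c.Cy ^ 2 + 8 * c.Mbar M))
    (min (c.mu * c.lam2 M β η T J r * η / (48 * (c.Lg ^ 2 + c.Cv ^ 2)))
      (min (1 / (6 * c.LPhi))
        (min (√r / (12 * √(c.Mbar M)))
          (min (c.mu / c.C4 M β T J r)
            (min (c.mu / c.C5 M β η T J r)
              ((1 / 2 : ℝ) ^ (2 * (T + J) + 3) * r
                / (c.Mbar M * T * β + c.Lg ^ 2 * η)))))))

/-- The parameters of the run: the prescribed step sizes, with `r = S₂ / q₁`. -/
noncomputable def params (c : Consts) (M β η : ℝ) (T J S1 S2 q1 : ℕ) : Params where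
  T := T
  J := J
  q1 := q1
  S1 := S1
  S2 := S2
  lam1 := c.lam1 M β T J (S2 / q1)
  lam2 := c.lam2 M β η T J (S2 / q1)
  alpha := c.alpha M β η T J (S2 / q1)
  beta := β
  eta := η
  M := M

end Consts

end ALSSpider

open ALSSpider

namespace ALSSpider

/-! ### Smooth strongly convex functions -/

section Smooth

open Filter Topology

variable {E : Type*} [NormedAddCommGroup E] [InnerProductSpace ℝ E]

/-! The potential `Φ(x_k) + ‖y_k - y*(x_k)‖² + ‖v_k - v*(x_k)‖²` decreases in expectation along the
run, up to the sampling error of the large batches. Here `v*(x)` solves `∇_y²g v = ∇_y f` at `(x,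
y*(x))`, and `∇Φ = ∇ₓf - ∇ₓ∇_yg v*` there (`Assumptions.hasGradientAt_Phi`). Each block of the
algorithm is thus an inexact gradient method: the `y`-steps for the strongly convex `g(x, ·)`, the
`v`-steps for a strongly convex quadratic with minimizer `v*`, the `x`-step for the smooth `Φ`.

`gradient_step_le` gives for one inner step a contraction, a negative multiple of `‖D‖²` and a
multiple of the squared error. Within an outer iteration the target moves only once, by at most a
constant times `α‖D^x‖`, and `tracking_le` absorbs this motion. The results are the pathwise
inequalities `gapY_succ_le`, `gapV_succ_le` and `Phi_succ_le`.

The errors of the estimators are controlled in expectation. A recursive update adds to the old error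
an average of increments that are centred given the past, so the cross terms vanish and the mean
square error grows by at most `1/S₂` times a squared Lipschitz bound of the displacement
(`memLp_add_noise`, `UnbiasedField.recursive_error`). The errors are reset every `q₁ = S₂`
iterations, so the growth summed over all iterations carries the factor `q₁/S₂ = 1`
(`sum_le_of_restart`). The displacements are at most step sizes times `‖D^x‖`, `‖D^y‖`, `‖D^v‖`, and
the prescribed step sizes are small enough for the negative `‖D‖²` terms to pay for them
(`Consts.Admissible.balanced`).

Summation (`sum_le_of_coupled_descent`) leaves `α/2 ∑ E‖∇Φ(x_k)‖² ≤ D + N K/S₁` with constants `D`,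
`N` free of `ε`. Dividing by `K`, both terms are of order `ε` once `K` and `S₁` are at least `b/ε`.
The cost is of order `K S₂` for the inner loops and `(K/q₁ + 1) S₁` for the restarts, that is
`ε^(-3/2)`, because `q₁ = S₂` is about `√S₁`. -/

theorem contDiff_gradient [FiniteDimensional ℝ E] [CompleteSpace E] {h : E → ℝ}
    (hh : ContDiff ℝ 2 h) : ContDiff ℝ 1 (gradient h) := by
  have key : gradient h = fun z => ∑ i, fderiv ℝ h z (stdOrthonormalBasis ℝ E i) •
      stdOrthonormalBasis ℝ E i := by
    funext z
    rw [← (stdOrthonormalBasis ℝ E).sum_repr' (gradient h z)]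
    refine Finset.sum_congr rfl fun i _ => ?_
    rw [real_inner_comm, inner_gradient_left]
  have h1 : ContDiff ℝ 1 (fderiv ℝ h) := hh.fderiv_right (by norm_num)
  rw [key]
  exact ContDiff.sum fun i _ => (h1.clm_apply contDiff_const).smul contDiff_const

/-- Differentiate `⟨∇h(t), b⟩ = Dh(t) b` in `t`. This carries the symmetry of the second derivative
over to `D(∇h)`, where the adjoint equation for the hypergradient needs it. -/
theorem inner_fderiv_gradient [FiniteDimensional ℝ E] [CompleteSpace E] {h : E → ℝ}
    (hh : ContDiff ℝ 2 h) (z a b : E) :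
    inner ℝ (fderiv ℝ (gradient h) z a) b = fderiv ℝ (fderiv ℝ h) z a b := by
  have h1 : ContDiff ℝ 1 (fderiv ℝ h) := hh.fderiv_right (by norm_num)
  have h2 : HasFDerivAt (gradient h) (fderiv ℝ (gradient h) z) z :=
    ((contDiff_gradient hh).differentiable (by norm_num) z).hasFDerivAt
  have h3 : HasFDerivAt (fderiv ℝ h) (fderiv ℝ (fderiv ℝ h) z) z :=
    (h1.differentiable (by norm_num) z).hasFDerivAt
  have h4 := h2.inner ℝ (hasFDerivAt_const b z)
  have h5 := h3.clm_apply (hasFDerivAt_const b z)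
  have h6 : (fun t => inner ℝ (gradient h t) b) = fun t => fderiv ℝ h t b := by
    funext t; exact inner_gradient_left
  rw [h6] at h4
  have := congrArg (fun T => T a) (h4.unique h5)
  simpa [fderivInnerCLM_apply] using this

theorem fderiv_gradient_symm [FiniteDimensional ℝ E] [CompleteSpace E] {h : E → ℝ}
    (hh : ContDiff ℝ 2 h) (z a b : E) :
    inner ℝ (fderiv ℝ (gradient h) z a) b = inner ℝ a (fderiv ℝ (gradient h) z b) := by
  rw [real_inner_comm (fderiv ℝ (gradient h) z b) a, inner_fderiv_gradient hh,
    inner_fderiv_gradient hh]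
  exact (hh.contDiffAt.isSymmSndFDerivAt (by simp)) a b

/-- Divide the strong convexity inequality on the segment from `y` to `y'` by `t` and let `t` tend
to `0` from the right. -/
theorem StrongConvexOn.gradient_le [CompleteSpace E] {h : E → ℝ} {μ : ℝ}
    (hc : StrongConvexOn Set.univ μ h) {y : E} (hd : DifferentiableAt ℝ h y) (y' : E) :
    h y + inner ℝ (gradient h y) (y' - y) + μ / 2 * ‖y' - y‖ ^ 2 ≤ h y' := by
  have hline : HasDerivAt (fun t : ℝ => h (y + t • (y' - y))) (inner ℝ (gradient h y) (y' - y)) 0 := by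
    have h1 : HasDerivAt (fun t : ℝ => y + t • (y' - y)) (y' - y) 0 := by
      simpa using ((hasDerivAt_id (0 : ℝ)).smul_const (y' - y)).const_add y
    have h2 : HasFDerivAt h (fderiv ℝ h y) (y + (0 : ℝ) • (y' - y)) := by
      simpa using hd.hasFDerivAt
    have := h2.comp_hasDerivAt (0 : ℝ) h1
    rwa [inner_gradient_left]
  have hlim := hline.tendsto_slope_zero_right
  have hlim2 : Tendsto (fun t : ℝ => h y' - h y - (1 - t) * (μ / 2 * ‖y' - y‖ ^ 2)) (𝓝[>] 0)
      (𝓝 (h y' - h y - (1 - 0) * (μ / 2 * ‖y' - y‖ ^ 2))) := by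
    refine Tendsto.mono_left (Continuous.tendsto ?_ 0) nhdsWithin_le_nhds
    fun_prop
  have hle : ∀ᶠ t : ℝ in 𝓝[>] 0, t⁻¹ • (h (y + (0 + t) • (y' - y)) - h (y + (0 : ℝ) • (y' - y)))
      ≤ h y' - h y - (1 - t) * (μ / 2 * ‖y' - y‖ ^ 2) := by
    have : Set.Ioo (0 : ℝ) 1 ∈ 𝓝[>] (0 : ℝ) := Ioo_mem_nhdsGT one_pos
    filter_upwards [this] with t ht
    have := hc.2 (Set.mem_univ y) (Set.mem_univ y') 
      (sub_nonneg.2 ht.2.le) ht.1.le (sub_add_cancel 1 t)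
    have e : (1 - t) • y + t • y' = y + (0 + t) • (y' - y) := by module
    rw [e, norm_sub_rev] at this
    simp only [smul_eq_mul, zero_smul, add_zero] at this ⊢
    rw [inv_mul_le_iff₀ ht.1]
    nlinarith
  have := le_of_tendsto_of_tendsto hlim hlim2 hle
  linarith

/-- The descent lemma. The difference of the two sides along the segment, `φ`, has nonpositive
derivative by Cauchy-Schwarz and the Lipschitz bound, so no integration is needed. -/
theorem le_add_inner_gradient_add_sq [CompleteSpace E] {h : E → ℝ} {L : ℝ} (hd : Differentiable ℝ h)
    (hL : ∀ z w, ‖gradient h z - gradient h w‖ ≤ L * ‖z - w‖) (w z : E) :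
    h z ≤ h w + inner ℝ (gradient h w) (z - w) + L / 2 * ‖z - w‖ ^ 2 := by
  set φ : ℝ → ℝ := fun t => h (w + t • (z - w)) - t * inner ℝ (gradient h w) (z - w)
    - L * t ^ 2 / 2 * ‖z - w‖ ^ 2 with hφ
  have hder : ∀ t : ℝ, HasDerivAt φ (inner ℝ (gradient h (w + t • (z - w))) (z - w)
      - inner ℝ (gradient h w) (z - w) - L * t * ‖z - w‖ ^ 2) t := by
    intro t
    have h1 : HasDerivAt (fun t : ℝ => w + t • (z - w)) (z - w) t := by
      simpa using ((hasDerivAt_id t).smul_const (z - w)).const_add w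
    have h2 := (hd (w + t • (z - w))).hasFDerivAt.comp_hasDerivAt t h1
    rw [← inner_gradient_left] at h2
    have h3 := (hasDerivAt_id t).mul_const (inner ℝ (gradient h w) (z - w))
    have h4 := ((((hasDerivAt_pow 2 t).const_mul L).div_const 2).mul_const (‖z - w‖ ^ 2))
    refine ((h2.sub h3).sub h4).congr_deriv ?_
    simp only [one_mul, Nat.add_one_sub_one, pow_one]
    push_cast
    ring
  have hanti : AntitoneOn φ (Set.Icc 0 1) := by
    refine antitoneOn_of_deriv_nonpos (convex_Icc 0 1)
      (fun t _ => (hder t).continuousAt.continuousWithinAt)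
      (fun t _ => (hder t).differentiableAt.differentiableWithinAt) fun t ht => ?_
    rw [interior_Icc] at ht
    rw [(hder t).deriv, ← inner_sub_left]
    have h1 := real_inner_le_norm (gradient h (w + t • (z - w)) - gradient h w) (z - w)
    have h2 := hL (w + t • (z - w)) w
    rw [add_sub_cancel_left, norm_smul, Real.norm_of_nonneg ht.1.le] at h2
    nlinarith [norm_nonneg (z - w), mul_le_mul_of_nonneg_right h2 (norm_nonneg (z - w))]
  have := hanti (Set.left_mem_Icc.2 zero_le_one) (Set.right_mem_Icc.2 zero_le_one) zero_le_one
  simp only [hφ, one_smul, zero_smul, add_sub_cancel, add_zero] at this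
  linarith

/-- Bound `h m` below by strong convexity at `y`, and above by the value of `h` after the gradient
step of length `1/L`, which the descent lemma estimates. The term `‖∇h‖²` is kept because it later
yields the negative `‖D‖²` that pays for the displacements. -/
theorem StrongConvexOn.inner_gradient_ge [CompleteSpace E] {h : E → ℝ} {μ L : ℝ} (hLpos : 0 < L)
    (hc : StrongConvexOn Set.univ μ h) (hd : Differentiable ℝ h)
    (hL : ∀ z w, ‖gradient h z - gradient h w‖ ≤ L * ‖z - w‖) {m : E} (hm : ∀ z, h m ≤ h z)
    (y : E) :
    μ / 2 * ‖y - m‖ ^ 2 + ‖gradient h y‖ ^ 2 / (2 * L) ≤ inner ℝ (gradient h y) (y - m) := by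
  have h1 := StrongConvexOn.gradient_le hc (hd y) m
  have h2 := le_add_inner_gradient_add_sq hd hL y (y - L⁻¹ • gradient h y)
  have h3 := hm (y - L⁻¹ • gradient h y)
  have e1 : y - L⁻¹ • gradient h y - y = -(L⁻¹ • gradient h y) := by abel
  have e2 : m - y = -(y - m) := by abel
  rw [e1, inner_neg_right, norm_neg, norm_smul, inner_smul_right, real_inner_self_eq_norm_sq,
    Real.norm_of_nonneg (by positivity)] at h2
  rw [e2, inner_neg_right, norm_neg] at h1
  have e3 : L / 2 * (L⁻¹ * ‖gradient h y‖) ^ 2 = ‖gradient h y‖ ^ 2 / (2 * L) := by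
    field_simp
  have e4 : L⁻¹ * ‖gradient h y‖ ^ 2 = 2 * (‖gradient h y‖ ^ 2 / (2 * L)) := by
    field_simp
  rw [e3, e4] at h2
  linarith

theorem StrongConvexOn.exists_isMin [FiniteDimensional ℝ E] [CompleteSpace E] {h : E → ℝ} {μ : ℝ}
    (hμ : 0 < μ) (hc : StrongConvexOn Set.univ μ h) (hd : Differentiable ℝ h) :
    ∃ m, ∀ z, h m ≤ h z := by
  refine hd.continuous.exists_forall_le ?_
  have hlow : ∀ z, h 0 - ‖gradient h 0‖ * ‖z‖ + μ / 2 * ‖z‖ ^ 2 ≤ h z := by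
    intro z
    have h1 := StrongConvexOn.gradient_le hc (hd 0) z
    have h2 := neg_le_of_abs_le (abs_real_inner_le_norm (gradient h 0) (z - 0))
    rw [sub_zero] at h1 h2
    linarith
  refine tendsto_atTop_mono hlow ?_
  have : Tendsto (fun s : ℝ => h 0 + s * (μ / 2 * s - ‖gradient h 0‖)) atTop atTop := by
    refine tendsto_atTop_add_const_left _ _ (tendsto_id.atTop_mul_atTop₀ ?_)
    exact tendsto_atTop_add_const_right _ _ (tendsto_id.const_mul_atTop (by positivity))
  refine (this.comp (tendsto_norm_cocompact_atTop (E := E))).congr fun z => ?_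
  simp only [Function.comp]; ring

/-- A damped inexact gradient step contracts towards the minimizer. -/
theorem gradient_step_le {A e a : E} {μ L l η : ℝ} (hμ : 0 < μ) (hL : 0 < L)
    (hA : μ / 2 * ‖a‖ ^ 2 + ‖A‖ ^ 2 / (2 * L) ≤ inner ℝ A a)
    (hl : 0 < l) (hl1 : l ≤ 1 / (2 * L + 2 * μ)) (hη : 0 < η) (hη1 : η < 1) :
    ‖a - (l * η) • (A + e)‖ ^ 2 ≤ (1 - l * η * μ / 2) * ‖a‖ ^ 2
      - η / 2 * l ^ 2 * ‖A + e‖ ^ 2 + 5 * (l * η) / μ * ‖e‖ ^ 2 := by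
  rw [le_div_iff₀ (by positivity)] at hl1
  have hlL : 2 * l ≤ 1 / L := by rw [le_div_iff₀ hL]; nlinarith
  have hlμ : 2 * l ≤ 1 / μ := by rw [le_div_iff₀ hμ]; nlinarith
  have hn : ‖A + e‖ ^ 2 = ‖A‖ ^ 2 + 2 * inner ℝ A e + ‖e‖ ^ 2 := norm_add_sq_real A e
  have h3 : 3 / 2 * inner ℝ A e ≥ -(‖A‖ ^ 2 / 2 + 9 / 8 * ‖e‖ ^ 2) := by
    have := norm_nonneg (A + (3 / 2 : ℝ) • e)
    have h := norm_add_sq_real A ((3 / 2 : ℝ) • e)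
    rw [inner_smul_right, norm_smul, Real.norm_of_nonneg (by norm_num)] at h
    nlinarith [sq_nonneg ‖A + (3 / 2 : ℝ) • e‖]
  have h4 : 2 * inner ℝ e a ≥ -(μ / 2 * ‖a‖ ^ 2 + 2 * (1 / μ) * ‖e‖ ^ 2) := by
    have h := norm_add_sq_real ((2 / μ) • e) a
    rw [inner_smul_left, norm_smul, Real.norm_of_nonneg (by positivity)] at h
    have h5 : 0 ≤ μ / 2 * ‖(2 / μ) • e + a‖ ^ 2 := by positivity
    rw [h] at h5
    simp only [conj_trivial] at h5
    have e1 : μ / 2 * ((2 / μ * ‖e‖) ^ 2 + 2 * (2 / μ * inner ℝ e a) + ‖a‖ ^ 2)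
        = μ / 2 * ‖a‖ ^ 2 + 2 * (1 / μ) * ‖e‖ ^ 2 + 2 * inner ℝ e a := by field_simp; ring
    linarith
  rw [norm_sub_sq_real, inner_smul_right, norm_smul, Real.norm_of_nonneg (by positivity),
    inner_add_right, real_inner_comm A a, real_inner_comm e a]
  have h6 : 2 * (l * η) * inner ℝ A a ≥
      l * η * μ * ‖a‖ ^ 2 + 2 * l ^ 2 * η * ‖A‖ ^ 2 := by
    have h7 : 2 * l * ‖A‖ ^ 2 ≤ 1 / L * ‖A‖ ^ 2 := by gcongr
    have e1 : ‖A‖ ^ 2 / (2 * L) = 1 / L * ‖A‖ ^ 2 / 2 := by field_simp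
    rw [e1] at hA
    have : 0 < l * η := by positivity
    nlinarith
  have h8 : l * η * (2 * inner ℝ e a) ≥ -(l * η) * (μ / 2 * ‖a‖ ^ 2 + 2 * (1 / μ) * ‖e‖ ^ 2) := by
    have : 0 < l * η := by positivity
    nlinarith
  have h9 : (l * η) ^ 2 * ‖A + e‖ ^ 2 ≤ l ^ 2 * η * ‖A + e‖ ^ 2 := by
    have : (l * η) ^ 2 ≤ l ^ 2 * η := by nlinarith [sq_nonneg l, mul_pos hη (sub_pos.2 hη1)]
    gcongr
  -- The `3/2` is the `1` of the quadratic term of the expansion plus the `1/2` that survives with a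
  -- minus sign. Inside, the sides differ by `‖A - 3e‖²/2`, and `2‖A‖²` is what `h6` supplies.
  have h10 : l ^ 2 * η * (3 / 2 * ‖A + e‖ ^ 2) ≤ l ^ 2 * η * (2 * ‖A‖ ^ 2 + 6 * ‖e‖ ^ 2) := by
    have h11 : 3 / 2 * ‖A + e‖ ^ 2 ≤ 2 * ‖A‖ ^ 2 + 6 * ‖e‖ ^ 2 := by
      have h := norm_sub_sq_real A ((3 : ℝ) • e)
      rw [inner_smul_right, norm_smul, Real.norm_of_nonneg (by norm_num)] at h
      rw [hn]
      nlinarith [sq_nonneg ‖A - (3 : ℝ) • e‖]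
    gcongr
  -- The final constant `5` is this `3` plus the `2` from Young's inequality in `h4`.
  have h12 : l ^ 2 * η * (6 * ‖e‖ ^ 2) ≤ 3 * (l * η) * (1 / μ) * ‖e‖ ^ 2 := by
    have : 0 ≤ l * η * ‖e‖ ^ 2 := by positivity
    nlinarith
  have e2 : 5 * (l * η) / μ * ‖e‖ ^ 2 = 5 * (l * η) * (1 / μ) * ‖e‖ ^ 2 := by ring
  rw [e2, mul_pow] 
  rw [mul_pow] at h9
  nlinarith

end Smooth

/-! ### Partial derivatives on `ℝ^p × ℝ^q` -/

section Partial

variable {p q : ℕ}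

theorem pt_sub (x x' : Vec p) (y y' : Vec q) : pt x y - pt x' y' = pt (x - x') (y - y') := rfl

theorem norm_pt_sq (x : Vec p) (y : Vec q) : ‖pt x y‖ ^ 2 = ‖x‖ ^ 2 + ‖y‖ ^ 2 :=
  WithLp.prod_norm_sq_eq_of_L2 _

theorem norm_fst_le (z : Pair p q) : ‖z.fst‖ ≤ ‖z‖ := by
  have h := WithLp.prod_norm_sq_eq_of_L2 z
  exact abs_le_of_sq_le_sq' (by nlinarith [sq_nonneg ‖z.snd‖]) (norm_nonneg z) |>.2

theorem norm_snd_le (z : Pair p q) : ‖z.snd‖ ≤ ‖z‖ := by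
  have h := WithLp.prod_norm_sq_eq_of_L2 z
  exact abs_le_of_sq_le_sq' (by nlinarith [sq_nonneg ‖z.fst‖]) (norm_nonneg z) |>.2

/-- The embedding `x ↦ (x, 0)`. -/
noncomputable def inX (p q : ℕ) : Vec p →L[ℝ] Pair p q :=
  ((WithLp.prodContinuousLinearEquiv 2 ℝ (Vec p) (Vec q)).symm : _ →L[ℝ] _).comp
    (ContinuousLinearMap.inl ℝ (Vec p) (Vec q))

/-- The embedding `y ↦ (0, y)`. -/
noncomputable def inY (p q : ℕ) : Vec q →L[ℝ] Pair p q :=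
  ((WithLp.prodContinuousLinearEquiv 2 ℝ (Vec p) (Vec q)).symm : _ →L[ℝ] _).comp
    (ContinuousLinearMap.inr ℝ (Vec p) (Vec q))

theorem inX_apply (x : Vec p) : inX p q x = pt x 0 := rfl

theorem inY_apply (y : Vec q) : inY p q y = pt 0 y := rfl

theorem norm_inY (y : Vec q) : ‖inY p q y‖ = ‖y‖ := by
  have h := norm_pt_sq (0 : Vec p) y
  rw [inY_apply]
  have : ‖pt (0 : Vec p) y‖ ^ 2 = ‖y‖ ^ 2 := by rw [h]; simp
  exact (sq_eq_sq₀ (norm_nonneg _) (norm_nonneg _)).1 this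

theorem hasFDerivAt_pt_left (x : Vec p) (y : Vec q) :
    HasFDerivAt (fun x => pt x y) (inX p q) x := by
  have h : (fun x => pt x y) = fun x => inX p q x + pt 0 y := by
    funext x
    rw [inX_apply]
    exact congrArg₂ pt (add_zero x).symm (zero_add y).symm
  rw [h]
  exact (inX p q).hasFDerivAt.add_const _

theorem hasFDerivAt_pt_right (x : Vec p) (y : Vec q) :
    HasFDerivAt (fun y => pt x y) (inY p q) y := by
  have h : (fun y => pt x y) = fun y => inY p q y + pt x 0 := by
    funext y
    rw [inY_apply]
    exact congrArg₂ pt (zero_add x).symm (add_zero y).symm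
  rw [h]
  exact (inY p q).hasFDerivAt.add_const _

theorem inner_inX (z : Pair p q) (x : Vec p) : inner ℝ z (inX p q x) = inner ℝ z.fst x := by
  rw [inX_apply, WithLp.prod_inner_apply]; simp

theorem inner_inY (z : Pair p q) (y : Vec q) : inner ℝ z (inY p q y) = inner ℝ z.snd y := by
  rw [inY_apply, WithLp.prod_inner_apply]; simp

theorem gradX_eq {h : Pair p q → ℝ} {z : Pair p q} (hd : DifferentiableAt ℝ h z) :
    gradX h z = (gradient h z).fst := by
  refine HasGradientAt.gradient ?_
  rw [hasGradientAt_iff_hasFDerivAt]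
  have h1 : HasFDerivAt h (fderiv ℝ h z) (pt z.fst z.snd) := hd.hasFDerivAt
  refine (h1.comp z.fst (hasFDerivAt_pt_left z.fst z.snd)).congr_fderiv ?_
  ext1 x
  rw [ContinuousLinearMap.comp_apply, ← inner_gradient_left, inner_inX]
  rfl

theorem gradY_eq {h : Pair p q → ℝ} {z : Pair p q} (hd : DifferentiableAt ℝ h z) :
    gradY h z = (gradient h z).snd := by
  refine HasGradientAt.gradient ?_
  rw [hasGradientAt_iff_hasFDerivAt]
  have h1 : HasFDerivAt h (fderiv ℝ h z) (pt z.fst z.snd) := hd.hasFDerivAt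
  refine (h1.comp z.snd (hasFDerivAt_pt_right z.fst z.snd)).congr_fderiv ?_
  ext1 x
  rw [ContinuousLinearMap.comp_apply, ← inner_gradient_left, inner_inY]
  rfl

/-- With this and `hessYY_apply`, both matrices are blocks of `D(∇h)`, so norm bounds, symmetry and
measurability need to be proved only for the full gradient. -/
theorem jacXY_apply {h : Pair p q → ℝ} (hh : ContDiff ℝ 2 h) (z : Pair p q) (v : Vec q) :
    jacXY h z v = (fderiv ℝ (gradient h) z (inY p q v)).fst := by
  have h1 : (fun y => gradX h (pt z.fst y)) =
      fun y => WithLp.fstL 2 ℝ (Vec p) (Vec q) (gradient h (pt z.fst y)) := by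
    funext y
    exact gradX_eq (hh.differentiable (by norm_num) _)
  have h2 : HasFDerivAt (gradient h) (fderiv ℝ (gradient h) z) (pt z.fst z.snd) :=
    ((contDiff_gradient hh).differentiable (by norm_num) z).hasFDerivAt
  have h3 := (WithLp.fstL 2 ℝ (Vec p) (Vec q)).hasFDerivAt.comp z.snd
    (h2.comp z.snd (hasFDerivAt_pt_right z.fst z.snd))
  have h4 : jacXY h z = _ := (congrArg (fun φ => fderiv ℝ φ z.snd) h1).trans h3.fderiv
  rw [h4]; rfl

theorem hessYY_apply {h : Pair p q → ℝ} (hh : ContDiff ℝ 2 h) (z : Pair p q) (v : Vec q) :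
    hessYY h z v = (fderiv ℝ (gradient h) z (inY p q v)).snd := by
  have h1 : (fun y => gradY h (pt z.fst y)) =
      fun y => WithLp.sndL 2 ℝ (Vec p) (Vec q) (gradient h (pt z.fst y)) := by
    funext y
    exact gradY_eq (hh.differentiable (by norm_num) _)
  have h2 : HasFDerivAt (gradient h) (fderiv ℝ (gradient h) z) (pt z.fst z.snd) :=
    ((contDiff_gradient hh).differentiable (by norm_num) z).hasFDerivAt
  have h3 := (WithLp.sndL 2 ℝ (Vec p) (Vec q)).hasFDerivAt.comp z.snd
    (h2.comp z.snd (hasFDerivAt_pt_right z.fst z.snd))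
  have h4 : hessYY h z = _ := (congrArg (fun φ => fderiv ℝ φ z.snd) h1).trans h3.fderiv
  rw [h4]; rfl

theorem norm_fderiv_le_of_lipReal {E V : Type*} [NormedAddCommGroup E] [NormedSpace ℝ E]
    [NormedAddCommGroup V] [NormedSpace ℝ V] {L : ℝ} (hL : 0 ≤ L) {h : E → V} (hh : LipReal L h)
    (z : E) : ‖fderiv ℝ h z‖ ≤ L := by
  exact norm_fderiv_le_of_lip' ℝ hL (Filter.Eventually.of_forall fun w => hh w z)

theorem norm_gradient_le_of_lipReal {E : Type*} [NormedAddCommGroup E] [InnerProductSpace ℝ E]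
    [CompleteSpace E] {L : ℝ} (hL : 0 ≤ L) {h : E → ℝ} (hh : LipReal L h)
    (z : E) : ‖gradient h z‖ ≤ L := by
  rw [gradient, LinearIsometryEquiv.norm_map]
  exact norm_fderiv_le_of_lipReal hL hh z

end Partial

/-! ### The search directions of a pair of functions -/

section Fields

variable {p q : ℕ} {c : Consts} {f g : Pair p q → ℝ}

/-- `∇_y² g v - ∇_y f`. -/
noncomputable def fieldV (f g : Pair p q → ℝ) (z : Pair p q) (v : Vec q) : Vec q :=
  hessYY g z v - gradY f z

/-- `∇ₓ f - ∇ₓ∇_y g v`. -/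
noncomputable def fieldX (f g : Pair p q → ℝ) (z : Pair p q) (v : Vec q) : Vec p :=
  gradX f z - jacXY g z v

theorem LipschitzConds.norm_gradX_sub_le (h : LipschitzConds c f g) (hf : ContDiff ℝ 1 f)
    (z w : Pair p q) : ‖gradX f z - gradX f w‖ ≤ c.Lf * ‖z - w‖ := by
  rw [gradX_eq (hf.differentiable (by norm_num) _), gradX_eq (hf.differentiable (by norm_num) _)]
  exact (norm_fst_le (gradient f z - gradient f w)).trans (h.grad_f_lip z w)

theorem LipschitzConds.norm_gradY_sub_le (h : LipschitzConds c f g) (hf : ContDiff ℝ 1 f)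
    (z w : Pair p q) : ‖gradY f z - gradY f w‖ ≤ c.Lf * ‖z - w‖ := by
  rw [gradY_eq (hf.differentiable (by norm_num) _), gradY_eq (hf.differentiable (by norm_num) _)]
  exact (norm_snd_le (gradient f z - gradient f w)).trans (h.grad_f_lip z w)

theorem LipschitzConds.norm_gradY_g_sub_le (h : LipschitzConds c f g) (hg : ContDiff ℝ 2 g)
    (z w : Pair p q) : ‖gradY g z - gradY g w‖ ≤ c.Lg * ‖z - w‖ := by
  rw [gradY_eq (hg.differentiable (by norm_num) _), gradY_eq (hg.differentiable (by norm_num) _)]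
  exact (norm_snd_le (gradient g z - gradient g w)).trans (h.grad_g_lip z w)

theorem LipschitzConds.norm_gradX_le (h : LipschitzConds c f g) (hc : c.Admissible)
    (hf : ContDiff ℝ 1 f) (z : Pair p q) : ‖gradX f z‖ ≤ c.Cf := by
  rw [gradX_eq (hf.differentiable (by norm_num) _)]
  exact (norm_fst_le _).trans (norm_gradient_le_of_lipReal hc.Cf_nonneg h.f_lip z)

theorem LipschitzConds.norm_gradY_le (h : LipschitzConds c f g) (hc : c.Admissible)
    (hf : ContDiff ℝ 1 f) (z : Pair p q) : ‖gradY f z‖ ≤ c.Cf := by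
  rw [gradY_eq (hf.differentiable (by norm_num) _)]
  exact (norm_snd_le _).trans (norm_gradient_le_of_lipReal hc.Cf_nonneg h.f_lip z)

theorem LipschitzConds.norm_fderiv_gradient_inY_le (h : LipschitzConds c f g) (hc : c.Admissible)
    (z : Pair p q) (v : Vec q) : ‖fderiv ℝ (gradient g) z (inY p q v)‖ ≤ c.Lg * ‖v‖ := by
  have := (fderiv ℝ (gradient g) z).le_of_opNorm_le
    (norm_fderiv_le_of_lipReal hc.Lg_pos.le h.grad_g_lip z) (inY p q v)
  rwa [norm_inY] at this

theorem LipschitzConds.norm_jacXY_le (h : LipschitzConds c f g) (hc : c.Admissible)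
    (hg : ContDiff ℝ 2 g) (z : Pair p q) (v : Vec q) : ‖jacXY g z v‖ ≤ c.Lg * ‖v‖ := by
  rw [jacXY_apply hg]
  exact (norm_fst_le _).trans (h.norm_fderiv_gradient_inY_le hc z v)

theorem LipschitzConds.norm_hessYY_le (h : LipschitzConds c f g) (hc : c.Admissible)
    (hg : ContDiff ℝ 2 g) (z : Pair p q) (v : Vec q) : ‖hessYY g z v‖ ≤ c.Lg * ‖v‖ := by
  rw [hessYY_apply hg]
  exact (norm_snd_le _).trans (h.norm_fderiv_gradient_inY_le hc z v)

theorem Consts.Admissible.Lgg_nonneg (hc : c.Admissible) : 0 ≤ c.Lgg :=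
  hc.Lgxy_nonneg.trans (le_max_left _ _)

theorem LipschitzConds.norm_jacXY_sub_le (h : LipschitzConds c f g)
    (z w : Pair p q) (v : Vec q) {M : ℝ} (hv : ‖v‖ ≤ M) (hc : c.Admissible) :
    ‖jacXY g z v - jacXY g w v‖ ≤ M * c.Lgg * ‖z - w‖ := by
  have h1 := (jacXY g z - jacXY g w).le_opNorm v
  have h2 : ‖jacXY g z - jacXY g w‖ ≤ c.Lgg * ‖z - w‖ :=
    (h.jac_g_lip z w).trans (mul_le_mul_of_nonneg_right (le_max_left _ _) (norm_nonneg _))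
  have hL := hc.Lgg_nonneg
  calc ‖jacXY g z v - jacXY g w v‖ ≤ ‖jacXY g z - jacXY g w‖ * ‖v‖ := h1
    _ ≤ c.Lgg * ‖z - w‖ * M := by gcongr
    _ = M * c.Lgg * ‖z - w‖ := by ring

theorem LipschitzConds.norm_hessYY_sub_le (h : LipschitzConds c f g)
    (z w : Pair p q) (v : Vec q) {M : ℝ} (hv : ‖v‖ ≤ M) (hc : c.Admissible) :
    ‖hessYY g z v - hessYY g w v‖ ≤ M * c.Lgg * ‖z - w‖ := by
  have h1 := (hessYY g z - hessYY g w).le_opNorm v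
  have h2 : ‖hessYY g z - hessYY g w‖ ≤ c.Lgg * ‖z - w‖ :=
    (h.hess_g_lip z w).trans (mul_le_mul_of_nonneg_right (le_max_right _ _) (norm_nonneg _))
  have hL := hc.Lgg_nonneg
  calc ‖hessYY g z v - hessYY g w v‖ ≤ ‖hessYY g z - hessYY g w‖ * ‖v‖ := h1
    _ ≤ c.Lgg * ‖z - w‖ * M := by gcongr
    _ = M * c.Lgg * ‖z - w‖ := by ring

/-- Half of `M̄₁` bounds the squared Lipschitz constant of both search directions in `(x, y)` for
`‖v‖ ≤ M`. The other half is used up when a variation in `v` is split off by `‖a + b‖² ≤ 2‖a‖² +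
2‖b‖²`. -/
theorem Consts.sq_le_Mbar (c : Consts) (M : ℝ) : (c.Lf + M * c.Lgg) ^ 2 ≤ c.Mbar M / 2 := by
  unfold Consts.Mbar
  nlinarith [sq_nonneg (c.Lf - M * c.Lgg)]

theorem LipschitzConds.norm_fieldV_sub_le (h : LipschitzConds c f g) (hc : c.Admissible)
    (hf : ContDiff ℝ 1 f) {M : ℝ} {v : Vec q} (hv : ‖v‖ ≤ M) (z w : Pair p q) :
    ‖fieldV f g z v - fieldV f g w v‖ ≤ (c.Lf + M * c.Lgg) * ‖z - w‖ := by
  have e : fieldV f g z v - fieldV f g w v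
      = (hessYY g z v - hessYY g w v) - (gradY f z - gradY f w) := by
    unfold fieldV; abel
  rw [e]
  refine (norm_sub_le _ _).trans ?_
  have := h.norm_hessYY_sub_le z w v hv hc
  have := h.norm_gradY_sub_le hf z w
  linarith

theorem LipschitzConds.norm_fieldX_sub_le (h : LipschitzConds c f g) (hc : c.Admissible)
    (hf : ContDiff ℝ 1 f) {M : ℝ} {v : Vec q} (hv : ‖v‖ ≤ M) (z w : Pair p q) :
    ‖fieldX f g z v - fieldX f g w v‖ ≤ (c.Lf + M * c.Lgg) * ‖z - w‖ := by
  have e : fieldX f g z v - fieldX f g w v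
      = (gradX f z - gradX f w) - (jacXY g z v - jacXY g w v) := by
    unfold fieldX; abel
  rw [e]
  refine (norm_sub_le _ _).trans ?_
  have := h.norm_jacXY_sub_le z w v hv hc
  have := h.norm_gradX_sub_le hf z w
  linarith

theorem LipschitzConds.sq_norm_fieldV_sub_le (h : LipschitzConds c f g) (hc : c.Admissible)
    (hf : ContDiff ℝ 1 f) {M : ℝ} {v : Vec q} (hv : ‖v‖ ≤ M) (z w : Pair p q) :
    ‖fieldV f g z v - fieldV f g w v‖ ^ 2 ≤ c.Mbar M / 2 * ‖z - w‖ ^ 2 := by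
  have h1 := h.norm_fieldV_sub_le hc hf hv z w
  have h2 := pow_le_pow_left₀ (norm_nonneg _) h1 2
  rw [mul_pow] at h2
  exact h2.trans (mul_le_mul_of_nonneg_right (c.sq_le_Mbar M) (sq_nonneg _))

theorem LipschitzConds.sq_norm_fieldX_sub_le (h : LipschitzConds c f g) (hc : c.Admissible)
    (hf : ContDiff ℝ 1 f) {M : ℝ} {v : Vec q} (hv : ‖v‖ ≤ M) (z w : Pair p q) :
    ‖fieldX f g z v - fieldX f g w v‖ ^ 2 ≤ c.Mbar M / 2 * ‖z - w‖ ^ 2 := by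
  have h1 := h.norm_fieldX_sub_le hc hf hv z w
  have h2 := pow_le_pow_left₀ (norm_nonneg _) h1 2
  rw [mul_pow] at h2
  exact h2.trans (mul_le_mul_of_nonneg_right (c.sq_le_Mbar M) (sq_nonneg _))

theorem sq_norm_add_le_two {V : Type*} [SeminormedAddCommGroup V] (a b : V) :
    ‖a + b‖ ^ 2 ≤ 2 * ‖a‖ ^ 2 + 2 * ‖b‖ ^ 2 := by
  have h := pow_le_pow_left₀ (norm_nonneg _) (norm_add_le a b) 2
  nlinarith [sq_nonneg (‖a‖ - ‖b‖)]

/-- Move the point with `v` fixed, then move `v` at the point `w`. Only the first move needs `‖v‖ ≤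
M`; the second is linear in `v - v'` with norm at most `L_g`. -/
theorem LipschitzConds.sq_norm_fieldV_sub_le' (h : LipschitzConds c f g) (hc : c.Admissible)
    (hf : ContDiff ℝ 1 f) (hg : ContDiff ℝ 2 g) {M : ℝ} {v : Vec q} (hv : ‖v‖ ≤ M)
    (v' : Vec q) (z w : Pair p q) :
    ‖fieldV f g z v - fieldV f g w v'‖ ^ 2
      ≤ c.Mbar M * ‖z - w‖ ^ 2 + 2 * c.Lg ^ 2 * ‖v - v'‖ ^ 2 := by
  have e : fieldV f g z v - fieldV f g w v'
      = (fieldV f g z v - fieldV f g w v) + hessYY g w (v - v') := by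
    unfold fieldV; rw [map_sub]; abel
  have h1 := h.sq_norm_fieldV_sub_le hc hf hv z w
  have h2 := pow_le_pow_left₀ (norm_nonneg _) (h.norm_hessYY_le hc hg w (v - v')) 2
  rw [e]
  have := sq_norm_add_le_two (fieldV f g z v - fieldV f g w v) (hessYY g w (v - v'))
  nlinarith

theorem LipschitzConds.sq_norm_fieldX_sub_le' (h : LipschitzConds c f g) (hc : c.Admissible)
    (hf : ContDiff ℝ 1 f) (hg : ContDiff ℝ 2 g) {M : ℝ} {v : Vec q} (hv : ‖v‖ ≤ M)
    (v' : Vec q) (z w : Pair p q) :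
    ‖fieldX f g z v - fieldX f g w v'‖ ^ 2
      ≤ c.Mbar M * ‖z - w‖ ^ 2 + 2 * c.Lg ^ 2 * ‖v - v'‖ ^ 2 := by
  have e : fieldX f g z v - fieldX f g w v'
      = (fieldX f g z v - fieldX f g w v) + -jacXY g w (v - v') := by
    unfold fieldX; rw [map_sub]; abel
  have h1 := h.sq_norm_fieldX_sub_le hc hf hv z w
  have h2 := pow_le_pow_left₀ (norm_nonneg _) (h.norm_jacXY_le hc hg w (v - v')) 2
  rw [e]
  have := sq_norm_add_le_two (fieldX f g z v - fieldX f g w v) (-jacXY g w (v - v'))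
  rw [norm_neg] at this
  nlinarith

end Fields

/-! ### Projection onto the ball -/

section Projection

variable {q : ℕ} {M : ℝ}

theorem norm_projBall_le (hM : 0 ≤ M) (w : Vec q) : ‖projBall M w‖ ≤ M := by
  unfold projBall
  split_ifs with h
  · exact h
  · have hw : 0 < ‖w‖ := hM.trans_lt (not_le.1 h)
    rw [norm_smul, Real.norm_of_nonneg (by positivity), div_mul_cancel₀ _ hw.ne']

/-- Outside the ball, put `s = M/‖w‖`. The difference of the squares is `(1 - s)((1 + s)‖w‖² - 2⟨w,
u⟩)`, and `⟨w, u⟩ ≤ s‖w‖²` for `u` in the ball. It is used with `u = v*`, so that projecting loses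
nothing, and with `u` the previous iterate, to bound the displacement. -/
theorem norm_projBall_sub_le (hM : 0 ≤ M) (w : Vec q) {u : Vec q} (hu : ‖u‖ ≤ M) :
    ‖projBall M w - u‖ ≤ ‖w - u‖ := by
  unfold projBall
  split_ifs with h
  · exact le_rfl
  · have hw : 0 < ‖w‖ := hM.trans_lt (not_le.1 h)
    set s := M / ‖w‖ with hs
    have hs0 : 0 ≤ s := by positivity
    have hs1 : s ≤ 1 := by rw [hs, div_le_one hw]; exact (not_le.1 h).le
    have hsw : s * ‖w‖ = M := div_mul_cancel₀ _ hw.ne'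
    have h1 : inner ℝ w u ≤ s * ‖w‖ ^ 2 := by
      have := real_inner_le_norm w u
      nlinarith
    refine (sq_le_sq₀ (norm_nonneg _) (norm_nonneg _)).1 ?_
    rw [norm_sub_sq_real, norm_sub_sq_real, norm_smul, Real.norm_of_nonneg hs0, inner_smul_left]
    simp only [conj_trivial]
    nlinarith [mul_nonneg (sub_nonneg.2 hs1) (mul_nonneg (sub_nonneg.2 hs1) (sq_nonneg ‖w‖)),
      mul_nonneg (sub_nonneg.2 hs1) (sub_nonneg.2 h1)]

theorem continuous_projBall (hM : 0 ≤ M) : Continuous (projBall M : Vec q → Vec q) := by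
  have : (projBall M : Vec q → Vec q) = fun w => (M / max M ‖w‖) • w := by
    funext w
    unfold projBall
    split_ifs with h
    · rcases hM.eq_or_lt with h0 | h0
      · subst h0
        have : w = 0 := norm_le_zero_iff.1 h
        simp [this]
      · rw [max_eq_left h, div_self h0.ne', one_smul]
    · rw [max_eq_right (not_le.1 h).le]
  -- For `M = 0` the denominator vanishes at the origin, but then the map is constantly `0`.
  rcases hM.eq_or_lt with h0 | h0
  · subst h0
    rw [this]
    simp only [zero_div, zero_smul]
    exact continuous_const
  · rw [this]
    refine Continuous.smul (Continuous.div continuous_const (continuous_const.max continuous_norm) fun w => ?_) continuous_id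
    exact (lt_max_of_lt_left h0).ne'

end Projection

/-! ### The deterministic bilevel problem -/

section Bilevel

open Filter Topology Asymptotics

variable {p q : ℕ} {Ξ Z : Type*} [MeasurableSpace Ξ] [MeasurableSpace Z]
  {Q : Problem p q Ξ Z} {c : Consts}

theorem norm_pt_le (x : Vec p) (y : Vec q) : ‖pt x y‖ ≤ ‖x‖ + ‖y‖ := by
  have h := norm_pt_sq x y
  have := norm_nonneg x
  have := norm_nonneg y
  exact abs_le_of_sq_le_sq' (by nlinarith [mul_nonneg (norm_nonneg x) (norm_nonneg y)])
    (by positivity) |>.2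

theorem norm_pt_sub_left (x x' : Vec p) (y : Vec q) : ‖pt x y - pt x' y‖ = ‖x - x'‖ := by
  have h := norm_pt_sq (x - x') (y - y)
  rw [← pt_sub, sub_self, norm_zero, zero_pow two_ne_zero, add_zero] at h
  exact (sq_eq_sq₀ (norm_nonneg _) (norm_nonneg _)).1 h

theorem norm_pt_sub_right (x : Vec p) (y y' : Vec q) : ‖pt x y - pt x y'‖ = ‖y - y'‖ := by
  have h := norm_pt_sq (x - x) (y - y')
  rw [← pt_sub, sub_self, norm_zero, zero_pow two_ne_zero, zero_add] at h
  exact (sq_eq_sq₀ (norm_nonneg _) (norm_nonneg _)).1 h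

theorem differentiable_section {h : Pair p q → ℝ} (hh : Differentiable ℝ h) (x : Vec p) :
    Differentiable ℝ fun y => h (pt x y) := fun y =>
  (hh (pt x y)).comp y (hasFDerivAt_pt_right x y).differentiableAt

theorem Regular.differentiable_g (hQ : Regular Q c) : Differentiable ℝ Q.g :=
  hQ.contDiff_g.differentiable (by norm_num)

theorem Regular.differentiable_f (hQ : Regular Q c) : Differentiable ℝ Q.f :=
  hQ.contDiff_f.differentiable (by norm_num)

theorem Assumptions.inner_gradY_ge (hQ : Assumptions Q c) {x : Vec p} {m : Vec q}
    (hm : ∀ y', Q.g (pt x m) ≤ Q.g (pt x y')) (y : Vec q) :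
    c.mu / 2 * ‖y - m‖ ^ 2 + ‖gradY Q.g (pt x y)‖ ^ 2 / (2 * c.Lg)
      ≤ inner ℝ (gradY Q.g (pt x y)) (y - m) := by
  refine StrongConvexOn.inner_gradient_ge hQ.admissible.Lg_pos (hQ.regular.strongConvex_g x)
    (differentiable_section hQ.regular.differentiable_g x) (fun z w => ?_) hm y
  have := hQ.lipschitz.norm_gradY_g_sub_le hQ.regular.contDiff_g (pt x z) (pt x w)
  rwa [norm_pt_sub_right] at this

theorem Assumptions.strongMono_gradY (hQ : Assumptions Q c) (x : Vec p) (y y' : Vec q) :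
    c.mu * ‖y - y'‖ ^ 2 ≤ inner ℝ (gradY Q.g (pt x y) - gradY Q.g (pt x y')) (y - y') := by
  have hd := differentiable_section hQ.regular.differentiable_g x
  have h1 := StrongConvexOn.gradient_le (hQ.regular.strongConvex_g x) (hd y) y'
  have h2 := StrongConvexOn.gradient_le (hQ.regular.strongConvex_g x) (hd y') y
  have e : y' - y = -(y - y') := by abel
  rw [e, inner_neg_right, norm_neg] at h1
  rw [inner_sub_left]
  change _ ≤ inner ℝ (gradient (fun y => Q.g (pt x y)) y) (y - y')
    - inner ℝ (gradient (fun y => Q.g (pt x y)) y') (y - y')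
  linarith

theorem Assumptions.yStar_le (hQ : Assumptions Q c) (x : Vec p) (y' : Vec q) :
    Q.g (pt x (Q.yStar x)) ≤ Q.g (pt x y') :=
  Classical.epsilon_spec (StrongConvexOn.exists_isMin hQ.admissible.mu_pos
    (hQ.regular.strongConvex_g x) (differentiable_section hQ.regular.differentiable_g x)) y'

theorem Assumptions.gradY_yStar (hQ : Assumptions Q c) (x : Vec p) :
    gradY Q.g (pt x (Q.yStar x)) = 0 := by
  have : IsLocalMin (fun y => Q.g (pt x y)) (Q.yStar x) :=
    Filter.Eventually.of_forall fun y => hQ.yStar_le x y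
  change gradient (fun y => Q.g (pt x y)) (Q.yStar x) = 0
  rw [gradient, this.fderiv_eq_zero, map_zero]

/-- Both partial gradients vanish at their minimizers, so strong monotonicity of `∇_y g(x, ·)`
between the two minimizers bounds `μ‖y*(x) - y*(x')‖²` by the change of `∇_y g(·, y*(x'))` from `x`
to `x'`, paired with the difference of the minimizers. -/
theorem Assumptions.norm_yStar_sub_le (hQ : Assumptions Q c) (x x' : Vec p) :
    ‖Q.yStar x - Q.yStar x'‖ ≤ c.Cy * ‖x - x'‖ := by
  have hμ := hQ.admissible.mu_pos
  have h1 := hQ.strongMono_gradY x (Q.yStar x) (Q.yStar x')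
  rw [hQ.gradY_yStar, ← hQ.gradY_yStar x'] at h1
  have h2 := hQ.lipschitz.norm_gradY_g_sub_le hQ.regular.contDiff_g (pt x' (Q.yStar x'))
    (pt x (Q.yStar x'))
  rw [norm_pt_sub_left, norm_sub_rev x' x] at h2
  have h3 := (real_inner_le_norm _ _).trans
    (mul_le_mul_of_nonneg_right h2 (norm_nonneg (Q.yStar x - Q.yStar x')))
  have h4 := h1.trans h3
  unfold Consts.Cy
  rw [div_mul_eq_mul_div, le_div_iff₀ hμ]
  rcases (norm_nonneg (Q.yStar x - Q.yStar x')).eq_or_lt with h0 | h0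
  · rw [← h0, zero_mul]
    exact mul_nonneg hQ.admissible.Lg_pos.le (norm_nonneg _)
  · refine le_of_mul_le_mul_right ?_ h0
    linarith

theorem Assumptions.norm_ptStar_sub_le (hQ : Assumptions Q c) (x x' : Vec p) :
    ‖pt x (Q.yStar x) - pt x' (Q.yStar x')‖ ≤ (1 + c.Cy) * ‖x - x'‖ := by
  rw [pt_sub]
  have := hQ.norm_yStar_sub_le x x'
  have := norm_pt_le (x - x') (Q.yStar x - Q.yStar x')
  linarith

/-- Strong monotonicity of `∇_y g` between `y` and `y + t v`, divided by `t²`, in the limit `t ↓ 0`.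
-/
theorem Assumptions.inner_hessYY_ge (hQ : Assumptions Q c) (z : Pair p q) (v : Vec q) :
    c.mu * ‖v‖ ^ 2 ≤ inner ℝ (hessYY Q.g z v) v := by
  have hd : DifferentiableAt ℝ (fun y => gradY Q.g (pt z.fst y)) z.snd := by
    have h1 : (fun y => gradY Q.g (pt z.fst y)) =
        fun y => WithLp.sndL 2 ℝ (Vec p) (Vec q) (gradient Q.g (pt z.fst y)) := by
      funext y
      exact gradY_eq (hQ.regular.differentiable_g _)
    rw [h1]
    exact (WithLp.sndL 2 ℝ (Vec p) (Vec q)).differentiableAt.comp z.snd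
      (((contDiff_gradient hQ.regular.contDiff_g).differentiable (by norm_num) _).comp z.snd
        (hasFDerivAt_pt_right z.fst z.snd).differentiableAt)
  have hline : HasDerivAt (fun t : ℝ => gradY Q.g (pt z.fst (z.snd + t • v)))
      (hessYY Q.g z v) 0 := by
    have h1 : HasDerivAt (fun t : ℝ => z.snd + t • v) v 0 := by
      simpa using ((hasDerivAt_id (0 : ℝ)).smul_const v).const_add z.snd
    have h2 : HasFDerivAt (fun y => gradY Q.g (pt z.fst y)) (hessYY Q.g z)
        (z.snd + (0 : ℝ) • v) := by
      rw [zero_smul, add_zero]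
      exact hd.hasFDerivAt
    exact h2.comp_hasDerivAt (0 : ℝ) h1
  have hlim := (hline.tendsto_slope_zero_right.inner (𝕜 := ℝ) (tendsto_const_nhds (x := v)))
  refine ge_of_tendsto hlim ?_
  filter_upwards [self_mem_nhdsWithin] with t ht
  have ht : 0 < t := ht
  have h := hQ.strongMono_gradY z.fst (z.snd + t • v) z.snd
  rw [add_sub_cancel_left, norm_smul, Real.norm_of_nonneg ht.le, inner_smul_right] at h
  simp only [zero_add, zero_smul, add_zero]
  rw [inner_smul_left]
  simp only [conj_trivial]
  rw [le_inv_mul_iff₀ ht]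
  refine le_of_mul_le_mul_left ?_ ht
  linarith

theorem Assumptions.hessYY_symm (hQ : Assumptions Q c) (z : Pair p q) (v w : Vec q) :
    inner ℝ (hessYY Q.g z v) w = inner ℝ v (hessYY Q.g z w) := by
  rw [hessYY_apply hQ.regular.contDiff_g, hessYY_apply hQ.regular.contDiff_g, ← inner_inY,
    fderiv_gradient_symm hQ.regular.contDiff_g, real_inner_comm, inner_inY, real_inner_comm]

/-- `‖H v‖² ≤ L ⟨H v, v⟩` for the Hessian `H`, averaged with strong positivity. -/
theorem Assumptions.inner_hessYY_ge' (hQ : Assumptions Q c) (z : Pair p q) (a : Vec q) :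
    c.mu / 2 * ‖a‖ ^ 2 + ‖hessYY Q.g z a‖ ^ 2 / (2 * c.Lg) ≤ inner ℝ (hessYY Q.g z a) a := by
  have hμ := hQ.admissible.mu_pos
  have hL := hQ.admissible.Lg_pos
  set b := hessYY Q.g z a with hb
  have h1 := hQ.inner_hessYY_ge z a
  -- Positivity of the Hessian `H` at `a - L⁻¹ H a` gives `⟨Ha, a⟩ ≥ ‖Ha‖²/L`, since `⟨Hb, b⟩ ≤
  -- L‖b‖²` with `b = Ha`. The claim is the average of this with `h1`, and no spectral decomposition
  -- enters.
  have h2 := hQ.inner_hessYY_ge z (a - c.Lg⁻¹ • b)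
  have h3 : inner ℝ (hessYY Q.g z b) b ≤ c.Lg * ‖b‖ ^ 2 := by
    have := (real_inner_le_norm (hessYY Q.g z b) b).trans (mul_le_mul_of_nonneg_right
      (hQ.lipschitz.norm_hessYY_le hQ.admissible hQ.regular.contDiff_g z b) (norm_nonneg b))
    linarith
  have h4 : inner ℝ (hessYY Q.g z b) a = ‖b‖ ^ 2 := by
    rw [hQ.hessYY_symm, ← hb, real_inner_self_eq_norm_sq]
  rw [map_sub, map_smul, ← hb, inner_sub_left, inner_sub_right, inner_sub_right, inner_smul_left,
    inner_smul_left, inner_smul_right, inner_smul_right, h4, real_inner_self_eq_norm_sq] at h2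
  simp only [conj_trivial] at h2
  have h5 : 0 ≤ c.mu * ‖a - c.Lg⁻¹ • b‖ ^ 2 := by positivity
  have h6 : c.Lg⁻¹ * (c.Lg⁻¹ * inner ℝ (hessYY Q.g z b) b) ≤ c.Lg⁻¹ * ‖b‖ ^ 2 := by
    have : c.Lg⁻¹ * inner ℝ (hessYY Q.g z b) b ≤ ‖b‖ ^ 2 := by
      rw [inv_mul_le_iff₀ hL]; exact h3
    gcongr
  have e : ‖b‖ ^ 2 / (2 * c.Lg) = c.Lg⁻¹ * ‖b‖ ^ 2 / 2 := by field_simp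
  rw [e]
  linarith

/-- The solution `v*(x)` of the linear system `∇_y² g v = ∇_y f` at `(x, y*(x))`. -/
noncomputable def Problem.vStar (Q : Problem p q Ξ Z) (x : Vec p) : Vec q :=
  Classical.epsilon fun v => fieldV Q.f Q.g (pt x (Q.yStar x)) v = 0

/-- The hypergradient. -/
noncomputable def Problem.gradPhi (Q : Problem p q Ξ Z) (x : Vec p) : Vec p :=
  fieldX Q.f Q.g (pt x (Q.yStar x)) (Q.vStar x)

/-- The Hessian is positive definite, hence injective, hence surjective in finite dimension. -/
theorem Assumptions.fieldV_vStar (hQ : Assumptions Q c) (x : Vec p) :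
    fieldV Q.f Q.g (pt x (Q.yStar x)) (Q.vStar x) = 0 := by
  have hinj : Function.Injective (hessYY Q.g (pt x (Q.yStar x)) : Vec q →ₗ[ℝ] Vec q) := by
    refine (injective_iff_map_eq_zero _).2 fun v hv => ?_
    have h := hQ.inner_hessYY_ge (pt x (Q.yStar x)) v
    have hv : hessYY Q.g (pt x (Q.yStar x)) v = 0 := hv
    rw [hv, inner_zero_left] at h
    have : ‖v‖ ^ 2 ≤ 0 := nonpos_of_mul_nonpos_right h hQ.admissible.mu_pos
    exact norm_eq_zero.1 (pow_eq_zero_iff two_ne_zero |>.1 (le_antisymm this (sq_nonneg _)))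
  obtain ⟨v, hv⟩ := LinearMap.injective_iff_surjective.1 hinj (gradY Q.f (pt x (Q.yStar x)))
  exact Classical.epsilon_spec (p := fun v => fieldV Q.f Q.g (pt x (Q.yStar x)) v = 0)
    ⟨v, sub_eq_zero.2 hv⟩

theorem Assumptions.hessYY_vStar (hQ : Assumptions Q c) (x : Vec p) :
    hessYY Q.g (pt x (Q.yStar x)) (Q.vStar x) = gradY Q.f (pt x (Q.yStar x)) :=
  sub_eq_zero.1 (hQ.fieldV_vStar x)

/-- This is why a `v`-step is a gradient step for a strongly convex quadratic with minimizer
`v*(x)`: at the exact lower-level solution the direction is the Hessian applied to `v - v*`. -/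
theorem Assumptions.fieldV_ptStar (hQ : Assumptions Q c) (x : Vec p) (v : Vec q) :
    fieldV Q.f Q.g (pt x (Q.yStar x)) v = hessYY Q.g (pt x (Q.yStar x)) (v - Q.vStar x) := by
  rw [map_sub, hQ.hessYY_vStar]; rfl

/-- Pair the linear system with `v*` itself. As `C_f/μ ≤ M` is assumed later, `v*` lies in `Ω` and
the projection does not increase the distance to it. -/
theorem Assumptions.norm_vStar_le (hQ : Assumptions Q c) (x : Vec p) :
    ‖Q.vStar x‖ ≤ c.Cf / c.mu := by
  have hμ := hQ.admissible.mu_pos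
  have h1 := hQ.inner_hessYY_ge (pt x (Q.yStar x)) (Q.vStar x)
  rw [hQ.hessYY_vStar] at h1
  have h2 := (real_inner_le_norm _ _).trans (mul_le_mul_of_nonneg_right
    (hQ.lipschitz.norm_gradY_le hQ.admissible hQ.regular.contDiff_f (pt x (Q.yStar x)))
    (norm_nonneg (Q.vStar x)))
  rw [le_div_iff₀ hμ]
  rcases (norm_nonneg (Q.vStar x)).eq_or_lt with h0 | h0
  · rw [← h0, zero_mul]; exact hQ.admissible.Cf_nonneg
  · refine le_of_mul_le_mul_right ?_ h0
    linarith

/-- The Hessian at `x` applied to `v*(x') - v*(x)` is the direction at `x` with the vector `v*(x')`.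
The same vector makes the direction vanish at `x'`, so only the variation of the point remains, with
a vector of norm at most `C_f/μ`. -/
theorem Assumptions.norm_vStar_sub_le (hQ : Assumptions Q c) (x x' : Vec p) :
    ‖Q.vStar x - Q.vStar x'‖ ≤ c.Cv * ‖x - x'‖ := by
  have hμ := hQ.admissible.mu_pos
  have hCf := hQ.admissible.Cf_nonneg
  have hLf := hQ.admissible.Lf_pos
  have hLgg := hQ.admissible.Lgg_nonneg
  have h1 := hQ.inner_hessYY_ge (pt x (Q.yStar x)) (Q.vStar x' - Q.vStar x)
  rw [← hQ.fieldV_ptStar, ← sub_zero (fieldV _ _ _ _), ← hQ.fieldV_vStar x'] at h1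
  have h2 := hQ.lipschitz.norm_fieldV_sub_le hQ.admissible hQ.regular.contDiff_f
    (hQ.norm_vStar_le x') (pt x (Q.yStar x)) (pt x' (Q.yStar x'))
  have h3 := (real_inner_le_norm _ _).trans
    (mul_le_mul_of_nonneg_right h2 (norm_nonneg (Q.vStar x' - Q.vStar x)))
  have h4 := h1.trans h3
  rw [norm_sub_rev] 
  have h5 : c.mu * ‖Q.vStar x' - Q.vStar x‖ ≤
      (c.Lf + c.Cf / c.mu * c.Lgg) * ((1 + c.Cy) * ‖x - x'‖) := by
    have h6 : (c.Lf + c.Cf / c.mu * c.Lgg) * ‖pt x (Q.yStar x) - pt x' (Q.yStar x')‖ ≤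
      (c.Lf + c.Cf / c.mu * c.Lgg) * ((1 + c.Cy) * ‖x - x'‖) := by
      have := hQ.norm_ptStar_sub_le x x'
      gcongr
    rcases (norm_nonneg (Q.vStar x' - Q.vStar x)).eq_or_lt with h0 | h0
    · rw [← h0, mul_zero]
      exact le_trans (by positivity) h6
    · refine le_trans (le_of_mul_le_mul_right ?_ h0) h6
      linarith
  have e : c.Cv * ‖x - x'‖ = ((c.Lf + c.Cf / c.mu * c.Lgg) * ((1 + c.Cy) * ‖x - x'‖)) / c.mu := by
    unfold Consts.Cv Consts.Cy; field_simp
  rw [e, le_div_iff₀ hμ]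
  linarith

/-- Only Lipschitz continuity of `y*` is used, not its differentiability. Along `z(x) = (x, y*(x))`
expand `f` and `∇g` to first order; the remainders are `o(x' - x)` because `z` is Lipschitz. As `∇_y
g` vanishes along `z`, pairing the second expansion with `(0, v*)` shows that `⟨D(∇g)(0, v*), z(x')
- z(x)⟩` is negligible. Subtracted from the first expansion, it cancels the `y`-component, because
the `y`-block of `D(∇g)(0, v*)` is `∇_y²g v* = ∇_y f`. The unknown increment of `y*` disappears and
the hypergradient remains. -/
theorem Assumptions.hasGradientAt_Phi (hQ : Assumptions Q c) (x : Vec p) :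
    HasGradientAt Q.Phi (Q.gradPhi x) x := by
  rw [hasGradientAt_iff_isLittleO]
  set z : Vec p → Pair p q := fun x => pt x (Q.yStar x) with hz
  have hO : (fun x' => z x' - z x) =O[𝓝 x] fun x' => x' - x :=
    IsBigO.of_bound (1 + c.Cy) (Eventually.of_forall fun x' => hQ.norm_ptStar_sub_le x' x)
  have hcont : Tendsto z (𝓝 x) (𝓝 (z x)) := by
    rw [tendsto_iff_norm_sub_tendsto_zero]
    refine squeeze_zero (fun _ => norm_nonneg _) (fun x' => hQ.norm_ptStar_sub_le x' x) ?_
    have : Tendsto (fun x' => (1 + c.Cy) * ‖x' - x‖) (𝓝 x) (𝓝 ((1 + c.Cy) * ‖x - x‖)) :=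
      Continuous.tendsto (by fun_prop) x
    simpa using this
  have h1 : (fun x' => Q.f (z x') - Q.f (z x) - inner ℝ (gradient Q.f (z x)) (z x' - z x))
      =o[𝓝 x] fun x' => x' - x :=
    ((hasGradientAt_iff_isLittleO.1
      (hQ.regular.differentiable_f (z x)).hasGradientAt).comp_tendsto hcont).trans_isBigO hO
  set D := fderiv ℝ (gradient Q.g) (z x) with hD
  have h2 : (fun x' => gradient Q.g (z x') - gradient Q.g (z x) - D (z x' - z x))
      =o[𝓝 x] fun x' => x' - x := by
    have := ((contDiff_gradient hQ.regular.contDiff_g).differentiable (by norm_num)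
      (z x)).hasFDerivAt
    exact (this.isLittleO.comp_tendsto hcont).trans_isBigO hO
  have h3 : (fun x' => inner ℝ (inY p q (Q.vStar x))
      (gradient Q.g (z x') - gradient Q.g (z x) - D (z x' - z x))) =o[𝓝 x] fun x' => x' - x := by
    refine IsBigO.trans_isLittleO (IsBigO.of_bound ‖inY p q (Q.vStar x)‖
      (Eventually.of_forall fun x' => ?_)) h2
    exact norm_inner_le_norm _ _
  refine (h1.sub h3).congr_left fun x' => ?_
  have hs : ∀ x', (gradient Q.g (z x')).snd = 0 := fun x' => by
    rw [← gradY_eq (hQ.regular.differentiable_g _)]; exact hQ.gradY_yStar x'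
  -- Both gradients of `g` have zero `y`-component, so they drop out of the pairing; symmetry of `D`
  -- moves it onto `(0, v*)`.
  have e1 : inner ℝ (inY p q (Q.vStar x)) (gradient Q.g (z x') - gradient Q.g (z x) - D (z x' - z x))
      = - inner ℝ (D (inY p q (Q.vStar x))) (z x' - z x) := by
    rw [inner_sub_right, inner_sub_right, real_inner_comm (gradient Q.g (z x')), inner_inY,
      real_inner_comm (gradient Q.g (z x)), inner_inY, hs, hs,
      ← fderiv_gradient_symm hQ.regular.contDiff_g]
    simp [hD]
  have e2 : (D (inY p q (Q.vStar x))).fst = jacXY Q.g (z x) (Q.vStar x) :=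
    (jacXY_apply hQ.regular.contDiff_g _ _).symm
  have e3 : (D (inY p q (Q.vStar x))).snd = (gradient Q.f (z x)).snd := by
    rw [← gradY_eq (hQ.regular.differentiable_f _), ← hQ.hessYY_vStar]
    exact (hessYY_apply hQ.regular.contDiff_g _ _).symm
  have e4 : (gradient Q.f (z x)).fst = gradX Q.f (z x) :=
    (gradX_eq (hQ.regular.differentiable_f _)).symm
  have e6 : inner ℝ (gradient Q.f (z x)) (z x' - z x) - inner ℝ (D (inY p q (Q.vStar x))) (z x' - z x)
      = inner ℝ (Q.gradPhi x) (x' - x) := by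
    rw [← inner_sub_left, WithLp.prod_inner_apply]
    have e7 : (gradient Q.f (z x) - D (inY p q (Q.vStar x))).ofLp.1 = Q.gradPhi x := by
      change (gradient Q.f (z x)).fst - (D (inY p q (Q.vStar x))).fst = _
      rw [e2, e4]; rfl
    have e8 : (gradient Q.f (z x) - D (inY p q (Q.vStar x))).ofLp.2 = 0 := by
      change (gradient Q.f (z x)).snd - (D (inY p q (Q.vStar x))).snd = _
      rw [e3, sub_self]
    rw [e7, e8, inner_zero_left, add_zero]
    rfl
  rw [e1, ← e6]
  simp only [Problem.Phi, hz]
  ring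

theorem Assumptions.gradient_Phi (hQ : Assumptions Q c) (x : Vec p) :
    gradient Q.Phi x = Q.gradPhi x :=
  (hQ.hasGradientAt_Phi x).gradient

theorem Assumptions.differentiable_Phi (hQ : Assumptions Q c) : Differentiable ℝ Q.Phi :=
  fun x => (hQ.hasGradientAt_Phi x).differentiableAt

theorem Assumptions.norm_gradPhi_le (hQ : Assumptions Q c) (x : Vec p) :
    ‖Q.gradPhi x‖ ≤ c.Cf + c.Lg * (c.Cf / c.mu) := by
  have h1 := hQ.lipschitz.norm_gradX_le hQ.admissible hQ.regular.contDiff_f (pt x (Q.yStar x))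
  have h2 := hQ.lipschitz.norm_jacXY_le hQ.admissible hQ.regular.contDiff_g (pt x (Q.yStar x))
    (Q.vStar x)
  have h3 := mul_le_mul_of_nonneg_left (hQ.norm_vStar_le x) hQ.admissible.Lg_pos.le
  exact (norm_sub_le _ _).trans (by linarith)

/-- Changing the point contributes `1 + C_y` and changing `v*` contributes `L_g C_v`, which is `C_y
(1 + C_y)` times the same factor `L_f + (C_f/μ) L_gg`. Their sum is the square `(1 + C_y)²`. -/
theorem Assumptions.norm_gradPhi_sub_le (hQ : Assumptions Q c) (x x' : Vec p) :
    ‖Q.gradPhi x - Q.gradPhi x'‖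
      ≤ (1 + c.Cy) ^ 2 * (c.Lf + c.Cf / c.mu * c.Lgg) * ‖x - x'‖ := by
  have hμ := hQ.admissible.mu_pos
  have hCf := hQ.admissible.Cf_nonneg
  have hLf := hQ.admissible.Lf_pos
  have hLg := hQ.admissible.Lg_pos
  have hLgg := hQ.admissible.Lgg_nonneg
  have e : Q.gradPhi x - Q.gradPhi x' =
      (fieldX Q.f Q.g (pt x (Q.yStar x)) (Q.vStar x)
        - fieldX Q.f Q.g (pt x' (Q.yStar x')) (Q.vStar x))
      - jacXY Q.g (pt x' (Q.yStar x')) (Q.vStar x - Q.vStar x') := by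
    unfold Problem.gradPhi fieldX; rw [map_sub]; abel
  have h1 := hQ.lipschitz.norm_fieldX_sub_le hQ.admissible hQ.regular.contDiff_f
    (hQ.norm_vStar_le x) (pt x (Q.yStar x)) (pt x' (Q.yStar x'))
  have h2 := hQ.lipschitz.norm_jacXY_le hQ.admissible hQ.regular.contDiff_g (pt x' (Q.yStar x'))
    (Q.vStar x - Q.vStar x')
  have h3 : (c.Lf + c.Cf / c.mu * c.Lgg) * ‖pt x (Q.yStar x) - pt x' (Q.yStar x')‖ ≤
      (c.Lf + c.Cf / c.mu * c.Lgg) * ((1 + c.Cy) * ‖x - x'‖) := by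
    have := hQ.norm_ptStar_sub_le x x'
    gcongr
  have h4 := mul_le_mul_of_nonneg_left (hQ.norm_vStar_sub_le x x') hLg.le
  have e2 : (c.Lf + c.Cf / c.mu * c.Lgg) * ((1 + c.Cy) * ‖x - x'‖) + c.Lg * (c.Cv * ‖x - x'‖)
      = (1 + c.Cy) ^ 2 * (c.Lf + c.Cf / c.mu * c.Lgg) * ‖x - x'‖ := by
    unfold Consts.Cv Consts.Cy; field_simp
  rw [e, ← e2]
  exact (norm_sub_le _ _).trans (by linarith)

end Bilevel

/-! ### Adding independent centred noise -/

section Noise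

variable {Ω S U V : Type*} [mΩ : MeasurableSpace Ω] [mS : MeasurableSpace S] [MeasurableSpace U]
  [NormedAddCommGroup V] [InnerProductSpace ℝ V] [CompleteSpace V] [MeasurableSpace V]
  [BorelSpace V] [SecondCountableTopology V] {P : Measure Ω} [IsProbabilityMeasure P]

/-- Independence in the form used for Fubini: the fresh sample is integrated out on a separate
factor while `ω` stays fixed. This replaces conditional expectations. -/
theorem map_prodMk_eq_of_indepFun {β : Type*} [MeasurableSpace β] {W : Ω → β} {s : Ω → S}
    (hW : Measurable W) (hs : Measurable s) (hind : IndepFun W s P) :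
    P.map (fun ω => (W ω, s ω)) = (P.prod (P.map s)).map fun x => (W x.1, x.2) := by
  have : IsProbabilityMeasure (P.map s) := Measure.isProbabilityMeasure_map hs.aemeasurable
  rw [(indepFun_iff_map_prod_eq_prod_map_map hW.aemeasurable hs.aemeasurable).1 hind]
  have := Measure.map_prod_map P (P.map s) hW measurable_id
  rw [Measure.map_id] at this
  exact this

theorem integrable_comp_iff_of_indepFun {β E : Type*} [MeasurableSpace β] [NormedAddCommGroup E]
    {W : Ω → β} {s : Ω → S} (hW : Measurable W) (hs : Measurable s) (hind : IndepFun W s P)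
    {F : β × S → E} (hF : StronglyMeasurable F) :
    Integrable (fun ω => F (W ω, s ω)) P ↔
      Integrable (fun x : Ω × S => F (W x.1, x.2)) (P.prod (P.map s)) := by
  have h1 := integrable_map_measure (μ := P) (f := fun ω => (W ω, s ω)) (g := F)
    hF.aestronglyMeasurable (hW.prodMk hs).aemeasurable
  have h2 := integrable_map_measure (μ := P.prod (P.map s))
    (f := fun x : Ω × S => (W x.1, x.2)) (g := F) hF.aestronglyMeasurable
    (by fun_prop)
  rw [map_prodMk_eq_of_indepFun hW hs hind] at h1
  exact h1.symm.trans h2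

theorem integral_comp_of_indepFun {β E : Type*} [MeasurableSpace β] [NormedAddCommGroup E]
    [NormedSpace ℝ E] {W : Ω → β} {s : Ω → S} (hW : Measurable W) (hs : Measurable s)
    (hind : IndepFun W s P) {F : β × S → E} (hF : StronglyMeasurable F) :
    ∫ ω, F (W ω, s ω) ∂P = ∫ x : Ω × S, F (W x.1, x.2) ∂(P.prod (P.map s)) := by
  have h1 := integral_map (μ := P) (φ := fun ω => (W ω, s ω)) (f := F)
    (hW.prodMk hs).aemeasurable hF.aestronglyMeasurable
  have h2 := integral_map (μ := P.prod (P.map s)) (φ := fun x : Ω × S => (W x.1, x.2)) (f := F)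
    (by fun_prop) hF.aestronglyMeasurable
  rw [map_prodMk_eq_of_indepFun hW hs hind] at h1
  exact h1.symm.trans h2

/-- The cross term `E⟨A, h(u, s)⟩` vanishes: by Fubini the inner integral over the fresh sample is
`⟨A, ∫ h(u, σ)⟩ = 0`. The function `φ` is any integrable bound for the second moment of the noise
given the past. -/
theorem memLp_add_noise {A : Ω → V} {u : Ω → U} {s : Ω → S} {h : U → S → V} {φ : Ω → ℝ}
    (hA : Measurable A) (hu : Measurable u) (hs : Measurable s)
    (hind : IndepFun (fun ω => (A ω, u ω)) s P) (hh : Measurable (Function.uncurry h))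
    (hint : ∀ ω, Integrable (h (u ω)) (P.map s)) (hmean : ∀ ω, ∫ σ, h (u ω) σ ∂(P.map s) = 0)
    (hsq : ∀ ω, Integrable (fun σ => ‖h (u ω) σ‖ ^ 2) (P.map s))
    (hφ : ∀ ω, ∫ σ, ‖h (u ω) σ‖ ^ 2 ∂(P.map s) ≤ φ ω)
    (hA2 : MemLp A 2 P) (hφi : Integrable φ P) :
    MemLp (fun ω => A ω + h (u ω) (s ω)) 2 P ∧
      ∫ ω, ‖A ω + h (u ω) (s ω)‖ ^ 2 ∂P ≤ ∫ ω, ‖A ω‖ ^ 2 ∂P + ∫ ω, φ ω ∂P := by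
  have hν : IsProbabilityMeasure (P.map s) := Measure.isProbabilityMeasure_map hs.aemeasurable
  have hW : Measurable fun ω => (A ω, u ω) := hA.prodMk hu
  have hF : Measurable fun x : (V × U) × S => h x.1.2 x.2 :=
    hh.comp ((measurable_snd.comp measurable_fst).prodMk measurable_snd)
  have hB : Measurable fun ω => h (u ω) (s ω) := hF.comp (hW.prodMk hs)
  have hF2 : StronglyMeasurable fun x : (V × U) × S => ‖h x.1.2 x.2‖ ^ 2 :=
    (hF.norm.pow_const 2).stronglyMeasurable
  have hprodm : Measurable fun x : Ω × S => ‖h (u x.1) x.2‖ ^ 2 :=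
    hF2.measurable.comp ((hW.comp measurable_fst).prodMk measurable_snd)
  -- On the product space the sections are integrable by hypothesis, and their integrals are
  -- dominated by `φ`.
  have hprod : Integrable (fun x : Ω × S => ‖h (u x.1) x.2‖ ^ 2) (P.prod (P.map s)) := by
    rw [integrable_prod_iff hprodm.aestronglyMeasurable]
    refine ⟨Filter.Eventually.of_forall fun ω => hsq ω, ?_⟩
    refine hφi.mono' ?_ (Filter.Eventually.of_forall fun ω => ?_)
    · exact (hprodm.norm.stronglyMeasurable.integral_prod_right').aestronglyMeasurable
    · have h0 : 0 ≤ ∫ σ, ‖h (u ω) σ‖ ^ 2 ∂(P.map s) := integral_nonneg fun _ => sq_nonneg _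
      have : ∀ σ, ‖‖h (u ω) σ‖ ^ 2‖ = ‖h (u ω) σ‖ ^ 2 := fun σ =>
        Real.norm_of_nonneg (sq_nonneg _)
      simp only [this]
      rw [Real.norm_of_nonneg h0]
      exact hφ ω
  have hB2 : MemLp (fun ω => h (u ω) (s ω)) 2 P :=
    (memLp_two_iff_integrable_sq_norm hB.aestronglyMeasurable).2
      ((integrable_comp_iff_of_indepFun hW hs hind hF2).2 hprod)
  have hBφ : ∫ ω, ‖h (u ω) (s ω)‖ ^ 2 ∂P ≤ ∫ ω, φ ω ∂P := by
    rw [integral_comp_of_indepFun hW hs hind hF2, integral_prod _ hprod]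
    exact integral_mono hprod.integral_prod_left hφi hφ
  have hF3 : StronglyMeasurable fun x : (V × U) × S => inner ℝ x.1.1 (h x.1.2 x.2) :=
    ((measurable_fst.comp measurable_fst).inner hF).stronglyMeasurable
  have hAB : Integrable (fun ω => inner ℝ (A ω) (h (u ω) (s ω))) P := by
    refine (hA2.norm.integrable_mul hB2.norm).mono' (hA.inner hB).aestronglyMeasurable
      (Filter.Eventually.of_forall fun ω => ?_)
    exact norm_inner_le_norm _ _
  have hAB0 : ∫ ω, inner ℝ (A ω) (h (u ω) (s ω)) ∂P = 0 := by
    rw [integral_comp_of_indepFun hW hs hind hF3,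
      integral_prod _ ((integrable_comp_iff_of_indepFun hW hs hind hF3).1 hAB)]
    have : ∀ ω, ∫ σ, inner ℝ (A ω) (h (u ω) σ) ∂(P.map s) = 0 := fun ω => by
      rw [integral_inner (hint ω), hmean, inner_zero_right]
    simp [this]
  refine ⟨hA2.add hB2, ?_⟩
  have hA2' := hA2.integrable_norm_pow two_ne_zero
  have hB2' := hB2.integrable_norm_pow two_ne_zero
  simp only [norm_add_sq_real]
  have hsum : Integrable (fun ω => ‖A ω‖ ^ 2 + 2 * inner ℝ (A ω) (h (u ω) (s ω))) P :=
    hA2'.add (hAB.const_mul 2)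
  rw [integral_add hsum hB2', integral_add hA2' (hAB.const_mul 2),
    integral_const_mul, hAB0]
  linarith

omit [SecondCountableTopology V] in
-- The variance is the second moment minus `‖m‖²`, and the second moment inherits the pointwise
-- bound.
theorem integral_norm_sub_sq_le {ν : Measure S} [IsProbabilityMeasure ν] {X : S → V} {m : V} {l : ℝ}
    (hXm : Measurable X) (hX : Integrable X ν) (hm : ∫ σ, X σ ∂ν = m)
    (hl : ∀ σ, ‖X σ‖ ^ 2 ≤ l) :
    Integrable (fun σ => ‖X σ - m‖ ^ 2) ν ∧ ∫ σ, ‖X σ - m‖ ^ 2 ∂ν ≤ l := by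
  have h2 : Integrable (fun σ => ‖X σ‖ ^ 2) ν :=
    (integrable_const l).mono' (hXm.norm.pow_const 2).aestronglyMeasurable
      (Filter.Eventually.of_forall fun σ => by
        rw [Real.norm_of_nonneg (sq_nonneg _)]; exact hl σ)
  have h3 : Integrable (fun σ => inner ℝ (X σ) m) ν := hX.inner_const m
  simp only [norm_sub_sq_real]
  have hdiff : Integrable (fun σ => ‖X σ‖ ^ 2 - 2 * inner ℝ (X σ) m) ν :=
    h2.sub (h3.const_mul 2)
  refine ⟨hdiff.add (integrable_const _), ?_⟩
  rw [integral_add hdiff (integrable_const _),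
    integral_sub h2 (h3.const_mul 2), integral_const_mul]
  have h4 : ∫ σ, inner ℝ (X σ) m ∂ν = ‖m‖ ^ 2 := by
    have : ∀ σ, inner ℝ (X σ) m = inner ℝ m (X σ) := fun σ => real_inner_comm _ _
    simp only [this]
    rw [integral_inner hX, hm, real_inner_self_eq_norm_sq]
  have h5 : ∫ σ, ‖X σ‖ ^ 2 ∂ν ≤ l := by
    have := integral_mono h2 (integrable_const l) hl
    simpa using this
  rw [h4, integral_const, probReal_univ, one_smul]
  nlinarith [sq_nonneg ‖m‖]

end Noise

/-! ### The past of a set of samples -/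

section Past

variable {Ω S I : Type*} [mS : MeasurableSpace S]

/-- The σ-algebra generated by the samples with labels in `s`. -/
@[reducible]
def past (smp : I → Ω → S) (s : Set I) : MeasurableSpace Ω :=
  ⨆ i ∈ s, MeasurableSpace.comap (smp i) mS

theorem past_mono (smp : I → Ω → S) {s t : Set I} (h : s ⊆ t) : past smp s ≤ past smp t :=
  biSup_mono h

theorem past_le [mΩ : MeasurableSpace Ω] {smp : I → Ω → S} (hm : ∀ i, Measurable (smp i)) (s : Set I) :
    past smp s ≤ mΩ :=
  iSup₂_le fun i _ => (hm i).comap_le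

theorem measurable_past {smp : I → Ω → S} {s : Set I} {i : I} (hi : i ∈ s) :
    Measurable[past smp s] (smp i) := by
  have : MeasurableSpace.comap (smp i) mS ≤ past smp s :=
    le_iSup₂_of_le (f := fun i (_ : i ∈ s) => MeasurableSpace.comap (smp i) mS) i hi le_rfl
  exact Measurable.of_comap_le this

theorem indepFun_of_measurable_past {β : Type*} [mΩ : MeasurableSpace Ω] {P : Measure Ω}
    [MeasurableSpace β] {smp : I → Ω → S}
    (hm : ∀ i, Measurable (smp i)) (hind : iIndepFun smp P) {s : Set I} {i : I} (hi : i ∉ s)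
    {W : Ω → β} (hW : Measurable[past smp s] W) : IndepFun W (smp i) P := by
  have h1 : Indep (past smp s) (past smp {i}) P :=
    indep_iSup_of_disjoint (fun i => (hm i).comap_le) hind (Set.disjoint_singleton_right.2 hi)
  have h2 : MeasurableSpace.comap (smp i) mS ≤ past smp {i} :=
    (measurable_past (Set.mem_singleton i)).comap_le
  exact indep_of_indep_of_le_left (indep_of_indep_of_le_right h1 h2) hW.comap_le

/-- Needed for the random output index, which is independent of the whole family of samples. -/
theorem past_le_comap (smp : I → Ω → S) (s : Set I) :
    past smp s ≤ MeasurableSpace.comap (fun ω i => smp i ω) MeasurableSpace.pi := by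
  refine iSup₂_le fun i _ => ?_
  have h : Measurable[MeasurableSpace.comap (fun ω i => smp i ω) MeasurableSpace.pi]
      (fun ω i => smp i ω) := comap_measurable _
  exact Measurable.comap_le ((measurable_pi_apply i).comp h)

end Past

/-! ### Mini-batches -/

section Batch

variable {Ω S I U V : Type*} [mΩ : MeasurableSpace Ω] [mS : MeasurableSpace S] [MeasurableSpace U]
  [NormedAddCommGroup V] [InnerProductSpace ℝ V] [CompleteSpace V] [MeasurableSpace V]
  [BorelSpace V] [SecondCountableTopology V] {P : Measure Ω} [IsProbabilityMeasure P]

/-- Add the samples of the batch one at a time. Each is independent of the earlier ones and of the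
past, so `memLp_add_noise` applies at every stage. The measurability statement belongs to the
induction because it provides this independence. -/
theorem memLp_add_batch {smp : I → Ω → S} (hm : ∀ i, Measurable (smp i)) (hind : iIndepFun smp P)
    {s : Set I} {b : ℕ → I} (hb : Function.Injective b) (hbs : ∀ i, b i ∉ s)
    {A : Ω → V} {u : Ω → U} {h : U → S → V} {φ : Ω → ℝ}
    (hA : Measurable[past smp s] A) (hu : Measurable[past smp s] u)
    (hh : Measurable (Function.uncurry h))
    (hint : ∀ i ω, Integrable (h (u ω)) (P.map (smp i)))
    (hmean : ∀ i ω, ∫ σ, h (u ω) σ ∂(P.map (smp i)) = 0)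
    (hsq : ∀ i ω, Integrable (fun σ => ‖h (u ω) σ‖ ^ 2) (P.map (smp i)))
    (hφ : ∀ i ω, ∫ σ, ‖h (u ω) σ‖ ^ 2 ∂(P.map (smp i)) ≤ φ ω)
    (hA2 : MemLp A 2 P) (hφi : Integrable φ P) (a : ℝ) (n : ℕ) :
    Measurable[past smp (s ∪ b '' {i | i < n})]
      (fun ω => A ω + a • ∑ i ∈ Finset.range n, h (u ω) (smp (b i) ω)) ∧
    MemLp (fun ω => A ω + a • ∑ i ∈ Finset.range n, h (u ω) (smp (b i) ω)) 2 P ∧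
      ∫ ω, ‖A ω + a • ∑ i ∈ Finset.range n, h (u ω) (smp (b i) ω)‖ ^ 2 ∂P
        ≤ ∫ ω, ‖A ω‖ ^ 2 ∂P + n * (a ^ 2 * ∫ ω, φ ω ∂P) := by
  induction n with
  | zero => simpa using ⟨hA.mono (past_mono _ Set.subset_union_left) le_rfl, hA2⟩
  | succ n ih =>
    obtain ⟨h1, h2, h3⟩ := ih
    have hsub : s ∪ b '' {i | i < n} ⊆ s ∪ b '' {i | i < n + 1} :=
      Set.union_subset_union_right _ (Set.image_mono fun i hi => Nat.lt_succ_of_lt hi)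
    have hu' := hu.mono (past_mono smp (Set.subset_union_left (t := b '' {i | i < n}))) le_rfl
    have hnew : b n ∉ s ∪ b '' {i | i < n} := by
      rintro (h | ⟨i, hi, hbi⟩)
      · exact hbs n h
      · exact (ne_of_lt hi) (hb hbi)
    have hstep : ∀ ω, A ω + a • ∑ i ∈ Finset.range (n + 1), h (u ω) (smp (b i) ω)
        = (A ω + a • ∑ i ∈ Finset.range n, h (u ω) (smp (b i) ω)) + a • h (u ω) (smp (b n) ω) := by
      intro ω
      rw [Finset.sum_range_succ, smul_add, add_assoc]
    simp only [hstep]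
    have hha : Measurable (Function.uncurry fun u σ => a • h u σ) := hh.const_smul a
    have key := memLp_add_noise (P := P) (h := fun u σ => a • h u σ) (φ := fun ω => a ^ 2 * φ ω)
      (h1.mono (past_le hm _) le_rfl) (hu'.mono (past_le hm _) le_rfl) (hm (b n))
      (indepFun_of_measurable_past hm hind hnew (h1.prodMk hu')) hha
      (fun ω => (hint _ ω).smul a) (fun ω => by rw [integral_smul, hmean, smul_zero])
      (fun ω => by
        simp only [norm_smul, mul_pow]
        exact (hsq _ ω).const_mul _)
      (fun ω => by
        simp only [norm_smul, mul_pow, Real.norm_eq_abs, sq_abs]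
        rw [integral_const_mul]
        exact mul_le_mul_of_nonneg_left (hφ _ ω) (sq_nonneg a))
      h2 (hφi.const_mul _)
    refine ⟨?_, key.1, ?_⟩
    · have e1 := h1.mono (past_mono smp hsub) le_rfl
      have e2 := hu'.mono (past_mono smp hsub) le_rfl
      have e3 : Measurable[past smp (s ∪ b '' {i | i < n + 1})] (smp (b n)) :=
        measurable_past (Or.inr ⟨n, Nat.lt_succ_self n, rfl⟩)
      exact e1.add (hha.comp (e2.prodMk e3))
    · have := key.2
      rw [integral_const_mul] at this
      push_cast
      linarith

end Batch

/-! ### Error of mini-batch estimators -/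

section Spider

variable {Ω S I U V : Type*} [mΩ : MeasurableSpace Ω] [mS : MeasurableSpace S] [MeasurableSpace U]
  [NormedAddCommGroup V] [InnerProductSpace ℝ V] [CompleteSpace V] [MeasurableSpace V]
  [BorelSpace V] [SecondCountableTopology V] {P : Measure Ω} [IsProbabilityMeasure P]
  {smp : I → Ω → S} {H : U → S → V} {Hbar : U → V} {s : Set I} {b : ℕ → I}

/-- `H` is an unbiased estimate of `Hbar` for each of the samples. -/
structure UnbiasedField (P : Measure Ω) (smp : I → Ω → S) (H : U → S → V) (Hbar : U → V) : Prop where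
  measurable : Measurable (Function.uncurry H)
  measurable_mean : Measurable Hbar
  integrable : ∀ i u, Integrable (H u) (P.map (smp i))
  integral_eq : ∀ i u, ∫ σ, H u σ ∂(P.map (smp i)) = Hbar u

/-- The new error equals the old error plus the batch average of the centred differences `h`. With
weight `1/N` and `N` samples the added variance is `N · N⁻² E l`. Evaluating both points on the same
sample is what lets the Lipschitz bound `l` control each difference. -/
theorem UnbiasedField.recursive_error (hH : UnbiasedField P smp H Hbar)
    (hm : ∀ i, Measurable (smp i)) (hind : iIndepFun smp P)
    (hb : Function.Injective b) (hbs : ∀ i, b i ∉ s) {u u' : Ω → U} {D : Ω → V} {l : Ω → ℝ}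
    (hu : Measurable[past smp s] u) (hu' : Measurable[past smp s] u')
    (hD : Measurable[past smp s] D) (hD2 : MemLp (fun ω => D ω - Hbar (u ω)) 2 P)
    (hl : ∀ ω σ, ‖H (u' ω) σ - H (u ω) σ‖ ^ 2 ≤ l ω) (hli : Integrable l P) {N : ℕ} (hN : 0 < N) :
    let D' := fun ω => (N : ℝ)⁻¹ • ∑ i ∈ Finset.range N, H (u' ω) (smp (b i) ω)
      + (D ω - (N : ℝ)⁻¹ • ∑ i ∈ Finset.range N, H (u ω) (smp (b i) ω))
    Measurable[past smp (s ∪ b '' {i | i < N})] D' ∧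
    MemLp (fun ω => D' ω - Hbar (u' ω)) 2 P ∧
    ∫ ω, ‖D' ω - Hbar (u' ω)‖ ^ 2 ∂P ≤ ∫ ω, ‖D ω - Hbar (u ω)‖ ^ 2 ∂P + (N : ℝ)⁻¹ * ∫ ω, l ω ∂P := by
  intro D'
  have hν : ∀ i, IsProbabilityMeasure (P.map (smp i)) := fun i =>
    Measure.isProbabilityMeasure_map (hm i).aemeasurable
  have hN0 : (N : ℝ) ≠ 0 := Nat.cast_ne_zero.2 hN.ne'
  have hHu : ∀ w, Measurable (H w) := fun w => hH.measurable.comp measurable_prodMk_left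
  set h : U × U → S → V := fun w σ => (H w.2 σ - H w.1 σ) - (Hbar w.2 - Hbar w.1) with hh
  have hhm : Measurable (Function.uncurry h) := by
    have h1 : Measurable fun x : (U × U) × S => H x.1.2 x.2 :=
      hH.measurable.comp ((measurable_snd.comp measurable_fst).prodMk measurable_snd)
    have h2 : Measurable fun x : (U × U) × S => H x.1.1 x.2 :=
      hH.measurable.comp ((measurable_fst.comp measurable_fst).prodMk measurable_snd)
    have h3 : Measurable fun x : (U × U) × S => Hbar x.1.2 :=
      hH.measurable_mean.comp (measurable_snd.comp measurable_fst)
    have h4 : Measurable fun x : (U × U) × S => Hbar x.1.1 :=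
      hH.measurable_mean.comp (measurable_fst.comp measurable_fst)
    exact (h1.sub h2).sub (h3.sub h4)
  have hint : ∀ i (w : U × U), Integrable (fun σ => H w.2 σ - H w.1 σ) (P.map (smp i)) := fun i w =>
    (hH.integrable i w.2).sub (hH.integrable i w.1)
  have hmean : ∀ i (w : U × U), ∫ σ, (H w.2 σ - H w.1 σ) ∂(P.map (smp i)) = Hbar w.2 - Hbar w.1 := by
    intro i w
    rw [integral_sub (hH.integrable i w.2) (hH.integrable i w.1), hH.integral_eq, hH.integral_eq]
  have hvar := fun i ω => integral_norm_sub_sq_le (ν := P.map (smp i))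
    ((hHu (u' ω)).sub (hHu (u ω))) (hint i (u ω, u' ω)) (hmean i (u ω, u' ω)) (hl ω)
  have key := memLp_add_batch hm hind hb hbs (A := fun ω => D ω - Hbar (u ω))
    (u := fun ω => (u ω, u' ω)) (h := h) (φ := l) (hD.sub (hH.measurable_mean.comp hu))
    (hu.prodMk hu') hhm
    (fun i ω => (hint i (u ω, u' ω)).sub (integrable_const _))
    (fun i ω => by
      rw [hh]
      rw [integral_sub (hint i (u ω, u' ω)) (integrable_const _), hmean, integral_const,
        probReal_univ, one_smul, sub_self])
    (fun i ω => (hvar i ω).1) (fun i ω => (hvar i ω).2) hD2 hli (N : ℝ)⁻¹ N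
  have e : ∀ ω, D ω - Hbar (u ω) + (N : ℝ)⁻¹ • ∑ i ∈ Finset.range N, h (u ω, u' ω) (smp (b i) ω)
      = D' ω - Hbar (u' ω) := by
    intro ω
    simp only [hh, D', Finset.sum_sub_distrib, Finset.sum_const, Finset.card_range, smul_sub]
    rw [← Nat.cast_smul_eq_nsmul ℝ, ← Nat.cast_smul_eq_nsmul ℝ, smul_smul, smul_smul,
      inv_mul_cancel₀ hN0, one_smul, one_smul]
    abel
  simp only [e] at key
  refine ⟨?_, key.2.1, key.2.2.trans (le_of_eq ?_)⟩
  · have h1 := key.1.add ((hH.measurable_mean.comp hu').mono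
      (past_mono smp (Set.subset_union_left (t := b '' {i | i < N}))) le_rfl)
    have hD' : D' = fun ω => (D' ω - Hbar (u' ω)) + Hbar (u' ω) := by
      funext ω
      exact (sub_add_cancel _ _).symm
    rw [hD']
    exact h1
  · field_simp

/-- The same argument with no previous error: start the batch sum from `A = 0`. -/
theorem UnbiasedField.batch_error (hH : UnbiasedField P smp H Hbar)
    (hm : ∀ i, Measurable (smp i)) (hind : iIndepFun smp P)
    (hb : Function.Injective b) (hbs : ∀ i, b i ∉ s) {u : Ω → U} {v : ℝ}
    (hu : Measurable[past smp s] u)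
    (hv : ∀ i ω, Integrable (fun σ => ‖H (u ω) σ - Hbar (u ω)‖ ^ 2) (P.map (smp i)) ∧
      ∫ σ, ‖H (u ω) σ - Hbar (u ω)‖ ^ 2 ∂(P.map (smp i)) ≤ v) {N : ℕ} (hN : 0 < N) :
    let D' := fun ω => (N : ℝ)⁻¹ • ∑ i ∈ Finset.range N, H (u ω) (smp (b i) ω)
    Measurable[past smp (s ∪ b '' {i | i < N})] D' ∧
    MemLp (fun ω => D' ω - Hbar (u ω)) 2 P ∧
    ∫ ω, ‖D' ω - Hbar (u ω)‖ ^ 2 ∂P ≤ v / N := by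
  intro D'
  have hν : ∀ i, IsProbabilityMeasure (P.map (smp i)) := fun i =>
    Measure.isProbabilityMeasure_map (hm i).aemeasurable
  have hN0 : (N : ℝ) ≠ 0 := Nat.cast_ne_zero.2 hN.ne'
  set h : U → S → V := fun w σ => H w σ - Hbar w with hh
  have hhm : Measurable (Function.uncurry h) :=
    hH.measurable.sub (hH.measurable_mean.comp measurable_fst)
  have key := memLp_add_batch hm hind hb hbs (A := fun _ => (0 : V)) (u := u) (h := h)
    (φ := fun _ => v) measurable_const hu hhm
    (fun i ω => (hH.integrable i (u ω)).sub (integrable_const _))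
    (fun i ω => by
      rw [hh]
      rw [integral_sub (hH.integrable i (u ω)) (integrable_const _), hH.integral_eq, integral_const,
        probReal_univ, one_smul, sub_self])
    (fun i ω => (hv i ω).1) (fun i ω => (hv i ω).2) (MemLp.zero) (integrable_const v) (N : ℝ)⁻¹ N
  have e : ∀ ω, 0 + (N : ℝ)⁻¹ • ∑ i ∈ Finset.range N, h (u ω) (smp (b i) ω)
      = D' ω - Hbar (u ω) := by
    intro ω
    simp only [hh, D', Finset.sum_sub_distrib, Finset.sum_const, Finset.card_range, smul_sub]
    rw [← Nat.cast_smul_eq_nsmul ℝ, smul_smul, inv_mul_cancel₀ hN0, one_smul, zero_add]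
  simp only [e] at key
  refine ⟨?_, key.2.1, key.2.2.trans (le_of_eq ?_)⟩
  · have h1 := key.1.add ((hH.measurable_mean.comp hu).mono
      (past_mono smp (Set.subset_union_left (t := b '' {i | i < N}))) le_rfl)
    have hD' : D' = fun ω => (D' ω - Hbar (u ω)) + Hbar (u ω) := by
      funext ω
      exact (sub_add_cancel _ _).symm
    rw [hD']
    exact h1
  · simp only [norm_zero, ne_eq, OfNat.ofNat_ne_zero, not_false_eq_true, zero_pow, integral_zero,
      integral_const, probReal_univ, one_smul, zero_add]
    field_simp

end Spider

/-! ### Measurability of derivatives in the sample -/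

section MeasurableDeriv

open Filter Topology

variable {E S : Type*} [NormedAddCommGroup E] [InnerProductSpace ℝ E] [FiniteDimensional ℝ E]
  [CompleteSpace E] [MeasurableSpace E] [BorelSpace E] [MeasurableSpace S]

omit [MeasurableSpace E] [BorelSpace E] in
theorem gradient_eq_sum (h : E → ℝ) (z : E) :
    gradient h z = ∑ i, fderiv ℝ h z (stdOrthonormalBasis ℝ E i) • stdOrthonormalBasis ℝ E i := by
  rw [← (stdOrthonormalBasis ℝ E).sum_repr' (gradient h z)]
  refine Finset.sum_congr rfl fun i _ => ?_
  rw [real_inner_comm, inner_gradient_left]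

omit [MeasurableSpace E] [BorelSpace E] in
theorem continuous_gradient {h : E → ℝ} (hh : ContDiff ℝ 1 h) : Continuous (gradient h) := by
  have h1 : Continuous (fderiv ℝ h) := hh.continuous_fderiv (by norm_num)
  have : gradient h = fun z => ∑ i, fderiv ℝ h z (stdOrthonormalBasis ℝ E i) •
      stdOrthonormalBasis ℝ E i := funext (gradient_eq_sum h)
  rw [this]
  exact continuous_finsetSum _ fun i _ => (h1.clm_apply continuous_const).smul continuous_const

theorem tendsto_norm_natCast : Tendsto (fun n : ℕ => ‖(n : ℝ)‖) atTop atTop :=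
  tendsto_norm_atTop_atTop.comp tendsto_natCast_atTop_atTop

/-- The gradient is continuous in the point, so measurability in the sample at each fixed point
gives joint measurability. At a fixed point the partial derivatives are limits of difference
quotients of measurable functions. -/
theorem measurable_gradient_sample {H : E → S → ℝ} (hm : ∀ z, Measurable (H z))
    (hd : ∀ σ, ContDiff ℝ 1 fun z => H z σ) :
    Measurable (Function.uncurry fun z σ => gradient (fun w => H w σ) z) := by
  have := FiniteDimensional.proper_real E
  have : SecondCountableTopology E := secondCountable_of_proper
  refine measurable_uncurry_of_continuous_of_measurable
    (fun σ => continuous_gradient (hd σ)) fun z => ?_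
  simp only [gradient_eq_sum]
  refine Finset.measurable_sum _ fun i _ => Measurable.smul_const ?_ _
  refine measurable_of_tendsto_metrizable
    (f := fun (n : ℕ) σ => (n : ℝ) • (H (z + (n : ℝ)⁻¹ • stdOrthonormalBasis ℝ E i) σ - H z σ))
    (fun n => ((hm _).sub (hm _)).const_smul (n : ℝ)) ?_
  rw [tendsto_pi_nhds]
  intro σ
  exact ((hd σ).differentiable (by norm_num) z).hasFDerivAt.lim _ tendsto_norm_natCast

/-- A limit of difference quotients of the jointly measurable gradient, along the increments `v/n`.
-/
theorem measurable_fderiv_gradient_sample {H : E → S → ℝ} (hm : ∀ z, Measurable (H z))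
    (hd : ∀ σ, ContDiff ℝ 2 fun z => H z σ) :
    Measurable fun x : (E × E) × S => fderiv ℝ (gradient fun w => H w x.2) x.1.1 x.1.2 := by
  have := FiniteDimensional.proper_real E
  have : SecondCountableTopology E := secondCountable_of_proper
  have hg := measurable_gradient_sample hm fun σ => (hd σ).of_le (by norm_num)
  refine measurable_of_tendsto_metrizable
    (f := fun (n : ℕ) (x : (E × E) × S) =>
      (n : ℝ) • (gradient (fun w => H w x.2) (x.1.1 + (n : ℝ)⁻¹ • x.1.2)
        - gradient (fun w => H w x.2) x.1.1)) (fun n => ?_) ?_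
  · have h1 : Measurable fun x : (E × E) × S => (x.1.1 + (n : ℝ)⁻¹ • x.1.2, x.2) := by fun_prop
    have h2 : Measurable fun x : (E × E) × S => (x.1.1, x.2) := by fun_prop
    exact ((hg.comp h1).sub (hg.comp h2)).const_smul _
  · rw [tendsto_pi_nhds]
    intro x
    exact ((contDiff_gradient (hd x.2)).differentiable (by norm_num) x.1.1).hasFDerivAt.lim _
      tendsto_norm_natCast

end MeasurableDeriv

/-! ### The sample directions are unbiased -/

section SampleFields

variable {p q : ℕ} {S S' : Type*} [MeasurableSpace S] [MeasurableSpace S']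

theorem measurable_gradY_sample {G : Pair p q → S → ℝ} (hm : ∀ z, Measurable (G z))
    (hd : ∀ σ, ContDiff ℝ 2 fun z => G z σ) :
    Measurable fun x : Pair p q × S => gradY (fun w => G w x.2) x.1 := by
  have h1 : (fun x : Pair p q × S => gradY (fun w => G w x.2) x.1) =
      fun x => WithLp.sndL 2 ℝ (Vec p) (Vec q) (gradient (fun w => G w x.2) x.1) :=
    funext fun x => gradY_eq ((hd x.2).differentiable (by norm_num) _)
  rw [h1]
  exact (WithLp.sndL 2 ℝ (Vec p) (Vec q)).continuous.measurable.comp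
    (measurable_gradient_sample hm fun σ => (hd σ).of_le (by norm_num))

theorem measurable_fieldV_sample {F : Pair p q → S → ℝ} {G : Pair p q → S' → ℝ}
    (hFm : ∀ z, Measurable (F z)) (hFd : ∀ σ, ContDiff ℝ 1 fun z => F z σ)
    (hGm : ∀ z, Measurable (G z)) (hGd : ∀ σ, ContDiff ℝ 2 fun z => G z σ) :
    Measurable fun x : (Pair p q × Vec q) × (S × S') =>
      fieldV (fun w => F w x.2.1) (fun w => G w x.2.2) x.1.1 x.1.2 := by
  have h1 : (fun x : (Pair p q × Vec q) × (S × S') =>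
      fieldV (fun w => F w x.2.1) (fun w => G w x.2.2) x.1.1 x.1.2) =
      fun x => WithLp.sndL 2 ℝ (Vec p) (Vec q)
          (fderiv ℝ (gradient fun w => G w x.2.2) x.1.1 (inY p q x.1.2))
        - WithLp.sndL 2 ℝ (Vec p) (Vec q) (gradient (fun w => F w x.2.1) x.1.1) := by
    funext x
    unfold fieldV
    rw [hessYY_apply (hGd x.2.2), gradY_eq ((hFd x.2.1).differentiable (by norm_num) _)]
    rfl
  have hsnd := (WithLp.sndL 2 ℝ (Vec p) (Vec q)).continuous.measurable
  have h2 : Measurable fun x : (Pair p q × Vec q) × (S × S') =>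
      ((x.1.1, inY p q x.1.2), x.2.2) := by
    have := (inY p q).continuous.measurable
    fun_prop
  have h3 : Measurable fun x : (Pair p q × Vec q) × (S × S') => (x.1.1, x.2.1) := by fun_prop
  rw [h1]
  exact (hsnd.comp ((measurable_fderiv_gradient_sample hGm hGd).comp h2)).sub
    (hsnd.comp ((measurable_gradient_sample hFm hFd).comp h3))

theorem measurable_fieldX_sample {F : Pair p q → S → ℝ} {G : Pair p q → S' → ℝ}
    (hFm : ∀ z, Measurable (F z)) (hFd : ∀ σ, ContDiff ℝ 1 fun z => F z σ)
    (hGm : ∀ z, Measurable (G z)) (hGd : ∀ σ, ContDiff ℝ 2 fun z => G z σ) :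
    Measurable fun x : (Pair p q × Vec q) × (S × S') =>
      fieldX (fun w => F w x.2.1) (fun w => G w x.2.2) x.1.1 x.1.2 := by
  have h1 : (fun x : (Pair p q × Vec q) × (S × S') =>
      fieldX (fun w => F w x.2.1) (fun w => G w x.2.2) x.1.1 x.1.2) =
      fun x => WithLp.fstL 2 ℝ (Vec p) (Vec q) (gradient (fun w => F w x.2.1) x.1.1)
        - WithLp.fstL 2 ℝ (Vec p) (Vec q)
          (fderiv ℝ (gradient fun w => G w x.2.2) x.1.1 (inY p q x.1.2)) := by
    funext x
    unfold fieldX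
    rw [jacXY_apply (hGd x.2.2), gradX_eq ((hFd x.2.1).differentiable (by norm_num) _)]
    rfl
  have hfst := (WithLp.fstL 2 ℝ (Vec p) (Vec q)).continuous.measurable
  have h2 : Measurable fun x : (Pair p q × Vec q) × (S × S') =>
      ((x.1.1, inY p q x.1.2), x.2.2) := by
    have := (inY p q).continuous.measurable
    fun_prop
  have h3 : Measurable fun x : (Pair p q × Vec q) × (S × S') => (x.1.1, x.2.1) := by fun_prop
  rw [h1]
  exact (hfst.comp ((measurable_gradient_sample hFm hFd).comp h3)).sub
    (hfst.comp ((measurable_fderiv_gradient_sample hGm hGd).comp h2))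

/-- The deterministic case is a sample function that ignores its sample; `ℝ` serves as a dummy
sample space. -/
theorem measurable_gradY {g : Pair p q → ℝ} (hg : ContDiff ℝ 2 g) : Measurable (gradY g) := by
  have h := measurable_gradY_sample (S := ℝ) (G := fun z _ => g z) (fun _ => measurable_const)
    (fun _ => hg)
  have h2 : Measurable fun z : Pair p q => (z, (0 : ℝ)) := measurable_id.prodMk measurable_const
  exact h.comp h2

theorem measurable_fieldV {f g : Pair p q → ℝ} (hf : ContDiff ℝ 1 f) (hg : ContDiff ℝ 2 g) :
    Measurable fun u : Pair p q × Vec q => fieldV f g u.1 u.2 := by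
  have h := measurable_fieldV_sample (S := ℝ) (S' := ℝ) (F := fun z _ => f z)
    (G := fun z _ => g z) (fun _ => measurable_const) (fun _ => hf) (fun _ => measurable_const)
    (fun _ => hg)
  have h2 : Measurable fun u : Pair p q × Vec q => (u, ((0 : ℝ), (0 : ℝ))) :=
    measurable_id.prodMk measurable_const
  have h3 := h.comp h2
  exact h3

theorem measurable_fieldX {f g : Pair p q → ℝ} (hf : ContDiff ℝ 1 f) (hg : ContDiff ℝ 2 g) :
    Measurable fun u : Pair p q × Vec q => fieldX f g u.1 u.2 := by
  have h := measurable_fieldX_sample (S := ℝ) (S' := ℝ) (F := fun z _ => f z)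
    (G := fun z _ => g z) (fun _ => measurable_const) (fun _ => hf) (fun _ => measurable_const)
    (fun _ => hg)
  have h2 : Measurable fun u : Pair p q × Vec q => (u, ((0 : ℝ), (0 : ℝ))) :=
    measurable_id.prodMk measurable_const
  have h3 := h.comp h2
  exact h3

end SampleFields

/-! ### Unbiasedness and variance of the sample directions -/

section Unbiased

variable {p q : ℕ} {Ξ Z Ω : Type*} [MeasurableSpace Ξ] [MeasurableSpace Z] [MeasurableSpace Ω]
  {Q : Problem p q Ξ Z} {c : Consts} {P : Measure Ω} {smp : Slot → Ω → Ξ × Z} {K : ℕ}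
  {κ : Ω → Fin K}

theorem IsSampling.map_fst (hS : IsSampling Q P smp K κ) (i : Slot) :
    (P.map (smp i)).map Prod.fst = Q.lawXi := by
  rw [Measure.map_map measurable_fst (hS.measurable_smp i)]
  exact hS.law_xi i

theorem IsSampling.map_snd (hS : IsSampling Q P smp K κ) (i : Slot) :
    (P.map (smp i)).map Prod.snd = Q.lawZeta := by
  rw [Measure.map_map measurable_snd (hS.measurable_smp i)]
  exact hS.law_delta i

/-- Only the marginals of a pair `(ξ, δ)` are prescribed. That is enough, because each direction is
a sum of terms depending on a single component. -/
theorem IsSampling.integral_fst {V : Type*} [NormedAddCommGroup V] [NormedSpace ℝ V]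
    (hS : IsSampling Q P smp K κ) (i : Slot) {X : Ξ → V} (hX : Integrable X Q.lawXi) :
    Integrable (fun σ => X σ.1) (P.map (smp i)) ∧
      ∫ σ, X σ.1 ∂(P.map (smp i)) = ∫ ξ, X ξ ∂Q.lawXi := by
  rw [← hS.map_fst i] at hX
  refine ⟨hX.comp_measurable measurable_fst, ?_⟩
  rw [← hS.map_fst i, integral_map measurable_fst.aemeasurable hX.aestronglyMeasurable]

theorem IsSampling.integral_snd {V : Type*} [NormedAddCommGroup V] [NormedSpace ℝ V]
    (hS : IsSampling Q P smp K κ) (i : Slot) {X : Z → V} (hX : Integrable X Q.lawZeta) :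
    Integrable (fun σ => X σ.2) (P.map (smp i)) ∧
      ∫ σ, X σ.2 ∂(P.map (smp i)) = ∫ ζ, X ζ ∂Q.lawZeta := by
  rw [← hS.map_snd i] at hX
  refine ⟨hX.comp_measurable measurable_snd, ?_⟩
  rw [← hS.map_snd i, integral_map measurable_snd.aemeasurable hX.aestronglyMeasurable]

/-- The sample direction for `y`, as a function of the point. -/
noncomputable def Problem.smpY (Q : Problem p q Ξ Z) (z : Pair p q) (σ : Ξ × Z) : Vec q :=
  gradY (fun w => Q.G w σ.2) z

/-- The sample direction for `v`. -/
noncomputable def Problem.smpV (Q : Problem p q Ξ Z) (u : Pair p q × Vec q) (σ : Ξ × Z) : Vec q :=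
  fieldV (fun w => Q.F w σ.1) (fun w => Q.G w σ.2) u.1 u.2

/-- The sample direction for `x`. -/
noncomputable def Problem.smpX (Q : Problem p q Ξ Z) (u : Pair p q × Vec q) (σ : Ξ × Z) : Vec p :=
  fieldX (fun w => Q.F w σ.1) (fun w => Q.G w σ.2) u.1 u.2

theorem NoiseConds.gradX_F (h : NoiseConds Q c) (hr : Regular Q c) (z : Pair p q) :
    Unbiased Q.lawXi (fun ξ => gradX (fun w => Q.F w ξ) z) (gradX Q.f z) := by
  have e : (fun ξ => gradX (fun w => Q.F w ξ) z) = fun ξ =>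
      WithLp.fstL 2 ℝ (Vec p) (Vec q) (gradient (fun w => Q.F w ξ) z) :=
    funext fun ξ => gradX_eq ((hr.contDiff_F ξ).differentiable (by norm_num) _)
  obtain ⟨h1, h2⟩ := h.unbiased_F z
  rw [Unbiased, e]
  refine ⟨(WithLp.fstL 2 ℝ (Vec p) (Vec q)).integrable_comp h1, ?_⟩
  rw [ContinuousLinearMap.integral_comp_comm _ h1, h2, gradX_eq (hr.differentiable_f _)]
  rfl

theorem NoiseConds.gradY_F (h : NoiseConds Q c) (hr : Regular Q c) (z : Pair p q) :
    Unbiased Q.lawXi (fun ξ => gradY (fun w => Q.F w ξ) z) (gradY Q.f z) := by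
  have e : (fun ξ => gradY (fun w => Q.F w ξ) z) = fun ξ =>
      WithLp.sndL 2 ℝ (Vec p) (Vec q) (gradient (fun w => Q.F w ξ) z) :=
    funext fun ξ => gradY_eq ((hr.contDiff_F ξ).differentiable (by norm_num) _)
  obtain ⟨h1, h2⟩ := h.unbiased_F z
  rw [Unbiased, e]
  refine ⟨(WithLp.sndL 2 ℝ (Vec p) (Vec q)).integrable_comp h1, ?_⟩
  rw [ContinuousLinearMap.integral_comp_comm _ h1, h2, gradY_eq (hr.differentiable_f _)]
  rfl

theorem NoiseConds.gradY_G (h : NoiseConds Q c) (hr : Regular Q c) (z : Pair p q) :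
    Unbiased Q.lawZeta (fun ζ => gradY (fun w => Q.G w ζ) z) (gradY Q.g z) := by
  have e : (fun ζ => gradY (fun w => Q.G w ζ) z) = fun ζ =>
      WithLp.sndL 2 ℝ (Vec p) (Vec q) (gradient (fun w => Q.G w ζ) z) :=
    funext fun ζ => gradY_eq ((hr.contDiff_G ζ).differentiable (by norm_num) _)
  obtain ⟨h1, h2⟩ := h.unbiased_G z
  rw [Unbiased, e]
  refine ⟨(WithLp.sndL 2 ℝ (Vec p) (Vec q)).integrable_comp h1, ?_⟩
  rw [ContinuousLinearMap.integral_comp_comm _ h1, h2, gradY_eq (hr.differentiable_g _)]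
  rfl

theorem Unbiased.apply {S : Type*} [MeasurableSpace S] {E V : Type*} [NormedAddCommGroup E]
    [NormedSpace ℝ E] [NormedAddCommGroup V] [NormedSpace ℝ V] {ν : Measure S}
    {X : S → E →L[ℝ] V} {m : E →L[ℝ] V} (h : Unbiased ν X m) (v : E) :
    Unbiased ν (fun σ => X σ v) (m v) :=
  ⟨h.1.apply_continuousLinearMap v, by rw [← ContinuousLinearMap.integral_apply h.1, h.2]⟩

theorem unbiasedField_smpY (hQ : Assumptions Q c) (hS : IsSampling Q P smp K κ) :
    UnbiasedField P smp Q.smpY (gradY Q.g) := by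
  refine ⟨?_, measurable_gradY hQ.regular.contDiff_g, fun i z => ?_, fun i z => ?_⟩
  · have h := measurable_gradY_sample hQ.regular.measurable_G hQ.regular.contDiff_G
    have h2 : Measurable fun x : Pair p q × (Ξ × Z) => (x.1, x.2.2) := by fun_prop
    exact h.comp h2
  · exact (hS.integral_snd i (hQ.noise.gradY_G hQ.regular z).1).1
  · exact ((hS.integral_snd i (hQ.noise.gradY_G hQ.regular z).1).2).trans
      (hQ.noise.gradY_G hQ.regular z).2

theorem unbiasedField_smpV (hQ : Assumptions Q c) (hS : IsSampling Q P smp K κ) :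
    UnbiasedField P smp Q.smpV (fun u => fieldV Q.f Q.g u.1 u.2) := by
  have h1 := fun u : Pair p q × Vec q => (hQ.noise.unbiased_hess u.1).apply u.2
  have h2 := fun u : Pair p q × Vec q => hQ.noise.gradY_F hQ.regular u.1
  have h3 := fun i u => hS.integral_snd i (h1 u).1
  have h4 := fun i u => hS.integral_fst i (h2 u).1
  refine ⟨?_, measurable_fieldV hQ.regular.contDiff_f hQ.regular.contDiff_g, fun i u => ?_,
    fun i u => ?_⟩
  · exact measurable_fieldV_sample hQ.regular.measurable_F hQ.regular.contDiff_F
      hQ.regular.measurable_G hQ.regular.contDiff_G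
  · exact (h3 i u).1.sub (h4 i u).1
  · unfold Problem.smpV fieldV
    rw [integral_sub (h3 i u).1 (h4 i u).1, (h3 i u).2, (h4 i u).2, (h1 u).2, (h2 u).2]

theorem unbiasedField_smpX (hQ : Assumptions Q c) (hS : IsSampling Q P smp K κ) :
    UnbiasedField P smp Q.smpX (fun u => fieldX Q.f Q.g u.1 u.2) := by
  have h1 := fun u : Pair p q × Vec q => (hQ.noise.unbiased_jac u.1).apply u.2
  have h2 := fun u : Pair p q × Vec q => hQ.noise.gradX_F hQ.regular u.1
  have h3 := fun i u => hS.integral_snd i (h1 u).1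
  have h4 := fun i u => hS.integral_fst i (h2 u).1
  refine ⟨?_, measurable_fieldX hQ.regular.contDiff_f hQ.regular.contDiff_g, fun i u => ?_,
    fun i u => ?_⟩
  · exact measurable_fieldX_sample hQ.regular.measurable_F hQ.regular.contDiff_F
      hQ.regular.measurable_G hQ.regular.contDiff_G
  · exact (h4 i u).1.sub (h3 i u).1
  · unfold Problem.smpX fieldX
    rw [integral_sub (h4 i u).1 (h3 i u).1, (h3 i u).2, (h4 i u).2, (h1 u).2, (h2 u).2]

/-- A bound for the variance of each of the sample directions. -/
noncomputable def Consts.sigSq (c : Consts) (M : ℝ) : ℝ :=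
  c.sigg ^ 2 + 2 * (c.sigf ^ 2 + M ^ 2 * c.siggyy ^ 2) + 2 * (c.sigf ^ 2 + M ^ 2 * c.siggxy ^ 2)

theorem variance_smpY (hQ : Assumptions Q c) (hS : IsSampling Q P smp K κ) (M : ℝ)
    (i : Slot) (z : Pair p q) :
    Integrable (fun σ => ‖Q.smpY z σ - gradY Q.g z‖ ^ 2) (P.map (smp i)) ∧
      ∫ σ, ‖Q.smpY z σ - gradY Q.g z‖ ^ 2 ∂(P.map (smp i)) ≤ c.sigSq M := by
  have h1 := hS.integral_snd i (hQ.noise.var_G z).1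
  have hle : ∀ σ, ‖Q.smpY z σ - gradY Q.g z‖ ^ 2
      ≤ ‖gradient (fun w => Q.G w σ.2) z - gradient Q.g z‖ ^ 2 := by
    intro σ
    unfold Problem.smpY
    rw [gradY_eq (hQ.regular.differentiable_g _),
      gradY_eq ((hQ.regular.contDiff_G σ.2).differentiable (by norm_num) _)]
    exact pow_le_pow_left₀ (norm_nonneg _)
      (norm_snd_le (gradient (fun w => Q.G w σ.2) z - gradient Q.g z)) 2
  have hm : Measurable fun σ => ‖Q.smpY z σ - gradY Q.g z‖ ^ 2 :=
    ((((unbiasedField_smpY hQ hS).measurable.comp measurable_prodMk_left).sub_const _).norm).pow_const 2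
  have hi : Integrable (fun σ => ‖Q.smpY z σ - gradY Q.g z‖ ^ 2) (P.map (smp i)) :=
    h1.1.mono' hm.aestronglyMeasurable (Filter.Eventually.of_forall fun σ => by
      rw [Real.norm_of_nonneg (sq_nonneg _)]; exact hle σ)
  refine ⟨hi, (integral_mono hi h1.1 hle).trans ?_⟩
  rw [h1.2]
  refine (hQ.noise.var_G z).2.trans ?_
  unfold Consts.sigSq
  have : 0 ≤ 2 * (c.sigf ^ 2 + M ^ 2 * c.siggyy ^ 2) := by positivity
  have : 0 ≤ 2 * (c.sigf ^ 2 + M ^ 2 * c.siggxy ^ 2) := by positivity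
  linarith

/-- The two components may be dependent, so the variances are combined by `‖a + b‖² ≤ 2‖a‖² +
2‖b‖²`; the bound `‖v‖ ≤ M` turns the operator norm variance into that of the product. -/
theorem variance_smpV (hQ : Assumptions Q c) (hS : IsSampling Q P smp K κ) {M : ℝ}
    (i : Slot) (u : Pair p q × Vec q) (hu : ‖u.2‖ ≤ M) :
    Integrable (fun σ => ‖Q.smpV u σ - fieldV Q.f Q.g u.1 u.2‖ ^ 2) (P.map (smp i)) ∧
      ∫ σ, ‖Q.smpV u σ - fieldV Q.f Q.g u.1 u.2‖ ^ 2 ∂(P.map (smp i)) ≤ c.sigSq M := by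
  have h1 := hS.integral_fst i (hQ.noise.var_F u.1).1
  have h2 := hS.integral_snd i (hQ.noise.var_hess u.1).1
  have hle : ∀ σ, ‖Q.smpV u σ - fieldV Q.f Q.g u.1 u.2‖ ^ 2
      ≤ 2 * ‖gradient (fun w => Q.F w σ.1) u.1 - gradient Q.f u.1‖ ^ 2
        + 2 * M ^ 2 * ‖hessYY (fun w => Q.G w σ.2) u.1 - hessYY Q.g u.1‖ ^ 2 := by
    intro σ
    have e : Q.smpV u σ - fieldV Q.f Q.g u.1 u.2 =
        -(gradY (fun w => Q.F w σ.1) u.1 - gradY Q.f u.1)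
        + (hessYY (fun w => Q.G w σ.2) u.1 - hessYY Q.g u.1) u.2 := by
      unfold Problem.smpV fieldV
      rw [sub_apply]; abel
    rw [e]
    refine (sq_norm_add_le_two _ _).trans ?_
    rw [norm_neg, gradY_eq (hQ.regular.differentiable_f _),
      gradY_eq ((hQ.regular.contDiff_F σ.1).differentiable (by norm_num) _)]
    have h3 := pow_le_pow_left₀ (norm_nonneg _)
      (norm_snd_le (gradient (fun w => Q.F w σ.1) u.1 - gradient Q.f u.1)) 2
    have h4 := pow_le_pow_left₀ (norm_nonneg _)
      ((hessYY (fun w => Q.G w σ.2) u.1 - hessYY Q.g u.1).le_opNorm_of_le hu) 2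
    rw [mul_pow] at h4
    have h3' : ‖(gradient (fun w => Q.F w σ.1) u.1).snd - (gradient Q.f u.1).snd‖ ^ 2
      ≤ ‖gradient (fun w => Q.F w σ.1) u.1 - gradient Q.f u.1‖ ^ 2 := h3
    linarith
  have hm : Measurable fun σ => ‖Q.smpV u σ - fieldV Q.f Q.g u.1 u.2‖ ^ 2 :=
    ((((unbiasedField_smpV hQ hS).measurable.comp measurable_prodMk_left).sub_const _).norm).pow_const 2
  have hdom := (h1.1.const_mul 2).add (h2.1.const_mul (2 * M ^ 2))
  have hi : Integrable (fun σ => ‖Q.smpV u σ - fieldV Q.f Q.g u.1 u.2‖ ^ 2) (P.map (smp i)) :=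
    hdom.mono' hm.aestronglyMeasurable (Filter.Eventually.of_forall fun σ => by
      rw [Real.norm_of_nonneg (sq_nonneg _)]; exact hle σ)
  refine ⟨hi, (integral_mono hi hdom hle).trans ?_⟩
  rw [integral_add' (h1.1.const_mul 2) (h2.1.const_mul (2 * M ^ 2)), integral_const_mul,
    integral_const_mul, h1.2, h2.2]
  have h5 := (hQ.noise.var_F u.1).2
  have h6 := mul_le_mul_of_nonneg_left (hQ.noise.var_hess u.1).2 (sq_nonneg M)
  unfold Consts.sigSq
  have : 0 ≤ 2 * (c.sigf ^ 2 + M ^ 2 * c.siggxy ^ 2) := by positivity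
  nlinarith [sq_nonneg c.sigg]

theorem variance_smpX (hQ : Assumptions Q c) (hS : IsSampling Q P smp K κ) {M : ℝ}
    (i : Slot) (u : Pair p q × Vec q) (hu : ‖u.2‖ ≤ M) :
    Integrable (fun σ => ‖Q.smpX u σ - fieldX Q.f Q.g u.1 u.2‖ ^ 2) (P.map (smp i)) ∧
      ∫ σ, ‖Q.smpX u σ - fieldX Q.f Q.g u.1 u.2‖ ^ 2 ∂(P.map (smp i)) ≤ c.sigSq M := by
  have h1 := hS.integral_fst i (hQ.noise.var_F u.1).1
  have h2 := hS.integral_snd i (hQ.noise.var_jac u.1).1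
  have hle : ∀ σ, ‖Q.smpX u σ - fieldX Q.f Q.g u.1 u.2‖ ^ 2
      ≤ 2 * ‖gradient (fun w => Q.F w σ.1) u.1 - gradient Q.f u.1‖ ^ 2
        + 2 * M ^ 2 * ‖jacXY (fun w => Q.G w σ.2) u.1 - jacXY Q.g u.1‖ ^ 2 := by
    intro σ
    have e : Q.smpX u σ - fieldX Q.f Q.g u.1 u.2 =
        (gradX (fun w => Q.F w σ.1) u.1 - gradX Q.f u.1)
        + -((jacXY (fun w => Q.G w σ.2) u.1 - jacXY Q.g u.1) u.2) := by
      unfold Problem.smpX fieldX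
      rw [sub_apply]; abel
    rw [e]
    refine (sq_norm_add_le_two _ _).trans ?_
    rw [norm_neg, gradX_eq (hQ.regular.differentiable_f _),
      gradX_eq ((hQ.regular.contDiff_F σ.1).differentiable (by norm_num) _)]
    have h3 := pow_le_pow_left₀ (norm_nonneg _)
      (norm_fst_le (gradient (fun w => Q.F w σ.1) u.1 - gradient Q.f u.1)) 2
    have h4 := pow_le_pow_left₀ (norm_nonneg _)
      ((jacXY (fun w => Q.G w σ.2) u.1 - jacXY Q.g u.1).le_opNorm_of_le hu) 2
    rw [mul_pow] at h4
    have h3' : ‖(gradient (fun w => Q.F w σ.1) u.1).fst - (gradient Q.f u.1).fst‖ ^ 2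
      ≤ ‖gradient (fun w => Q.F w σ.1) u.1 - gradient Q.f u.1‖ ^ 2 := h3
    linarith
  have hm : Measurable fun σ => ‖Q.smpX u σ - fieldX Q.f Q.g u.1 u.2‖ ^ 2 :=
    ((((unbiasedField_smpX hQ hS).measurable.comp measurable_prodMk_left).sub_const _).norm).pow_const 2
  have hdom := (h1.1.const_mul 2).add (h2.1.const_mul (2 * M ^ 2))
  have hi : Integrable (fun σ => ‖Q.smpX u σ - fieldX Q.f Q.g u.1 u.2‖ ^ 2) (P.map (smp i)) :=
    hdom.mono' hm.aestronglyMeasurable (Filter.Eventually.of_forall fun σ => by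
      rw [Real.norm_of_nonneg (sq_nonneg _)]; exact hle σ)
  refine ⟨hi, (integral_mono hi hdom hle).trans ?_⟩
  rw [integral_add' (h1.1.const_mul 2) (h2.1.const_mul (2 * M ^ 2)), integral_const_mul,
    integral_const_mul, h1.2, h2.2]
  have h5 := (hQ.noise.var_F u.1).2
  have h6 := mul_le_mul_of_nonneg_left (hQ.noise.var_jac u.1).2 (sq_nonneg M)
  unfold Consts.sigSq
  have : 0 ≤ 2 * (c.sigf ^ 2 + M ^ 2 * c.siggyy ^ 2) := by positivity
  nlinarith [sq_nonneg c.sigg]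

end Unbiased

/-! ### The stages of a run -/

section Stages

variable {p q : ℕ} {Ξ Z : Type*} [MeasurableSpace Ξ] [MeasurableSpace Z]

/-- A problem with the parameters and the start of a run. -/
structure Trial (p q : ℕ) (Ξ Z : Type*) [MeasurableSpace Ξ] [MeasurableSpace Z] where
  Q : Problem p q Ξ Z
  a : Params
  x0 : Vec p
  y0 : Vec q
  v0 : Vec q

namespace Trial

variable (R : Trial p q Ξ Z) (σ : Slot → Ξ × Z)

/-- The state at the start of outer iteration `k`. -/
noncomputable def start (k : ℕ) : State p q := run R.Q R.a R.x0 R.y0 R.v0 σ k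

/-- The state after the refresh in outer iteration `k`. -/
noncomputable def fresh (k : ℕ) : State p q := refresh R.Q R.a σ k (R.start σ k)

/-- The new upper-level point of outer iteration `k`. -/
noncomputable def nextX (k : ℕ) : Vec p := (R.fresh σ k).x - R.a.alpha • (R.fresh σ k).Dx

/-- The state after `t` steps on `y` in outer iteration `k`. -/
noncomputable def yState (k t : ℕ) : YState p q :=
  yLoop R.Q R.a σ k (R.nextX σ k)
    ⟨(R.fresh σ k).x, (R.fresh σ k).y, (R.fresh σ k).Dy, (R.fresh σ k).count⟩ t

/-- The new lower-level point of outer iteration `k`. -/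
noncomputable def nextY (k : ℕ) : Vec q := (R.yState σ k R.a.T).y

/-- The state after `j` steps on `v` in outer iteration `k`. -/
noncomputable def vState (k j : ℕ) : VState p q :=
  vLoop R.Q R.a σ k (R.nextX σ k) (R.nextY σ k)
    ⟨(R.fresh σ k).x, (R.fresh σ k).y, (R.fresh σ k).v, (R.fresh σ k).Dx, (R.fresh σ k).Dv,
      (R.yState σ k R.a.T).count⟩ j

theorem start_succ (k : ℕ) : R.start σ (k + 1) =
    ⟨R.nextX σ k, R.nextY σ k, (R.vState σ k R.a.J).v, (R.vState σ k R.a.J).Dx,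
      (R.yState σ k R.a.T).Dy, (R.vState σ k R.a.J).Dv, (R.vState σ k R.a.J).count⟩ := rfl

theorem fresh_x (k : ℕ) : (R.fresh σ k).x = (R.start σ k).x := by
  unfold fresh refresh; split_ifs <;> rfl

theorem fresh_y (k : ℕ) : (R.fresh σ k).y = (R.start σ k).y := by
  unfold fresh refresh; split_ifs <;> rfl

theorem fresh_v (k : ℕ) : (R.fresh σ k).v = (R.start σ k).v := by
  unfold fresh refresh; split_ifs <;> rfl

theorem fresh_of_ne (k : ℕ) (h : k % R.a.q1 ≠ 0) : R.fresh σ k = R.start σ k := by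
  unfold fresh refresh; rw [if_neg h]

theorem yState_succ_x (k t : ℕ) : (R.yState σ k (t + 1)).x = R.nextX σ k := rfl

theorem yState_succ_y (k t : ℕ) : (R.yState σ k (t + 1)).y =
    (R.yState σ k t).y - (R.a.lam1 * R.a.beta) • (R.yState σ k t).Dy := rfl

theorem vState_succ_x (k j : ℕ) : (R.vState σ k (j + 1)).x = R.nextX σ k := rfl

theorem vState_succ_y (k j : ℕ) : (R.vState σ k (j + 1)).y = R.nextY σ k := rfl

theorem vState_succ_v (k j : ℕ) : (R.vState σ k (j + 1)).v =
    projBall R.a.M ((R.vState σ k j).v - (R.a.lam2 * R.a.eta) • (R.vState σ k j).Dv) := rfl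

theorem yState_T_x (hT : 0 < R.a.T) (k : ℕ) : (R.yState σ k R.a.T).x = R.nextX σ k := by
  obtain ⟨n, hn⟩ := Nat.exists_eq_succ_of_ne_zero hT.ne'
  rw [hn]; rfl

theorem vState_J_x (hJ : 0 < R.a.J) (k : ℕ) : (R.vState σ k R.a.J).x = R.nextX σ k := by
  obtain ⟨n, hn⟩ := Nat.exists_eq_succ_of_ne_zero hJ.ne'
  rw [hn]; rfl

theorem vState_J_y (hJ : 0 < R.a.J) (k : ℕ) : (R.vState σ k R.a.J).y = R.nextY σ k := by
  obtain ⟨n, hn⟩ := Nat.exists_eq_succ_of_ne_zero hJ.ne'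
  rw [hn]; rfl

/-- The error of the estimate in a state of the loop on `y`. -/
noncomputable def errY (k t : ℕ) : Vec q :=
  (R.yState σ k t).Dy - gradY R.Q.g (pt (R.yState σ k t).x (R.yState σ k t).y)

/-- The error of the estimate `Dv` in a state of the loop on `v`. -/
noncomputable def errV (k j : ℕ) : Vec q :=
  (R.vState σ k j).Dv
    - fieldV R.Q.f R.Q.g (pt (R.vState σ k j).x (R.vState σ k j).y) (R.vState σ k j).v

/-- The error of the estimate `Dx` in a state of the loop on `v`. -/
noncomputable def errX (k j : ℕ) : Vec p :=
  (R.vState σ k j).Dx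
    - fieldX R.Q.f R.Q.g (pt (R.vState σ k j).x (R.vState σ k j).y) (R.vState σ k j).v

/-- Without a restart both the estimate and the point where it was taken are carried over. A
positive `T` is needed for the last inner state to sit at the new point `x_{k+1}`. -/
theorem errY_succ_zero (hT : 0 < R.a.T) (k : ℕ) (h : (k + 1) % R.a.q1 ≠ 0) :
    R.errY σ (k + 1) 0 = R.errY σ k R.a.T := by
  have : R.yState σ (k + 1) 0 = ⟨(R.fresh σ (k + 1)).x, (R.fresh σ (k + 1)).y,
    (R.fresh σ (k + 1)).Dy, (R.fresh σ (k + 1)).count⟩ := rfl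
  unfold errY
  rw [this, R.fresh_of_ne σ (k + 1) h, start_succ, yState_T_x _ _ hT]
  rfl

theorem errV_succ_zero (hJ : 0 < R.a.J) (k : ℕ) (h : (k + 1) % R.a.q1 ≠ 0) :
    R.errV σ (k + 1) 0 = R.errV σ k R.a.J := by
  have : R.vState σ (k + 1) 0 = ⟨(R.fresh σ (k + 1)).x, (R.fresh σ (k + 1)).y,
    (R.fresh σ (k + 1)).v, (R.fresh σ (k + 1)).Dx, (R.fresh σ (k + 1)).Dv, _⟩ := rfl
  unfold errV
  rw [this, R.fresh_of_ne σ (k + 1) h, start_succ, vState_J_x _ _ hJ, vState_J_y _ _ hJ]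

theorem errX_succ_zero (hJ : 0 < R.a.J) (k : ℕ) (h : (k + 1) % R.a.q1 ≠ 0) :
    R.errX σ (k + 1) 0 = R.errX σ k R.a.J := by
  have : R.vState σ (k + 1) 0 = ⟨(R.fresh σ (k + 1)).x, (R.fresh σ (k + 1)).y,
    (R.fresh σ (k + 1)).v, (R.fresh σ (k + 1)).Dx, (R.fresh σ (k + 1)).Dv, _⟩ := rfl
  unfold errX
  rw [this, R.fresh_of_ne σ (k + 1) h, start_succ, vState_J_x _ _ hJ, vState_J_y _ _ hJ]

theorem norm_start_v_le (hM : 0 ≤ R.a.M) (hv0 : ‖R.v0‖ ≤ R.a.M) (hJ : 0 < R.a.J) (k : ℕ) :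
    ‖(R.start σ k).v‖ ≤ R.a.M := by
  cases k with
  | zero => exact hv0
  | succ k =>
    rw [start_succ]
    obtain ⟨n, hn⟩ := Nat.exists_eq_succ_of_ne_zero hJ.ne'
    change ‖(R.vState σ k R.a.J).v‖ ≤ _
    rw [hn, Nat.succ_eq_add_one, vState_succ_v]
    exact norm_projBall_le hM _

theorem norm_vState_v_le (hM : 0 ≤ R.a.M) (hv0 : ‖R.v0‖ ≤ R.a.M) (hJ : 0 < R.a.J) (k j : ℕ) :
    ‖(R.vState σ k j).v‖ ≤ R.a.M := by
  cases j with
  | zero =>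
    change ‖(R.fresh σ k).v‖ ≤ _
    rw [fresh_v]
    exact R.norm_start_v_le σ hM hv0 hJ k
  | succ j =>
    rw [vState_succ_v]
    exact norm_projBall_le hM _

end Trial

end Stages

/-! ### The order of the samples -/

namespace Slot

/-- The outer iteration of a sample. -/
def outer : Slot → ℕ
  | outerX k _ => k
  | outerY k _ => k
  | outerV k _ => k
  | innerY k _ _ => k
  | innerX k _ _ => k
  | innerV k _ _ => k

/-- The position of a sample within its outer iteration. -/
def stage (T : ℕ) : Slot → ℕ
  | outerX _ _ => 0
  | outerY _ _ => 0
  | outerV _ _ => 0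
  | innerY _ t _ => 1 + t
  -- Stage `0` is the restart and the `v`-loop follows the `T` steps on `y`. The `x`- and
  -- `v`-batches of one step may share a stage because the two errors are estimated separately.
  | innerX _ j _ => 1 + T + j
  | innerV _ j _ => 1 + T + j

/-- The samples drawn before stage `m` of outer iteration `k`. -/
def before (T k m : ℕ) : Set Slot :=
  {s | s.outer < k ∨ s.outer = k ∧ s.stage T < m}

theorem before_mono (T k : ℕ) {m n : ℕ} (h : m ≤ n) : before T k m ⊆ before T k n := by
  rintro s (hs | ⟨h1, h2⟩)
  · exact Or.inl hs
  · exact Or.inr ⟨h1, h2.trans_le h⟩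

theorem before_succ (T k m : ℕ) : before T k m ⊆ before T (k + 1) 0 := by
  rintro s (hs | ⟨h1, h2⟩)
  · exact Or.inl (Nat.lt_succ_of_lt hs)
  · exact Or.inl (h1 ▸ Nat.lt_succ_self _)

theorem union_image_subset_before {T k m : ℕ} {b : ℕ → Slot} (N : ℕ)
    (hb : ∀ i, (b i).outer = k ∧ (b i).stage T = m) :
    before T k m ∪ b '' {i | i < N} ⊆ before T k (m + 1) := by
  rintro s (hs | ⟨i, -, rfl⟩)
  · exact before_mono T k (Nat.le_succ m) hs
  · exact Or.inr ⟨(hb i).1, by rw [(hb i).2]; exact Nat.lt_succ_self m⟩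

theorem not_mem_before {T k m : ℕ} {s : Slot} (h : s.outer = k ∧ s.stage T = m) :
    s ∉ before T k m := by
  rintro (h1 | ⟨-, h2⟩)
  · exact absurd h.1 h1.ne
  · exact absurd h.2 h2.ne

end Slot

/-! ### Measurability, integrability and error recursion along a run -/

section Random

variable {p q : ℕ} {Ξ Z Ω : Type*} [MeasurableSpace Ξ] [MeasurableSpace Z] [mΩ : MeasurableSpace Ω]

omit mΩ in
theorem measurable_pt {m : MeasurableSpace Ω} {x : Ω → Vec p} {y : Ω → Vec q}
    (hx : Measurable[m] x) (hy : Measurable[m] y) : Measurable[m] fun ω => pt (x ω) (y ω) := by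
  have h : Measurable fun w : Vec p × Vec q => pt w.1 w.2 :=
    ((WithLp.prodContinuousLinearEquiv 2 ℝ (Vec p) (Vec q)).symm.continuous).measurable
  exact h.comp (hx.prodMk hy)

theorem memLp_pt {P : Measure Ω} {x : Ω → Vec p} {y : Ω → Vec q}
    (hx : MemLp x 2 P) (hy : MemLp y 2 P) (hxm : Measurable x) (hym : Measurable y) :
    MemLp (fun ω => pt (x ω) (y ω)) 2 P := by
  refine (hx.norm.add hy.norm).of_le (measurable_pt hxm hym).aestronglyMeasurable
    (Filter.Eventually.of_forall fun ω => ?_)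
  have h := norm_pt_le (x ω) (y ω)
  exact h.trans (Real.le_norm_self _)

/-- The conditions on the parameters of a run used in the analysis. -/
structure Trial.Valid (R : Trial p q Ξ Z) : Prop where
  T_pos : 0 < R.a.T
  J_pos : 0 < R.a.J
  S1_pos : 0 < R.a.S1
  S2_pos : 0 < R.a.S2
  M_nonneg : 0 ≤ R.a.M
  v0_le : ‖R.v0‖ ≤ R.a.M

/-- The realization of the samples. -/
def path (smp : Slot → Ω → Ξ × Z) (ω : Ω) (s : Slot) : Ξ × Z := smp s ω

variable {R : Trial p q Ξ Z} {c : Consts} {P : Measure Ω} {smp : Slot → Ω → Ξ × Z} {K : ℕ}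
  {κ : Ω → Fin K}

/-- The σ-algebra of the samples drawn before stage `m` of outer iteration `k`. -/
@[reducible]
def history (R : Trial p q Ξ Z) (smp : Slot → Ω → Ξ × Z) (k m : ℕ) : MeasurableSpace Ω :=
  past smp (Slot.before R.a.T k m)

theorem history_le (hS : IsSampling R.Q P smp K κ) (k m : ℕ) : history R smp k m ≤ mΩ :=
  past_le hS.measurable_smp _

omit mΩ in
theorem history_mono (k : ℕ) {m n : ℕ} (h : m ≤ n) : history R smp k m ≤ history R smp k n :=
  past_mono smp (Slot.before_mono _ k h)

/-- The gradient `∇_y g` may be unbounded but grows at most linearly. The other two directions are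
bounded, since `∇f` is bounded and `v` stays in the ball. -/
theorem Assumptions.memLp_gradY {Q : Problem p q Ξ Z} (hQ : Assumptions Q c) [IsProbabilityMeasure P]
    {z : Ω → Pair p q} (hz : MemLp z 2 P) (hzm : Measurable z) :
    MemLp (fun ω => gradY Q.g (z ω)) 2 P := by
  obtain ⟨A, hA⟩ : ∃ A, A = ‖gradY Q.g 0‖ := ⟨_, rfl⟩
  have h0 : MemLp (fun _ : Ω => A) 2 P := memLp_const A
  have h1 : MemLp (fun ω => A + c.Lg * ‖z ω‖) 2 P := h0.add (hz.norm.const_mul c.Lg)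
  have hm := (measurable_gradY hQ.regular.contDiff_g).comp hzm
  refine h1.of_le hm.aestronglyMeasurable
    (Filter.Eventually.of_forall fun ω => ?_)
  have h := hQ.lipschitz.norm_gradY_g_sub_le hQ.regular.contDiff_g (z ω) 0
  rw [sub_zero] at h
  have h2 := norm_le_norm_add_norm_sub' (gradY Q.g (z ω)) (gradY Q.g 0)
  exact (h2.trans (by linarith)).trans (Real.le_norm_self _)

theorem Assumptions.memLp_fieldX {Q : Problem p q Ξ Z} (hQ : Assumptions Q c)
    [IsProbabilityMeasure P] {u : Ω → Pair p q × Vec q} (hu : Measurable u) {M : ℝ}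
    (hM : ∀ ω, ‖(u ω).2‖ ≤ M) :
    MemLp (fun ω => fieldX Q.f Q.g (u ω).1 (u ω).2) 2 P := by
  have hm := (measurable_fieldX hQ.regular.contDiff_f hQ.regular.contDiff_g).comp hu
  refine (memLp_const (c.Cf + c.Lg * M : ℝ)).of_le hm.aestronglyMeasurable
    (Filter.Eventually.of_forall fun ω => ?_)
  have h1 := hQ.lipschitz.norm_gradX_le hQ.admissible hQ.regular.contDiff_f (u ω).1
  have h2 := hQ.lipschitz.norm_jacXY_le hQ.admissible hQ.regular.contDiff_g (u ω).1 (u ω).2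
  have h3 := mul_le_mul_of_nonneg_left (hM ω) hQ.admissible.Lg_pos.le
  exact ((norm_sub_le _ _).trans (by linarith)).trans (Real.le_norm_self _)

theorem Assumptions.memLp_fieldV {Q : Problem p q Ξ Z} (hQ : Assumptions Q c)
    [IsProbabilityMeasure P] {u : Ω → Pair p q × Vec q} (hu : Measurable u) {M : ℝ}
    (hM : ∀ ω, ‖(u ω).2‖ ≤ M) :
    MemLp (fun ω => fieldV Q.f Q.g (u ω).1 (u ω).2) 2 P := by
  have hm := (measurable_fieldV hQ.regular.contDiff_f hQ.regular.contDiff_g).comp hu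
  refine (memLp_const (c.Lg * M + c.Cf : ℝ)).of_le hm.aestronglyMeasurable
    (Filter.Eventually.of_forall fun ω => ?_)
  have h1 := hQ.lipschitz.norm_gradY_le hQ.admissible hQ.regular.contDiff_f (u ω).1
  have h2 := hQ.lipschitz.norm_hessYY_le hQ.admissible hQ.regular.contDiff_g (u ω).1 (u ω).2
  have h3 := mul_le_mul_of_nonneg_left (hM ω) hQ.admissible.Lg_pos.le
  exact ((norm_sub_le _ _).trans (by linarith)).trans (Real.le_norm_self _)

/-- Measurability and square integrability of a state of the loop on `y`. -/
structure YInv (R : Trial p q Ξ Z) (P : Measure Ω) (smp : Slot → Ω → Ξ × Z) (k t : ℕ) : Prop where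
  mx : Measurable[history R smp k (1 + t)] fun ω => (R.yState (path smp ω) k t).x
  my : Measurable[history R smp k (1 + t)] fun ω => (R.yState (path smp ω) k t).y
  mD : Measurable[history R smp k (1 + t)] fun ω => (R.yState (path smp ω) k t).Dy
  lx : MemLp (fun ω => (R.yState (path smp ω) k t).x) 2 P
  ly : MemLp (fun ω => (R.yState (path smp ω) k t).y) 2 P
  le : MemLp (fun ω => R.errY (path smp ω) k t) 2 P

/-- Measurability and square integrability of a state of the loop on `v`. -/
structure VInv (R : Trial p q Ξ Z) (P : Measure Ω) (smp : Slot → Ω → Ξ × Z) (k j : ℕ) : Prop where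
  mx : Measurable[history R smp k (1 + R.a.T + j)] fun ω => (R.vState (path smp ω) k j).x
  my : Measurable[history R smp k (1 + R.a.T + j)] fun ω => (R.vState (path smp ω) k j).y
  mv : Measurable[history R smp k (1 + R.a.T + j)] fun ω => (R.vState (path smp ω) k j).v
  mDx : Measurable[history R smp k (1 + R.a.T + j)] fun ω => (R.vState (path smp ω) k j).Dx
  mDv : Measurable[history R smp k (1 + R.a.T + j)] fun ω => (R.vState (path smp ω) k j).Dv
  lx : MemLp (fun ω => (R.vState (path smp ω) k j).x) 2 P
  ly : MemLp (fun ω => (R.vState (path smp ω) k j).y) 2 P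
  lex : MemLp (fun ω => R.errX (path smp ω) k j) 2 P
  lev : MemLp (fun ω => R.errV (path smp ω) k j) 2 P

/-- Measurability and square integrability of the state at the start of an outer iteration. -/
structure StartInv (R : Trial p q Ξ Z) (P : Measure Ω) (smp : Slot → Ω → Ξ × Z) (k : ℕ) : Prop where
  mx : Measurable[history R smp k 0] fun ω => (R.start (path smp ω) k).x
  my : Measurable[history R smp k 0] fun ω => (R.start (path smp ω) k).y
  mv : Measurable[history R smp k 0] fun ω => (R.start (path smp ω) k).v
  mDx : Measurable[history R smp k 0] fun ω => (R.start (path smp ω) k).Dx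
  mDy : Measurable[history R smp k 0] fun ω => (R.start (path smp ω) k).Dy
  mDv : Measurable[history R smp k 0] fun ω => (R.start (path smp ω) k).Dv
  lx : MemLp (fun ω => (R.start (path smp ω) k).x) 2 P
  ly : MemLp (fun ω => (R.start (path smp ω) k).y) 2 P
  ley : k % R.a.q1 ≠ 0 → MemLp (fun ω => R.errY (path smp ω) k 0) 2 P
  lex : k % R.a.q1 ≠ 0 → MemLp (fun ω => R.errX (path smp ω) k 0) 2 P
  lev : k % R.a.q1 ≠ 0 → MemLp (fun ω => R.errV (path smp ω) k 0) 2 P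

/-- Measurability and square integrability of the state after the refresh. -/
structure FreshInv (R : Trial p q Ξ Z) (P : Measure Ω) (smp : Slot → Ω → Ξ × Z) (k : ℕ) : Prop where
  mx : Measurable[history R smp k 1] fun ω => (R.fresh (path smp ω) k).x
  my : Measurable[history R smp k 1] fun ω => (R.fresh (path smp ω) k).y
  mv : Measurable[history R smp k 1] fun ω => (R.fresh (path smp ω) k).v
  mDx : Measurable[history R smp k 1] fun ω => (R.fresh (path smp ω) k).Dx
  mDy : Measurable[history R smp k 1] fun ω => (R.fresh (path smp ω) k).Dy
  mDv : Measurable[history R smp k 1] fun ω => (R.fresh (path smp ω) k).Dv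
  lx : MemLp (fun ω => (R.fresh (path smp ω) k).x) 2 P
  ly : MemLp (fun ω => (R.fresh (path smp ω) k).y) 2 P
  ley : MemLp (fun ω => R.errY (path smp ω) k 0) 2 P
  lex : MemLp (fun ω => R.errX (path smp ω) k 0) 2 P
  lev : MemLp (fun ω => R.errV (path smp ω) k 0) 2 P

variable [IsProbabilityMeasure P]

theorem refresh_error (hQ : Assumptions R.Q c) (hV : R.Valid) (hS : IsSampling R.Q P smp K κ)
    {k : ℕ} (hk : k % R.a.q1 = 0) (h : StartInv R P smp k) :
    FreshInv R P smp k ∧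
    ∫ ω, ‖R.errY (path smp ω) k 0‖ ^ 2 ∂P ≤ c.sigSq R.a.M / R.a.S1 ∧
    ∫ ω, ‖R.errX (path smp ω) k 0‖ ^ 2 ∂P ≤ c.sigSq R.a.M / R.a.S1 ∧
    ∫ ω, ‖R.errV (path smp ω) k 0‖ ^ 2 ∂P ≤ c.sigSq R.a.M / R.a.S1 := by
  have ex : ∀ ω, (R.fresh (path smp ω) k).x = (R.start (path smp ω) k).x := fun ω => R.fresh_x _ k
  have ey : ∀ ω, (R.fresh (path smp ω) k).y = (R.start (path smp ω) k).y := fun ω => R.fresh_y _ k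
  have ev : ∀ ω, (R.fresh (path smp ω) k).v = (R.start (path smp ω) k).v := fun ω => R.fresh_v _ k
  have hz := measurable_pt h.mx h.my
  have hu := hz.prodMk h.mv
  have hvM : ∀ ω, ‖(R.start (path smp ω) k).v‖ ≤ R.a.M := fun ω =>
    R.norm_start_v_le _ hV.M_nonneg hV.v0_le hV.J_pos k
  have kY := (unbiasedField_smpY hQ hS).batch_error hS.measurable_smp hS.indep
    (b := fun i => Slot.outerY k i) (fun i j hij => by simpa using hij)
    (fun i => Slot.not_mem_before (T := R.a.T) ⟨rfl, rfl⟩) hz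
    (fun i ω => variance_smpY hQ hS R.a.M i _) hV.S1_pos
  have kX := (unbiasedField_smpX hQ hS).batch_error hS.measurable_smp hS.indep
    (b := fun i => Slot.outerX k i) (fun i j hij => by simpa using hij)
    (fun i => Slot.not_mem_before (T := R.a.T) ⟨rfl, rfl⟩) hu
    (fun i ω => variance_smpX hQ hS i _ (hvM ω)) hV.S1_pos
  have kV := (unbiasedField_smpV hQ hS).batch_error hS.measurable_smp hS.indep
    (b := fun i => Slot.outerV k i) (fun i j hij => by simpa using hij)
    (fun i => Slot.not_mem_before (T := R.a.T) ⟨rfl, rfl⟩) hu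
    (fun i ω => variance_smpV hQ hS i _ (hvM ω)) hV.S1_pos
  have dY : ∀ ω, (R.fresh (path smp ω) k).Dy = (R.a.S1 : ℝ)⁻¹ • ∑ i ∈ Finset.range R.a.S1,
      R.Q.smpY (pt (R.start (path smp ω) k).x (R.start (path smp ω) k).y)
        (smp (Slot.outerY k i) ω) := fun ω => by
    unfold Trial.fresh refresh; rw [if_pos hk]; rfl
  have dX : ∀ ω, (R.fresh (path smp ω) k).Dx = (R.a.S1 : ℝ)⁻¹ • ∑ i ∈ Finset.range R.a.S1,
      R.Q.smpX (pt (R.start (path smp ω) k).x (R.start (path smp ω) k).y,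
        (R.start (path smp ω) k).v) (smp (Slot.outerX k i) ω) := fun ω => by
    unfold Trial.fresh refresh; rw [if_pos hk]; rfl
  have dV : ∀ ω, (R.fresh (path smp ω) k).Dv = (R.a.S1 : ℝ)⁻¹ • ∑ i ∈ Finset.range R.a.S1,
      R.Q.smpV (pt (R.start (path smp ω) k).x (R.start (path smp ω) k).y,
        (R.start (path smp ω) k).v) (smp (Slot.outerV k i) ω) := fun ω => by
    unfold Trial.fresh refresh; rw [if_pos hk]; rfl
  have rY : ∀ ω, R.errY (path smp ω) k 0 = (R.fresh (path smp ω) k).Dy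
      - gradY R.Q.g (pt (R.start (path smp ω) k).x (R.start (path smp ω) k).y) := fun ω => by
    rw [← ex, ← ey]; rfl
  have rX : ∀ ω, R.errX (path smp ω) k 0 = (R.fresh (path smp ω) k).Dx
      - fieldX R.Q.f R.Q.g (pt (R.start (path smp ω) k).x (R.start (path smp ω) k).y)
        (R.start (path smp ω) k).v := fun ω => by
    rw [← ex, ← ey, ← ev]; rfl
  have rV : ∀ ω, R.errV (path smp ω) k 0 = (R.fresh (path smp ω) k).Dv
      - fieldV R.Q.f R.Q.g (pt (R.start (path smp ω) k).x (R.start (path smp ω) k).y)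
        (R.start (path smp ω) k).v := fun ω => by
    rw [← ex, ← ey, ← ev]; rfl
  simp only [rY, rX, rV, dY, dX, dV]
  have hle := history_mono (R := R) (smp := smp) k (Nat.zero_le 1)
  refine ⟨⟨?_, ?_, ?_, ?_, ?_, ?_, ?_, ?_, ?_, ?_, ?_⟩, kY.2.2, kX.2.2, kV.2.2⟩
  · simp only [ex]; exact h.mx.mono hle le_rfl
  · simp only [ey]; exact h.my.mono hle le_rfl
  · simp only [ev]; exact h.mv.mono hle le_rfl
  · simp only [dX]
    exact kX.1.mono (past_mono smp (Slot.union_image_subset_before _ fun i => ⟨rfl, rfl⟩)) le_rfl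
  · simp only [dY]
    exact kY.1.mono (past_mono smp (Slot.union_image_subset_before _ fun i => ⟨rfl, rfl⟩)) le_rfl
  · simp only [dV]
    exact kV.1.mono (past_mono smp (Slot.union_image_subset_before _ fun i => ⟨rfl, rfl⟩)) le_rfl
  · simp only [ex]; exact h.lx
  · simp only [ey]; exact h.ly
  · simp only [rY, dY]; exact kY.2.1
  · simp only [rX, dX]; exact kX.2.1
  · simp only [rV, dV]; exact kV.2.1

theorem freshInv_of_startInv (hQ : Assumptions R.Q c) (hV : R.Valid)
    (hS : IsSampling R.Q P smp K κ) {k : ℕ} (h : StartInv R P smp k) : FreshInv R P smp k := by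
  by_cases hk : k % R.a.q1 = 0
  · exact (refresh_error hQ hV hS hk h).1
  · have e : ∀ ω, R.fresh (path smp ω) k = R.start (path smp ω) k := fun ω =>
      R.fresh_of_ne _ k hk
    have hle := history_mono (R := R) (smp := smp) k (Nat.zero_le 1)
    refine ⟨?_, ?_, ?_, ?_, ?_, ?_, ?_, ?_, h.ley hk, h.lex hk, h.lev hk⟩ <;> simp only [e]
    · exact h.mx.mono hle le_rfl
    · exact h.my.mono hle le_rfl
    · exact h.mv.mono hle le_rfl
    · exact h.mDx.mono hle le_rfl
    · exact h.mDy.mono hle le_rfl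
    · exact h.mDv.mono hle le_rfl
    · exact h.lx
    · exact h.ly

/-- The estimate is its error plus the exact direction, both square integrable. -/
theorem FreshInv.memLp_Dx (hQ : Assumptions R.Q c) (hV : R.Valid) (hS : IsSampling R.Q P smp K κ)
    {k : ℕ} (h : FreshInv R P smp k) : MemLp (fun ω => (R.fresh (path smp ω) k).Dx) 2 P := by
  have hu : Measurable fun ω => (pt (R.fresh (path smp ω) k).x (R.fresh (path smp ω) k).y,
      (R.fresh (path smp ω) k).v) :=
    ((measurable_pt h.mx h.my).prodMk h.mv).mono (history_le hS k 1) le_rfl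
  have h1 := hQ.memLp_fieldX (P := P) hu (M := R.a.M)
    (fun ω => by rw [R.fresh_v]; exact R.norm_start_v_le _ hV.M_nonneg hV.v0_le hV.J_pos k)
  refine (h.lex.add h1).congr_norm (h.mDx.mono (history_le hS k 1) le_rfl).aestronglyMeasurable
    (Filter.Eventually.of_forall fun ω => ?_)
  have e : R.errX (path smp ω) k 0 = (R.fresh (path smp ω) k).Dx
      - fieldX R.Q.f R.Q.g (pt (R.fresh (path smp ω) k).x (R.fresh (path smp ω) k).y)
        (R.fresh (path smp ω) k).v := rfl
  simp only [Pi.add_apply]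
  rw [e, sub_add_cancel]

omit [IsProbabilityMeasure P] in
theorem FreshInv.measurable_nextX {k : ℕ} (h : FreshInv R P smp k) :
    Measurable[history R smp k 1] fun ω => R.nextX (path smp ω) k :=
  h.mx.sub (h.mDx.const_smul R.a.alpha)

theorem FreshInv.memLp_nextX (hQ : Assumptions R.Q c) (hV : R.Valid) (hS : IsSampling R.Q P smp K κ)
    {k : ℕ} (h : FreshInv R P smp k) : MemLp (fun ω => R.nextX (path smp ω) k) 2 P :=
  h.lx.sub ((h.memLp_Dx hQ hV hS).const_smul R.a.alpha)

omit [IsProbabilityMeasure P] in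
theorem FreshInv.yInv_zero {k : ℕ} (h : FreshInv R P smp k) : YInv R P smp k 0 :=
  ⟨h.mx, h.my, h.mDy, h.lx, h.ly, h.ley⟩

theorem YInv.memLp_Dy (hQ : Assumptions R.Q c) (hS : IsSampling R.Q P smp K κ)
    {k t : ℕ} (h : YInv R P smp k t) : MemLp (fun ω => (R.yState (path smp ω) k t).Dy) 2 P := by
  have hx := h.mx.mono (history_le hS k _) le_rfl
  have hy := h.my.mono (history_le hS k _) le_rfl
  have h1 := hQ.memLp_gradY (P := P) (memLp_pt h.lx h.ly hx hy) (measurable_pt hx hy)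
  refine (h.le.add h1).congr_norm (h.mD.mono (history_le hS k _) le_rfl).aestronglyMeasurable
    (Filter.Eventually.of_forall fun ω => ?_)
  simp only [Pi.add_apply]
  unfold Trial.errY
  rw [sub_add_cancel]

/-- The squared displacement in a step of the loop on `y`. -/
noncomputable def moveY (R : Trial p q Ξ Z) (σ : Slot → Ξ × Z) (k t : ℕ) : ℝ :=
  ‖(R.yState σ k (t + 1)).x - (R.yState σ k t).x‖ ^ 2
    + ‖(R.yState σ k (t + 1)).y - (R.yState σ k t).y‖ ^ 2

/-- The squared displacement of `(x, y)` in a step of the loop on `v`. -/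
noncomputable def moveV (R : Trial p q Ξ Z) (σ : Slot → Ξ × Z) (k j : ℕ) : ℝ :=
  ‖(R.vState σ k (j + 1)).x - (R.vState σ k j).x‖ ^ 2
    + ‖(R.vState σ k (j + 1)).y - (R.vState σ k j).y‖ ^ 2

/-- The point reached by step `t` depends on the old estimate alone, so both the old and the new
point are known before batch `t` is drawn. Hence `UnbiasedField.recursive_error` applies, with the
Lipschitz bound for the gradient of each sample function. -/
theorem yInv_succ (hQ : Assumptions R.Q c) (hV : R.Valid) (hS : IsSampling R.Q P smp K κ)
    {k t : ℕ} (hF : FreshInv R P smp k) (h : YInv R P smp k t) :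
    YInv R P smp k (t + 1) ∧
    ∫ ω, ‖R.errY (path smp ω) k (t + 1)‖ ^ 2 ∂P ≤ ∫ ω, ‖R.errY (path smp ω) k t‖ ^ 2 ∂P
      + (R.a.S2 : ℝ)⁻¹ * ∫ ω, c.Lg ^ 2 * moveY R (path smp ω) k t ∂P := by
  have hx' : Measurable[history R smp k (1 + t)] fun ω => (R.yState (path smp ω) k (t + 1)).x :=
    hF.measurable_nextX.mono (history_mono k (by omega)) le_rfl
  have hy' : Measurable[history R smp k (1 + t)] fun ω => (R.yState (path smp ω) k (t + 1)).y :=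
    h.my.sub (h.mD.const_smul (R.a.lam1 * R.a.beta))
  have lx' : MemLp (fun ω => (R.yState (path smp ω) k (t + 1)).x) 2 P := hF.memLp_nextX hQ hV hS
  have ly' : MemLp (fun ω => (R.yState (path smp ω) k (t + 1)).y) 2 P :=
    h.ly.sub ((h.memLp_Dy hQ hS).const_smul (R.a.lam1 * R.a.beta))
  have hli : Integrable (fun ω => c.Lg ^ 2 * moveY R (path smp ω) k t) P :=
    (((lx'.sub h.lx).integrable_norm_pow two_ne_zero).add
      ((ly'.sub h.ly).integrable_norm_pow two_ne_zero)).const_mul _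
  have key := (unbiasedField_smpY hQ hS).recursive_error hS.measurable_smp hS.indep
    (b := fun i => Slot.innerY k t i) (fun i j hij => by simpa using hij)
    (fun i => Slot.not_mem_before (T := R.a.T) ⟨rfl, rfl⟩)
    (measurable_pt h.mx h.my) (measurable_pt hx' hy') h.mD h.le
    (l := fun ω => c.Lg ^ 2 * moveY R (path smp ω) k t)
    (fun ω σ => by
      have h1 := (hQ.lipschitz_sample σ.1 σ.2).norm_gradY_g_sub_le (hQ.regular.contDiff_G σ.2)
        (pt (R.yState (path smp ω) k (t + 1)).x (R.yState (path smp ω) k (t + 1)).y)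
        (pt (R.yState (path smp ω) k t).x (R.yState (path smp ω) k t).y)
      have h2 := pow_le_pow_left₀ (norm_nonneg _) h1 2
      rw [mul_pow, pt_sub, norm_pt_sq] at h2
      exact h2) hli hV.S2_pos
  have hle : history R smp k (1 + t) ≤ history R smp k (1 + (t + 1)) := history_mono k (by omega)
  refine ⟨⟨hx'.mono hle le_rfl, hy'.mono hle le_rfl, ?_, lx', ly', key.2.1⟩, key.2.2⟩
  exact key.1.mono (past_mono smp (Slot.union_image_subset_before _ fun i => ⟨rfl, rfl⟩)) le_rfl

theorem FreshInv.yInv (hQ : Assumptions R.Q c) (hV : R.Valid) (hS : IsSampling R.Q P smp K κ)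
    {k : ℕ} (hF : FreshInv R P smp k) (t : ℕ) : YInv R P smp k t := by
  induction t with
  | zero => exact hF.yInv_zero
  | succ t ih => exact (yInv_succ hQ hV hS hF ih).1

omit [IsProbabilityMeasure P] in
theorem FreshInv.vInv_zero {k : ℕ} (h : FreshInv R P smp k) : VInv R P smp k 0 := by
  have hle : history R smp k 1 ≤ history R smp k (1 + R.a.T + 0) := history_mono k (by omega)
  exact ⟨h.mx.mono hle le_rfl, h.my.mono hle le_rfl, h.mv.mono hle le_rfl, h.mDx.mono hle le_rfl,
    h.mDv.mono hle le_rfl, h.lx, h.ly, h.lex, h.lev⟩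

theorem VInv.memLp_v (hV : R.Valid) (hS : IsSampling R.Q P smp K κ) {k j : ℕ}
    (h : VInv R P smp k j) : MemLp (fun ω => (R.vState (path smp ω) k j).v) 2 P :=
  (memLp_const R.a.M).of_le (h.mv.mono (history_le hS k _) le_rfl).aestronglyMeasurable
    (Filter.Eventually.of_forall fun _ =>
      (R.norm_vState_v_le _ hV.M_nonneg hV.v0_le hV.J_pos k j).trans (Real.le_norm_self _))

theorem VInv.memLp_Dv (hQ : Assumptions R.Q c) (hV : R.Valid) (hS : IsSampling R.Q P smp K κ)
    {k j : ℕ} (h : VInv R P smp k j) : MemLp (fun ω => (R.vState (path smp ω) k j).Dv) 2 P := by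
  have hu : Measurable fun ω => (pt (R.vState (path smp ω) k j).x (R.vState (path smp ω) k j).y,
      (R.vState (path smp ω) k j).v) :=
    ((measurable_pt h.mx h.my).prodMk h.mv).mono (history_le hS k _) le_rfl
  have h1 := hQ.memLp_fieldV (P := P) hu (M := R.a.M)
    (fun _ => R.norm_vState_v_le _ hV.M_nonneg hV.v0_le hV.J_pos k j)
  refine (h.lev.add h1).congr_norm (h.mDv.mono (history_le hS k _) le_rfl).aestronglyMeasurable
    (Filter.Eventually.of_forall fun ω => ?_)
  simp only [Pi.add_apply]
  unfold Trial.errV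
  rw [sub_add_cancel]

/-- As for the loop on `y`: the `x`- and `v`-batches are drawn after the new point is determined,
and continuity of the projection keeps that point measurable. -/
theorem vInv_succ (hQ : Assumptions R.Q c) (hV : R.Valid) (hS : IsSampling R.Q P smp K κ)
    {k j : ℕ} (hF : FreshInv R P smp k) (h : VInv R P smp k j) :
    VInv R P smp k (j + 1) ∧
    ∫ ω, ‖R.errX (path smp ω) k (j + 1)‖ ^ 2 ∂P ≤ ∫ ω, ‖R.errX (path smp ω) k j‖ ^ 2 ∂P
      + (R.a.S2 : ℝ)⁻¹ * ∫ ω, (c.Mbar R.a.M * moveV R (path smp ω) k j + 2 * c.Lg ^ 2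
        * ‖(R.vState (path smp ω) k (j + 1)).v - (R.vState (path smp ω) k j).v‖ ^ 2) ∂P ∧
    ∫ ω, ‖R.errV (path smp ω) k (j + 1)‖ ^ 2 ∂P ≤ ∫ ω, ‖R.errV (path smp ω) k j‖ ^ 2 ∂P
      + (R.a.S2 : ℝ)⁻¹ * ∫ ω, (c.Mbar R.a.M * moveV R (path smp ω) k j + 2 * c.Lg ^ 2
        * ‖(R.vState (path smp ω) k (j + 1)).v - (R.vState (path smp ω) k j).v‖ ^ 2) ∂P := by
  have hY := hF.yInv hQ hV hS R.a.T
  have hx' : Measurable[history R smp k (1 + R.a.T + j)]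
      fun ω => (R.vState (path smp ω) k (j + 1)).x :=
    hF.measurable_nextX.mono (history_mono k (by omega)) le_rfl
  have hy' : Measurable[history R smp k (1 + R.a.T + j)]
      fun ω => (R.vState (path smp ω) k (j + 1)).y :=
    hY.my.mono (history_mono k (by omega)) le_rfl
  have hv' : Measurable[history R smp k (1 + R.a.T + j)]
      fun ω => (R.vState (path smp ω) k (j + 1)).v :=
    (continuous_projBall hV.M_nonneg).measurable.comp
      (h.mv.sub (h.mDv.const_smul (R.a.lam2 * R.a.eta)))
  have lx' : MemLp (fun ω => (R.vState (path smp ω) k (j + 1)).x) 2 P := hF.memLp_nextX hQ hV hS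
  have ly' : MemLp (fun ω => (R.vState (path smp ω) k (j + 1)).y) 2 P := hY.ly
  have hvM : ∀ j ω, ‖(R.vState (path smp ω) k j).v‖ ≤ R.a.M := fun j ω =>
    R.norm_vState_v_le _ hV.M_nonneg hV.v0_le hV.J_pos k j
  have lv' : MemLp (fun ω => (R.vState (path smp ω) k (j + 1)).v) 2 P :=
    (memLp_const R.a.M).of_le (hv'.mono (history_le hS k _) le_rfl).aestronglyMeasurable
      (Filter.Eventually.of_forall fun ω => (hvM _ ω).trans (Real.le_norm_self _))
  have hli : Integrable (fun ω => c.Mbar R.a.M * moveV R (path smp ω) k j + 2 * c.Lg ^ 2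
        * ‖(R.vState (path smp ω) k (j + 1)).v - (R.vState (path smp ω) k j).v‖ ^ 2) P :=
    ((((lx'.sub h.lx).integrable_norm_pow two_ne_zero).add
      ((ly'.sub h.ly).integrable_norm_pow two_ne_zero)).const_mul _).add
      (((lv'.sub (h.memLp_v hV hS)).integrable_norm_pow two_ne_zero).const_mul _)
  have hu := (measurable_pt h.mx h.my).prodMk h.mv
  have hu' := (measurable_pt hx' hy').prodMk hv'
  have kX := (unbiasedField_smpX hQ hS).recursive_error hS.measurable_smp hS.indep
    (b := fun i => Slot.innerX k j i) (fun i j hij => by simpa using hij)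
    (fun i => Slot.not_mem_before (T := R.a.T) ⟨rfl, rfl⟩) hu hu' h.mDx h.lex
    (l := fun ω => c.Mbar R.a.M * moveV R (path smp ω) k j + 2 * c.Lg ^ 2
        * ‖(R.vState (path smp ω) k (j + 1)).v - (R.vState (path smp ω) k j).v‖ ^ 2)
    (fun ω σ => by
      have h1 := (hQ.lipschitz_sample σ.1 σ.2).sq_norm_fieldX_sub_le' hQ.admissible
        (hQ.regular.contDiff_F σ.1) (hQ.regular.contDiff_G σ.2) (hvM (j + 1) ω)
        (R.vState (path smp ω) k j).v
        (pt (R.vState (path smp ω) k (j + 1)).x (R.vState (path smp ω) k (j + 1)).y)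
        (pt (R.vState (path smp ω) k j).x (R.vState (path smp ω) k j).y)
      rw [pt_sub, norm_pt_sq] at h1
      exact h1) hli hV.S2_pos
  have kV := (unbiasedField_smpV hQ hS).recursive_error hS.measurable_smp hS.indep
    (b := fun i => Slot.innerV k j i) (fun i j hij => by simpa using hij)
    (fun i => Slot.not_mem_before (T := R.a.T) ⟨rfl, rfl⟩) hu hu' h.mDv h.lev
    (l := fun ω => c.Mbar R.a.M * moveV R (path smp ω) k j + 2 * c.Lg ^ 2
        * ‖(R.vState (path smp ω) k (j + 1)).v - (R.vState (path smp ω) k j).v‖ ^ 2)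
    (fun ω σ => by
      have h1 := (hQ.lipschitz_sample σ.1 σ.2).sq_norm_fieldV_sub_le' hQ.admissible
        (hQ.regular.contDiff_F σ.1) (hQ.regular.contDiff_G σ.2) (hvM (j + 1) ω)
        (R.vState (path smp ω) k j).v
        (pt (R.vState (path smp ω) k (j + 1)).x (R.vState (path smp ω) k (j + 1)).y)
        (pt (R.vState (path smp ω) k j).x (R.vState (path smp ω) k j).y)
      rw [pt_sub, norm_pt_sq] at h1
      exact h1) hli hV.S2_pos
  have hle : history R smp k (1 + R.a.T + j) ≤ history R smp k (1 + R.a.T + (j + 1)) :=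
    history_mono k (by omega)
  refine ⟨⟨hx'.mono hle le_rfl, hy'.mono hle le_rfl, hv'.mono hle le_rfl, ?_, ?_, lx', ly',
    kX.2.1, kV.2.1⟩, kX.2.2, kV.2.2⟩
  · exact kX.1.mono (past_mono smp (Slot.union_image_subset_before _ fun i => ⟨rfl, rfl⟩)) le_rfl
  · exact kV.1.mono (past_mono smp (Slot.union_image_subset_before _ fun i => ⟨rfl, rfl⟩)) le_rfl

theorem FreshInv.vInv (hQ : Assumptions R.Q c) (hV : R.Valid) (hS : IsSampling R.Q P smp K κ)
    {k : ℕ} (hF : FreshInv R P smp k) (j : ℕ) : VInv R P smp k j := by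
  induction j with
  | zero => exact hF.vInv_zero
  | succ j ih => exact (vInv_succ hQ hV hS hF ih).1

theorem startInv (hQ : Assumptions R.Q c) (hV : R.Valid) (hS : IsSampling R.Q P smp K κ) (k : ℕ) :
    StartInv R P smp k := by
  induction k with
  | zero =>
    -- The starting estimates are arbitrary, so no error bound is claimed for them; iteration `0` is
    -- a restart and discards them.
    have h0 : ¬ (0 % R.a.q1 ≠ 0) := by simp
    exact ⟨measurable_const, measurable_const, measurable_const, measurable_const,
      measurable_const, measurable_const, memLp_const R.x0, memLp_const R.y0,
      fun h => absurd h h0, fun h => absurd h h0, fun h => absurd h h0⟩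
  | succ k ih =>
    have hF := freshInv_of_startInv hQ hV hS ih
    have hY := hF.yInv hQ hV hS R.a.T
    have hU := hF.vInv hQ hV hS R.a.J
    have hle : ∀ m, history R smp k m ≤ history R smp (k + 1) 0 := fun m =>
      past_mono smp (Slot.before_succ _ k m)
    refine ⟨hF.measurable_nextX.mono (hle _) le_rfl, hY.my.mono (hle _) le_rfl,
      hU.mv.mono (hle _) le_rfl, hU.mDx.mono (hle _) le_rfl, hY.mD.mono (hle _) le_rfl,
      hU.mDv.mono (hle _) le_rfl, hF.memLp_nextX hQ hV hS, hY.ly, fun h => ?_, fun h => ?_,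
      fun h => ?_⟩
    · simp only [R.errY_succ_zero _ hV.T_pos k h]; exact hY.le
    · simp only [R.errX_succ_zero _ hV.J_pos k h]; exact hU.lex
    · simp only [R.errV_succ_zero _ hV.J_pos k h]; exact hU.lev

end Random

/-! ### Descent along a realization -/

section Descent

/-- The triangle inequality with Young's inequality of weight `s`, so that a moving target costs
only part of the contraction. -/
theorem sq_norm_sub_le_of_pos {E : Type*} [NormedAddCommGroup E] {s : ℝ} (hs : 0 < s) (b m m' : E) :
    ‖b - m'‖ ^ 2 ≤ (1 + s) * ‖b - m‖ ^ 2 + (1 + 1 / s) * ‖m - m'‖ ^ 2 := by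
  have h1 : ‖b - m'‖ ≤ ‖b - m‖ + ‖m - m'‖ := norm_sub_le_norm_sub_add_norm_sub b m m'
  have h2 := pow_le_pow_left₀ (norm_nonneg _) h1 2
  have h3 : 2 * ‖b - m‖ * ‖m - m'‖ ≤ s * ‖b - m‖ ^ 2 + 1 / s * ‖m - m'‖ ^ 2 := by
    have h4 : 0 ≤ 1 / s * (s * ‖b - m‖ - ‖m - m'‖) ^ 2 := by positivity
    have h5 : 1 / s * (s * ‖b - m‖ - ‖m - m'‖) ^ 2 =
        s * ‖b - m‖ ^ 2 + 1 / s * ‖m - m'‖ ^ 2 - 2 * ‖b - m‖ * ‖m - m'‖ := by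
      field_simp; ring
    linarith
  nlinarith

/-- A contracting iteration whose target moves once, after the first step. -/
theorem tracking_le {E : Type*} [NormedAddCommGroup E] {s C D : ℝ} (hs : 0 < s) (hs1 : s ≤ 1 / 8)
    (hC : 0 ≤ C) {y : ℕ → E} {m₀ m₁ : E} {r e : ℕ → ℝ} (hr : ∀ t, 0 ≤ r t) (he : ∀ t, 0 ≤ e t)
    (h0 : ‖y 1 - m₀‖ ^ 2 ≤ (1 - 2 * s) * ‖y 0 - m₀‖ ^ 2 - r 0 + C * e 0)
    (h1 : ∀ t, ‖y (t + 2) - m₁‖ ^ 2 ≤ (1 - 2 * s) * ‖y (t + 1) - m₁‖ ^ 2 - r (t + 1)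
      + C * e (t + 1))
    (hD : ‖m₀ - m₁‖ ^ 2 ≤ D) (n : ℕ) :
    ‖y (n + 1) - m₁‖ ^ 2 ≤ (1 - s) * ‖y 0 - m₀‖ ^ 2 - ∑ t ∈ Finset.range (n + 1), r t
      + 6 / 5 * C * ∑ t ∈ Finset.range (n + 1), e t + 5 / (4 * s) * D := by
  induction n with
  | zero =>
    -- The first step spends half of the rate `2s` on the moved target: `(1 + s)(1 - 2s) ≤ 1 - s`.
    -- With `s ≤ 1/8` also `1 + s ≤ 6/5` and `1 + 1/s ≤ 5/(4s)`, which explains the constants.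
    have h2 := sq_norm_sub_le_of_pos hs (y 1) m₀ m₁
    have h3 : (1 + 1 / s) * ‖m₀ - m₁‖ ^ 2 ≤ 5 / (4 * s) * D := by
      have h4 : 1 + 1 / s ≤ 5 / (4 * s) := by
        rw [show 5 / (4 * s) = 1 / s + 1 / (4 * s) by field_simp; norm_num]
        have : 1 ≤ 1 / (4 * s) := by rw [le_div_iff₀ (by positivity)]; linarith
        linarith
      have h5 : 0 ≤ 1 + 1 / s := by positivity
      exact (mul_le_mul_of_nonneg_left hD h5).trans
        (mul_le_mul_of_nonneg_right h4 ((sq_nonneg _).trans hD))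
    have h4 : (1 + s) * ‖y 1 - m₀‖ ^ 2 ≤
        (1 + s) * ((1 - 2 * s) * ‖y 0 - m₀‖ ^ 2 - r 0 + C * e 0) :=
      mul_le_mul_of_nonneg_left h0 (by linarith)
    have h5 : 0 ≤ C * e 0 := mul_nonneg hC (he 0)
    have h6 := mul_nonneg hs.le (hr 0)
    have h7 := mul_nonneg (sub_nonneg.2 hs1) h5
    have h8 : 0 ≤ s ^ 2 * ‖y 0 - m₀‖ ^ 2 := by positivity
    simp only [zero_add, Finset.sum_range_one]
    nlinarith
  | succ n ih =>
    have h2 := h1 n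
    rw [Finset.sum_range_succ r (n + 1), Finset.sum_range_succ e (n + 1)]
    -- From the second step on the contraction is given away; only `1 - 2s ≤ 1` is used.
    have h3 : 0 ≤ s * ‖y (n + 1) - m₁‖ ^ 2 := by positivity
    have h4 : 0 ≤ C * e (n + 1) := mul_nonneg hC (he _)
    nlinarith

variable {p q : ℕ} {Ξ Z : Type*} [MeasurableSpace Ξ] [MeasurableSpace Z]

/-- A Lipschitz constant of `∇Φ`. -/
noncomputable def Consts.Lhyp (c : Consts) : ℝ := (1 + c.Cy) ^ 2 * (c.Lf + c.Cf / c.mu * c.Lgg)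

/-- The step size conditions of the descent estimates. -/
structure StepSizes (c : Consts) (a : Params) : Prop where
  beta_pos : 0 < a.beta
  beta_lt : a.beta < 1
  eta_pos : 0 < a.eta
  eta_lt : a.eta < 1
  lam1_pos : 0 < a.lam1
  lam1_le : a.lam1 ≤ 1 / (2 * c.Lg + 2 * c.mu)
  lam2_pos : 0 < a.lam2
  lam2_le : a.lam2 ≤ 1 / (2 * c.Lg + 2 * c.mu)
  alpha_pos : 0 < a.alpha
  alpha_le : a.alpha * c.Lhyp ≤ 1 / 4

variable {R : Trial p q Ξ Z} {c : Consts}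

namespace Trial

variable (R : Trial p q Ξ Z) (σ : Slot → Ξ × Z)

/-- The squared distance of `y_k` to `y*(x_k)`. -/
noncomputable def gapY (k : ℕ) : ℝ := ‖(R.start σ k).y - R.Q.yStar (R.start σ k).x‖ ^ 2

/-- The squared distance of `v_k` to `v*(x_k)`. -/
noncomputable def gapV (k : ℕ) : ℝ := ‖(R.start σ k).v - R.Q.vStar (R.start σ k).x‖ ^ 2

/-- The squared norm of `D^x_k`. -/
noncomputable def sqDx (k : ℕ) : ℝ := ‖(R.fresh σ k).Dx‖ ^ 2

/-- The sum of the squared norms of the estimates in the loop on `y`. -/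
noncomputable def sqDy (k : ℕ) : ℝ := ∑ t ∈ Finset.range R.a.T, ‖(R.yState σ k t).Dy‖ ^ 2

/-- The sum of the squared norms of the estimates in the loop on `v`. -/
noncomputable def sqDv (k : ℕ) : ℝ := ∑ j ∈ Finset.range R.a.J, ‖(R.vState σ k j).Dv‖ ^ 2

end Trial

variable (σ : Slot → Ξ × Z)

theorem small_rate {μ L l β : ℝ} (hμ : 0 < μ) (hL : 0 < L) (hl : 0 < l)
    (hl1 : l ≤ 1 / (2 * L + 2 * μ)) (hβ1 : β < 1) : l * β * μ / 4 ≤ 1 / 8 := by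
  rw [le_div_iff₀ (by positivity)] at hl1
  have h1 : l * μ ≤ 1 / 2 := by nlinarith
  have h2 : l * μ * β ≤ l * μ * 1 := mul_le_mul_of_nonneg_left hβ1.le (by positivity)
  linarith

theorem norm_nextX_sub (k : ℕ) :
    ‖R.nextX σ k - (R.fresh σ k).x‖ ^ 2 = R.a.alpha ^ 2 * R.sqDx σ k := by
  unfold Trial.nextX Trial.sqDx
  rw [sub_sub_cancel_left, norm_neg, norm_smul, mul_pow, Real.norm_eq_abs, sq_abs]

/-- The first `y`-step uses the gradient at `x_k` and approaches `y*(x_k)`; all later ones approach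
`y*(x_{k+1})`. So `tracking_le` applies with rate `s = λ₁βμ/4` and `C = 5λ₁β/μ`, and Lipschitz
continuity of `y*` bounds the motion of the target. -/
theorem gapY_succ_le (hQ : Assumptions R.Q c) (hV : R.Valid) (hA : StepSizes c R.a) (k : ℕ) :
    R.gapY σ (k + 1) ≤ (1 - R.a.lam1 * R.a.beta * c.mu / 4) * R.gapY σ k
      - R.a.beta / 2 * R.a.lam1 ^ 2 * R.sqDy σ k
      + 6 * (R.a.lam1 * R.a.beta) / c.mu * ∑ t ∈ Finset.range R.a.T, ‖R.errY σ k t‖ ^ 2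
      + 5 / (R.a.lam1 * R.a.beta * c.mu) * (c.Cy ^ 2 * (R.a.alpha ^ 2 * R.sqDx σ k)) := by
  have hμ := hQ.admissible.mu_pos
  have hL := hQ.admissible.Lg_pos
  have hl := hA.lam1_pos
  have hβ := hA.beta_pos
  have hstep : ∀ t, ‖(R.yState σ k (t + 1)).y - R.Q.yStar (R.yState σ k t).x‖ ^ 2 ≤
      (1 - 2 * (R.a.lam1 * R.a.beta * c.mu / 4))
        * ‖(R.yState σ k t).y - R.Q.yStar (R.yState σ k t).x‖ ^ 2
      - R.a.beta / 2 * R.a.lam1 ^ 2 * ‖(R.yState σ k t).Dy‖ ^ 2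
      + 5 * (R.a.lam1 * R.a.beta) / c.mu * ‖R.errY σ k t‖ ^ 2 := by
    intro t
    have h1 := hQ.inner_gradY_ge (fun y' => hQ.yStar_le (R.yState σ k t).x y') (R.yState σ k t).y
    have h2 := gradient_step_le (e := R.errY σ k t) hμ hL h1 hl hA.lam1_le hβ hA.beta_lt
    have e1 : gradY R.Q.g (pt (R.yState σ k t).x (R.yState σ k t).y) + R.errY σ k t
        = (R.yState σ k t).Dy := add_sub_cancel _ _
    rw [e1] at h2
    have e2 : (R.yState σ k (t + 1)).y - R.Q.yStar (R.yState σ k t).x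
        = (R.yState σ k t).y - R.Q.yStar (R.yState σ k t).x
          - (R.a.lam1 * R.a.beta) • (R.yState σ k t).Dy := by
      rw [R.yState_succ_y]; abel
    rw [e2]
    linarith
  have hD : ‖R.Q.yStar (R.fresh σ k).x - R.Q.yStar (R.nextX σ k)‖ ^ 2
      ≤ c.Cy ^ 2 * (R.a.alpha ^ 2 * R.sqDx σ k) := by
    have h := pow_le_pow_left₀ (norm_nonneg _)
      (hQ.norm_yStar_sub_le (R.fresh σ k).x (R.nextX σ k)) 2
    rwa [mul_pow, norm_sub_rev _ (R.nextX σ k), norm_nextX_sub] at h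
  obtain ⟨n, hn⟩ := Nat.exists_eq_succ_of_ne_zero hV.T_pos.ne'
  have h0 := hstep 0
  have ex0 : (R.yState σ k 0).x = (R.fresh σ k).x := rfl
  rw [ex0] at h0
  have h1 := fun t => hstep (t + 1)
  simp only [R.yState_succ_x] at h1
  have key := tracking_le (m₀ := R.Q.yStar (R.fresh σ k).x)
    (m₁ := R.Q.yStar (R.nextX σ k)) (s := R.a.lam1 * R.a.beta * c.mu / 4)
    (C := 5 * (R.a.lam1 * R.a.beta) / c.mu) (y := fun t => (R.yState σ k t).y)
    (r := fun t => R.a.beta / 2 * R.a.lam1 ^ 2 * ‖(R.yState σ k t).Dy‖ ^ 2)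
    (e := fun t => ‖R.errY σ k t‖ ^ 2) (by positivity)
    (small_rate hμ hL hl hA.lam1_le hA.beta_lt) (by positivity) (fun t => by positivity)
    (fun t => by positivity) h0 h1 hD n
  rw [← Finset.mul_sum, ← Nat.succ_eq_add_one, ← hn] at key
  have e3 : R.gapY σ (k + 1) = ‖(R.yState σ k R.a.T).y - R.Q.yStar (R.nextX σ k)‖ ^ 2 := rfl
  have e4 : R.gapY σ k = ‖(R.yState σ k 0).y - R.Q.yStar (R.fresh σ k).x‖ ^ 2 := by
    unfold Trial.gapY
    rw [← R.fresh_x, ← R.fresh_y]; rfl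
  rw [e3, e4]
  refine key.trans (le_of_eq ?_)
  have e5 : 5 / (4 * (R.a.lam1 * R.a.beta * c.mu / 4)) = 5 / (R.a.lam1 * R.a.beta * c.mu) := by
    rw [mul_div_cancel₀ _ four_ne_zero]
  rw [e5]
  unfold Trial.sqDy
  ring

/-- Each `v`-step is a gradient step for the quadratic at `(x, y*(x))`, so its error is the sampling
error plus the bias from evaluating at `y` instead of `y*(x)`. This bias couples the `v`-gap to the
`y`-gap. The projection is harmless because `v*` lies in `Ω`. -/
theorem gapV_succ_le (hQ : Assumptions R.Q c) (hV : R.Valid) (hA : StepSizes c R.a)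
    (hM : c.Cf / c.mu ≤ R.a.M) (k : ℕ) :
    R.gapV σ (k + 1) ≤ (1 - R.a.lam2 * R.a.eta * c.mu / 4) * R.gapV σ k
      - R.a.eta / 2 * R.a.lam2 ^ 2 * R.sqDv σ k
      + 6 * (R.a.lam2 * R.a.eta) / c.mu * (2 * ∑ j ∈ Finset.range R.a.J, ‖R.errV σ k j‖ ^ 2
        + R.a.J * (c.Mbar R.a.M * (R.gapY σ k + R.gapY σ (k + 1))))
      + 5 / (R.a.lam2 * R.a.eta * c.mu) * (c.Cv ^ 2 * (R.a.alpha ^ 2 * R.sqDx σ k)) := by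
  have hμ := hQ.admissible.mu_pos
  have hL := hQ.admissible.Lg_pos
  have hl := hA.lam2_pos
  have hη := hA.eta_pos
  have hMb : 0 ≤ c.Mbar R.a.M := by unfold Consts.Mbar; positivity
  have hg0 : ∀ k, 0 ≤ R.gapY σ k := fun k => sq_nonneg _
  -- The loop on `v` starts at `(x_k, y_k)` and then stays at `(x_{k+1}, y_{k+1})`; the sum of the
  -- two gaps serves for all `j` at once.
  have hgap : ∀ j, ‖(R.vState σ k j).y - R.Q.yStar (R.vState σ k j).x‖ ^ 2
      ≤ R.gapY σ k + R.gapY σ (k + 1) := by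
    intro j
    cases j with
    | zero =>
      have e4 : R.gapY σ k = ‖(R.vState σ k 0).y - R.Q.yStar (R.vState σ k 0).x‖ ^ 2 := by
        unfold Trial.gapY
        rw [← R.fresh_x, ← R.fresh_y]; rfl
      rw [← e4]
      linarith [hg0 (k + 1)]
    | succ j =>
      have e3 : R.gapY σ (k + 1) =
        ‖(R.vState σ k (j + 1)).y - R.Q.yStar (R.vState σ k (j + 1)).x‖ ^ 2 := rfl
      rw [← e3]
      linarith [hg0 k]
  have hstep : ∀ j, ‖(R.vState σ k (j + 1)).v - R.Q.vStar (R.vState σ k j).x‖ ^ 2 ≤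
      (1 - 2 * (R.a.lam2 * R.a.eta * c.mu / 4))
        * ‖(R.vState σ k j).v - R.Q.vStar (R.vState σ k j).x‖ ^ 2
      - R.a.eta / 2 * R.a.lam2 ^ 2 * ‖(R.vState σ k j).Dv‖ ^ 2
      + 5 * (R.a.lam2 * R.a.eta) / c.mu
        * (2 * ‖R.errV σ k j‖ ^ 2 + c.Mbar R.a.M * (R.gapY σ k + R.gapY σ (k + 1))) := by
    intro j
    set S := R.vState σ k j with hS
    have hvM : ‖S.v‖ ≤ R.a.M := R.norm_vState_v_le σ hV.M_nonneg hV.v0_le hV.J_pos k j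
    set E := S.Dv - fieldV R.Q.f R.Q.g (pt S.x (R.Q.yStar S.x)) S.v with hE
    have h1 := hQ.inner_hessYY_ge' (pt S.x (R.Q.yStar S.x)) (S.v - R.Q.vStar S.x)
    rw [← hQ.fieldV_ptStar] at h1
    have h2 := gradient_step_le (e := E) hμ hL h1 hl hA.lam2_le hη hA.eta_lt
    have e1 : fieldV R.Q.f R.Q.g (pt S.x (R.Q.yStar S.x)) S.v + E = S.Dv := add_sub_cancel _ _
    rw [e1] at h2
    have h3 : ‖E‖ ^ 2 ≤ 2 * ‖R.errV σ k j‖ ^ 2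
        + c.Mbar R.a.M * (R.gapY σ k + R.gapY σ (k + 1)) := by
      have e2 : E = R.errV σ k j + (fieldV R.Q.f R.Q.g (pt S.x S.y) S.v
          - fieldV R.Q.f R.Q.g (pt S.x (R.Q.yStar S.x)) S.v) := (sub_add_sub_cancel _ _ _).symm
      have h4 := hQ.lipschitz.sq_norm_fieldV_sub_le hQ.admissible hQ.regular.contDiff_f hvM
        (pt S.x S.y) (pt S.x (R.Q.yStar S.x))
      rw [norm_pt_sub_right] at h4
      have h5 := mul_le_mul_of_nonneg_left (hgap j) hMb
      have h6 := sq_norm_add_le_two (R.errV σ k j) (fieldV R.Q.f R.Q.g (pt S.x S.y) S.v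
          - fieldV R.Q.f R.Q.g (pt S.x (R.Q.yStar S.x)) S.v)
      rw [← e2] at h6
      linarith
    have h7 : ‖(R.vState σ k (j + 1)).v - R.Q.vStar S.x‖
        ≤ ‖S.v - R.Q.vStar S.x - (R.a.lam2 * R.a.eta) • S.Dv‖ := by
      rw [R.vState_succ_v, sub_right_comm]
      exact norm_projBall_sub_le hV.M_nonneg _ ((hQ.norm_vStar_le _).trans hM)
    have h8 := pow_le_pow_left₀ (norm_nonneg _) h7 2
    have h9 : 5 * (R.a.lam2 * R.a.eta) / c.mu * ‖E‖ ^ 2 ≤ 5 * (R.a.lam2 * R.a.eta) / c.mu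
        * (2 * ‖R.errV σ k j‖ ^ 2 + c.Mbar R.a.M * (R.gapY σ k + R.gapY σ (k + 1))) :=
      mul_le_mul_of_nonneg_left h3 (by positivity)
    linarith
  have hD : ‖R.Q.vStar (R.fresh σ k).x - R.Q.vStar (R.nextX σ k)‖ ^ 2
      ≤ c.Cv ^ 2 * (R.a.alpha ^ 2 * R.sqDx σ k) := by
    have h := pow_le_pow_left₀ (norm_nonneg _)
      (hQ.norm_vStar_sub_le (R.fresh σ k).x (R.nextX σ k)) 2
    rwa [mul_pow, norm_sub_rev _ (R.nextX σ k), norm_nextX_sub] at h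
  obtain ⟨n, hn⟩ := Nat.exists_eq_succ_of_ne_zero hV.J_pos.ne'
  have h0 := hstep 0
  have ex0 : (R.vState σ k 0).x = (R.fresh σ k).x := rfl
  rw [ex0] at h0
  have h1 := fun j => hstep (j + 1)
  simp only [R.vState_succ_x] at h1
  have key := tracking_le (m₀ := R.Q.vStar (R.fresh σ k).x)
    (m₁ := R.Q.vStar (R.nextX σ k)) (s := R.a.lam2 * R.a.eta * c.mu / 4)
    (C := 5 * (R.a.lam2 * R.a.eta) / c.mu) (y := fun j => (R.vState σ k j).v)
    (r := fun j => R.a.eta / 2 * R.a.lam2 ^ 2 * ‖(R.vState σ k j).Dv‖ ^ 2)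
    (e := fun j => 2 * ‖R.errV σ k j‖ ^ 2 + c.Mbar R.a.M * (R.gapY σ k + R.gapY σ (k + 1)))
    (by positivity) (small_rate hμ hL hl hA.lam2_le hA.eta_lt) (by positivity)
    (fun t => by positivity)
    (fun t => add_nonneg (by positivity) (mul_nonneg hMb (add_nonneg (hg0 _) (hg0 _))))
    h0 h1 hD n
  rw [← Finset.mul_sum, ← Nat.succ_eq_add_one, ← hn, Finset.sum_add_distrib, ← Finset.mul_sum,
    Finset.sum_const, Finset.card_range, nsmul_eq_mul] at key
  have e3 : R.gapV σ (k + 1) = ‖(R.vState σ k R.a.J).v - R.Q.vStar (R.nextX σ k)‖ ^ 2 := rfl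
  have e4 : R.gapV σ k = ‖(R.vState σ k 0).v - R.Q.vStar (R.fresh σ k).x‖ ^ 2 := by
    unfold Trial.gapV
    rw [← R.fresh_x, ← R.fresh_v]; rfl
  rw [e3, e4]
  refine key.trans (le_of_eq ?_)
  have e5 : 5 / (4 * (R.a.lam2 * R.a.eta * c.mu / 4)) = 5 / (R.a.lam2 * R.a.eta * c.mu) := by
    rw [mul_div_cancel₀ _ four_ne_zero]
  rw [e5]
  unfold Trial.sqDv
  ring

/-- In the descent lemma, write `-2⟨∇Φ, D⟩` as `‖D - ∇Φ‖² - ‖D‖² - ‖∇Φ‖²`. The quadratic term takes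
`1/8` from the coefficient `1/2` of `α‖D‖²`, leaving `3/8`. The distance from `D` to `∇Φ` splits
into the sampling error and the bias caused by the `y`- and `v`-gaps. -/
theorem Phi_succ_le (hQ : Assumptions R.Q c) (hV : R.Valid) (hA : StepSizes c R.a) (k : ℕ) :
    R.Q.Phi (R.start σ (k + 1)).x ≤ R.Q.Phi (R.start σ k).x
      - R.a.alpha / 2 * ‖R.Q.gradPhi (R.start σ k).x‖ ^ 2 - 3 / 8 * R.a.alpha * R.sqDx σ k
      + R.a.alpha * ‖R.errX σ k 0‖ ^ 2
      + R.a.alpha * (c.Mbar R.a.M * R.gapY σ k + 2 * c.Lg ^ 2 * R.gapV σ k) := by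
  have hα := hA.alpha_pos
  set F := R.fresh σ k with hF
  have hx : (R.start σ k).x = F.x := (R.fresh_x σ k).symm
  have hvM : ‖F.v‖ ≤ R.a.M := by
    rw [hF, R.fresh_v]; exact R.norm_start_v_le σ hV.M_nonneg hV.v0_le hV.J_pos k
  have h1 := le_add_inner_gradient_add_sq (L := c.Lhyp) hQ.differentiable_Phi
    (fun z w => by
      rw [hQ.gradient_Phi, hQ.gradient_Phi]; exact hQ.norm_gradPhi_sub_le z w) F.x (R.nextX σ k)
  rw [hQ.gradient_Phi, norm_nextX_sub] at h1
  have e1 : R.nextX σ k - F.x = -(R.a.alpha • F.Dx) := sub_sub_cancel_left _ _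
  rw [e1, inner_neg_right, inner_smul_right] at h1
  have e2 : ‖F.Dx - R.Q.gradPhi F.x‖ ^ 2 = R.sqDx σ k - 2 * inner ℝ (R.Q.gradPhi F.x) F.Dx
      + ‖R.Q.gradPhi F.x‖ ^ 2 := by
    rw [norm_sub_sq_real, real_inner_comm]; rfl
  have h2 : ‖F.Dx - R.Q.gradPhi F.x‖ ^ 2 ≤ 2 * ‖R.errX σ k 0‖ ^ 2
      + 2 * (c.Mbar R.a.M * R.gapY σ k + 2 * c.Lg ^ 2 * R.gapV σ k) := by
    have e3 : F.Dx - R.Q.gradPhi F.x = R.errX σ k 0 + (fieldX R.Q.f R.Q.g (pt F.x F.y) F.v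
        - fieldX R.Q.f R.Q.g (pt F.x (R.Q.yStar F.x)) (R.Q.vStar F.x)) :=
      (sub_add_sub_cancel _ _ _).symm
    have h3 := hQ.lipschitz.sq_norm_fieldX_sub_le' hQ.admissible hQ.regular.contDiff_f
      hQ.regular.contDiff_g hvM (R.Q.vStar F.x) (pt F.x F.y) (pt F.x (R.Q.yStar F.x))
    rw [norm_pt_sub_right] at h3
    have h4 := sq_norm_add_le_two (R.errX σ k 0) (fieldX R.Q.f R.Q.g (pt F.x F.y) F.v
        - fieldX R.Q.f R.Q.g (pt F.x (R.Q.yStar F.x)) (R.Q.vStar F.x))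
    rw [← e3] at h4
    have e5 : R.gapY σ k = ‖F.y - R.Q.yStar F.x‖ ^ 2 := by
      rw [hF, R.fresh_x, R.fresh_y]; rfl
    have e6 : R.gapV σ k = ‖F.v - R.Q.vStar F.x‖ ^ 2 := by
      rw [hF, R.fresh_x, R.fresh_v]; rfl
    rw [e5, e6]
    linarith
  have h5 : c.Lhyp / 2 * (R.a.alpha ^ 2 * R.sqDx σ k) ≤ 1 / 8 * R.a.alpha * R.sqDx σ k := by
    have h6 : 0 ≤ R.a.alpha * R.sqDx σ k := mul_nonneg hα.le (sq_nonneg _)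
    nlinarith [mul_le_mul_of_nonneg_right hA.alpha_le h6]
  have e7 : R.Q.Phi (R.start σ (k + 1)).x = R.Q.Phi (R.nextX σ k) := rfl
  rw [e7, hx]
  have h8 := mul_le_mul_of_nonneg_left h2 (half_pos hα).le
  rw [e2] at h8
  linarith

end Descent

/-! ### Expected errors and expected descent -/

section Expected

variable {p q : ℕ} {Ξ Z Ω : Type*} [MeasurableSpace Ξ] [MeasurableSpace Z] [mΩ : MeasurableSpace Ω]
  {R : Trial p q Ξ Z} {c : Consts}

theorem sqDx_nonneg (σ : Slot → Ξ × Z) (k : ℕ) : 0 ≤ R.sqDx σ k := sq_nonneg _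

theorem sqDy_nonneg (σ : Slot → Ξ × Z) (k : ℕ) : 0 ≤ R.sqDy σ k :=
  Finset.sum_nonneg fun _ _ => sq_nonneg _

theorem sqDv_nonneg (σ : Slot → Ξ × Z) (k : ℕ) : 0 ≤ R.sqDv σ k :=
  Finset.sum_nonneg fun _ _ => sq_nonneg _

theorem sq_norm_yState_y_sub (σ : Slot → Ξ × Z) (k t : ℕ) :
    ‖(R.yState σ k (t + 1)).y - (R.yState σ k t).y‖ ^ 2
      = (R.a.lam1 * R.a.beta) ^ 2 * ‖(R.yState σ k t).Dy‖ ^ 2 := by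
  rw [R.yState_succ_y, sub_sub_cancel_left, norm_neg, norm_smul, mul_pow, Real.norm_eq_abs, sq_abs]

theorem moveY_zero (σ : Slot → Ξ × Z) (k : ℕ) : moveY R σ k 0 =
    R.a.alpha ^ 2 * R.sqDx σ k + (R.a.lam1 * R.a.beta) ^ 2 * ‖(R.yState σ k 0).Dy‖ ^ 2 := by
  unfold moveY
  rw [sq_norm_yState_y_sub, ← norm_nextX_sub]; rfl

theorem moveY_succ (σ : Slot → Ξ × Z) (k t : ℕ) : moveY R σ k (t + 1) =
    (R.a.lam1 * R.a.beta) ^ 2 * ‖(R.yState σ k (t + 1)).Dy‖ ^ 2 := by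
  unfold moveY
  rw [sq_norm_yState_y_sub, R.yState_succ_x, R.yState_succ_x, sub_self, norm_zero]
  ring

theorem yState_y_sub (σ : Slot → Ξ × Z) (k t : ℕ) : (R.yState σ k t).y - (R.yState σ k 0).y =
    -((R.a.lam1 * R.a.beta) • ∑ i ∈ Finset.range t, (R.yState σ k i).Dy) := by
  induction t with
  | zero => simp
  | succ t ih =>
    rw [R.yState_succ_y, sub_right_comm, ih, Finset.sum_range_succ, smul_add, neg_add]
    abel

theorem sq_norm_nextY_sub_le (σ : Slot → Ξ × Z) (k : ℕ) :
    ‖R.nextY σ k - (R.fresh σ k).y‖ ^ 2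
      ≤ R.a.T * (R.a.lam1 * R.a.beta) ^ 2 * R.sqDy σ k := by
  have h1 : R.nextY σ k - (R.fresh σ k).y =
    -((R.a.lam1 * R.a.beta) • ∑ i ∈ Finset.range R.a.T, (R.yState σ k i).Dy) :=
    yState_y_sub σ k R.a.T
  rw [h1, norm_neg, norm_smul, mul_pow, Real.norm_eq_abs, sq_abs]
  have h2 : ‖∑ i ∈ Finset.range R.a.T, (R.yState σ k i).Dy‖ ^ 2 ≤ R.a.T * R.sqDy σ k := by
    have h3 := pow_le_pow_left₀ (norm_nonneg _)
      (norm_sum_le (Finset.range R.a.T) fun i => (R.yState σ k i).Dy) 2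
    have h4 := sq_sum_le_card_mul_sum_sq (s := Finset.range R.a.T)
      (f := fun i => ‖(R.yState σ k i).Dy‖)
    rw [Finset.card_range] at h4
    exact h3.trans h4
  have h5 := mul_le_mul_of_nonneg_left h2 (sq_nonneg (R.a.lam1 * R.a.beta))
  linarith

/-- The first `v`-step passes from `(x_k, y_k)` to `(x_{k+1}, y_{k+1})` at once, so it sees all `T`
moves of `y` together; the factor `T` is Cauchy-Schwarz. -/
theorem moveV_zero_le (σ : Slot → Ξ × Z) (k : ℕ) : moveV R σ k 0 ≤
    R.a.alpha ^ 2 * R.sqDx σ k + R.a.T * (R.a.lam1 * R.a.beta) ^ 2 * R.sqDy σ k := by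
  have h1 := sq_norm_nextY_sub_le (R := R) σ k
  have h2 : moveV R σ k 0 = ‖R.nextX σ k - (R.fresh σ k).x‖ ^ 2
    + ‖R.nextY σ k - (R.fresh σ k).y‖ ^ 2 := rfl
  rw [h2, norm_nextX_sub]
  linarith

theorem moveV_succ (σ : Slot → Ξ × Z) (k j : ℕ) : moveV R σ k (j + 1) = 0 := by
  unfold moveV
  rw [R.vState_succ_x, R.vState_succ_x, R.vState_succ_y, R.vState_succ_y, sub_self, sub_self]
  simp

theorem sq_norm_vState_v_sub_le (hV : R.Valid) (σ : Slot → Ξ × Z) (k j : ℕ) :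
    ‖(R.vState σ k (j + 1)).v - (R.vState σ k j).v‖ ^ 2
      ≤ (R.a.lam2 * R.a.eta) ^ 2 * ‖(R.vState σ k j).Dv‖ ^ 2 := by
  have h := norm_projBall_sub_le hV.M_nonneg
    ((R.vState σ k j).v - (R.a.lam2 * R.a.eta) • (R.vState σ k j).Dv)
    (R.norm_vState_v_le σ hV.M_nonneg hV.v0_le hV.J_pos k j)
  rw [sub_sub_cancel_left, norm_neg, norm_smul, ← R.vState_succ_v] at h
  have h2 := pow_le_pow_left₀ (norm_nonneg _) h 2
  rwa [mul_pow, Real.norm_eq_abs, sq_abs] at h2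

variable {P : Measure Ω} {smp : Slot → Ω → Ξ × Z} {K : ℕ} {κ : Ω → Fin K}
  [IsProbabilityMeasure P]

section

variable (hQ : Assumptions R.Q c) (hV : R.Valid) (hS : IsSampling R.Q P smp K κ) (k : ℕ)

include hQ hV hS

theorem freshInv : FreshInv R P smp k := freshInv_of_startInv hQ hV hS (startInv hQ hV hS k)

theorem yInv (t : ℕ) : YInv R P smp k t := (freshInv hQ hV hS k).yInv hQ hV hS t

theorem vInv (j : ℕ) : VInv R P smp k j := (freshInv hQ hV hS k).vInv hQ hV hS j

theorem integrable_sqDx : Integrable (fun ω => R.sqDx (path smp ω) k) P :=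
  ((freshInv hQ hV hS k).memLp_Dx hQ hV hS).integrable_norm_pow two_ne_zero

theorem integrable_sq_Dy (t : ℕ) : Integrable (fun ω => ‖(R.yState (path smp ω) k t).Dy‖ ^ 2) P :=
  ((yInv hQ hV hS k t).memLp_Dy hQ hS).integrable_norm_pow two_ne_zero

theorem integrable_sq_Dv (j : ℕ) : Integrable (fun ω => ‖(R.vState (path smp ω) k j).Dv‖ ^ 2) P :=
  ((vInv hQ hV hS k j).memLp_Dv hQ hV hS).integrable_norm_pow two_ne_zero

theorem integrable_sqDy : Integrable (fun ω => R.sqDy (path smp ω) k) P :=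
  integrable_finsetSum _ fun t _ => integrable_sq_Dy hQ hV hS k t

theorem integrable_sqDv : Integrable (fun ω => R.sqDv (path smp ω) k) P :=
  integrable_finsetSum _ fun j _ => integrable_sq_Dv hQ hV hS k j

theorem integrable_sq_errY (t : ℕ) : Integrable (fun ω => ‖R.errY (path smp ω) k t‖ ^ 2) P :=
  (yInv hQ hV hS k t).le.integrable_norm_pow two_ne_zero

theorem integrable_sq_errX (j : ℕ) : Integrable (fun ω => ‖R.errX (path smp ω) k j‖ ^ 2) P :=
  (vInv hQ hV hS k j).lex.integrable_norm_pow two_ne_zero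

theorem integrable_sq_errV (j : ℕ) : Integrable (fun ω => ‖R.errV (path smp ω) k j‖ ^ 2) P :=
  (vInv hQ hV hS k j).lev.integrable_norm_pow two_ne_zero

theorem integral_sqDy : ∫ ω, R.sqDy (path smp ω) k ∂P
    = ∑ t ∈ Finset.range R.a.T, ∫ ω, ‖(R.yState (path smp ω) k t).Dy‖ ^ 2 ∂P :=
  integral_finsetSum _ fun t _ => integrable_sq_Dy hQ hV hS k t

theorem integral_sqDv : ∫ ω, R.sqDv (path smp ω) k ∂P
    = ∑ j ∈ Finset.range R.a.J, ∫ ω, ‖(R.vState (path smp ω) k j).Dv‖ ^ 2 ∂P :=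
  integral_finsetSum _ fun j _ => integrable_sq_Dv hQ hV hS k j

end

/-- The growth of the error of `D^y` within an outer iteration. -/
noncomputable def growthY (R : Trial p q Ξ Z) (c : Consts) (P : Measure Ω)
    (smp : Slot → Ω → Ξ × Z) (k : ℕ) : ℝ :=
  c.Lg ^ 2 * (R.a.alpha ^ 2 * ∫ ω, R.sqDx (path smp ω) k ∂P
    + (R.a.lam1 * R.a.beta) ^ 2 * ∫ ω, R.sqDy (path smp ω) k ∂P)

/-- The growth of the errors of `D^x` and `D^v` within an outer iteration. -/
noncomputable def growthV (R : Trial p q Ξ Z) (c : Consts) (P : Measure Ω)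
    (smp : Slot → Ω → Ξ × Z) (k : ℕ) : ℝ :=
  c.Mbar R.a.M * (R.a.alpha ^ 2 * ∫ ω, R.sqDx (path smp ω) k ∂P
    + R.a.T * (R.a.lam1 * R.a.beta) ^ 2 * ∫ ω, R.sqDy (path smp ω) k ∂P)
    + 2 * c.Lg ^ 2 * ((R.a.lam2 * R.a.eta) ^ 2 * ∫ ω, R.sqDv (path smp ω) k ∂P)

theorem Consts.Mbar_nonneg (c : Consts) (M : ℝ) : 0 ≤ c.Mbar M := by
  unfold Consts.Mbar; positivity

omit [IsProbabilityMeasure P] in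
theorem growthY_nonneg (k : ℕ) : 0 ≤ growthY R c P smp k := by
  have h1 : 0 ≤ ∫ ω, R.sqDx (path smp ω) k ∂P := integral_nonneg fun ω => sqDx_nonneg _ k
  have h2 : 0 ≤ ∫ ω, R.sqDy (path smp ω) k ∂P := integral_nonneg fun ω => sqDy_nonneg _ k
  unfold growthY
  positivity

omit [IsProbabilityMeasure P] in
theorem growthV_nonneg (k : ℕ) : 0 ≤ growthV R c P smp k := by
  have h1 : 0 ≤ ∫ ω, R.sqDx (path smp ω) k ∂P := integral_nonneg fun ω => sqDx_nonneg _ k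
  have h2 : 0 ≤ ∫ ω, R.sqDy (path smp ω) k ∂P := integral_nonneg fun ω => sqDy_nonneg _ k
  have h3 : 0 ≤ ∫ ω, R.sqDv (path smp ω) k ∂P := integral_nonneg fun ω => sqDv_nonneg _ k
  have h4 := c.Mbar_nonneg R.a.M
  unfold growthV
  positivity

section

variable (hQ : Assumptions R.Q c) (hV : R.Valid) (hS : IsSampling R.Q P smp K κ) (k : ℕ)

include hQ hV hS

/-- The upper-level point moves only in the first inner step, so `‖D^x‖²` enters once, while every
step contributes its own `‖D^y‖²`. -/
theorem integral_errY_le_sum (n : ℕ) : ∫ ω, ‖R.errY (path smp ω) k n‖ ^ 2 ∂P ≤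
    ∫ ω, ‖R.errY (path smp ω) k 0‖ ^ 2 ∂P + (R.a.S2 : ℝ)⁻¹ * (c.Lg ^ 2 *
      (R.a.alpha ^ 2 * ∫ ω, R.sqDx (path smp ω) k ∂P + (R.a.lam1 * R.a.beta) ^ 2
        * ∑ t ∈ Finset.range n, ∫ ω, ‖(R.yState (path smp ω) k t).Dy‖ ^ 2 ∂P)) := by
  have hX : 0 ≤ ∫ ω, R.sqDx (path smp ω) k ∂P := integral_nonneg fun ω => sqDx_nonneg _ k
  induction n with
  | zero =>
    have : 0 ≤ (R.a.S2 : ℝ)⁻¹ * (c.Lg ^ 2 *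
      (R.a.alpha ^ 2 * ∫ ω, R.sqDx (path smp ω) k ∂P)) := by positivity
    simpa using this
  | succ n ih =>
    have h1 := (yInv_succ hQ hV hS (freshInv hQ hV hS k) (yInv hQ hV hS k n)).2
    rw [integral_const_mul] at h1
    rw [Finset.sum_range_succ]
    cases n with
    | zero =>
      simp only [moveY_zero] at h1
      rw [integral_add ((integrable_sqDx hQ hV hS k).const_mul _)
        ((integrable_sq_Dy hQ hV hS k 0).const_mul _), integral_const_mul, integral_const_mul] at h1
      simpa using h1
    | succ n =>
      simp only [moveY_succ] at h1
      rw [integral_const_mul] at h1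
      linarith

theorem integral_errY_le {n : ℕ} (hn : n ≤ R.a.T) : ∫ ω, ‖R.errY (path smp ω) k n‖ ^ 2 ∂P ≤
    ∫ ω, ‖R.errY (path smp ω) k 0‖ ^ 2 ∂P + (R.a.S2 : ℝ)⁻¹ * growthY R c P smp k := by
  refine (integral_errY_le_sum hQ hV hS k n).trans ?_
  unfold growthY
  rw [integral_sqDy hQ hV hS]
  have : ∑ t ∈ Finset.range n, ∫ ω, ‖(R.yState (path smp ω) k t).Dy‖ ^ 2 ∂P
      ≤ ∑ t ∈ Finset.range R.a.T, ∫ ω, ‖(R.yState (path smp ω) k t).Dy‖ ^ 2 ∂P :=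
    Finset.sum_le_sum_of_subset_of_nonneg (Finset.range_mono hn)
      fun t _ _ => integral_nonneg fun ω => sq_nonneg _
  gcongr

/-- Only the step `j = 0` moves `(x, y)`; afterwards the displacement is in `v` alone. -/
theorem integral_growth_le (j : ℕ) :
    ∫ ω, (c.Mbar R.a.M * moveV R (path smp ω) k j + 2 * c.Lg ^ 2
        * ‖(R.vState (path smp ω) k (j + 1)).v - (R.vState (path smp ω) k j).v‖ ^ 2) ∂P
    ≤ (if j = 0 then c.Mbar R.a.M * (R.a.alpha ^ 2 * ∫ ω, R.sqDx (path smp ω) k ∂P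
        + R.a.T * (R.a.lam1 * R.a.beta) ^ 2 * ∫ ω, R.sqDy (path smp ω) k ∂P) else 0)
      + 2 * c.Lg ^ 2 * ((R.a.lam2 * R.a.eta) ^ 2
        * ∫ ω, ‖(R.vState (path smp ω) k j).Dv‖ ^ 2 ∂P) := by
  have hMb := c.Mbar_nonneg R.a.M
  have iX := integrable_sqDx hQ hV hS k
  have iY := integrable_sqDy hQ hV hS k
  have iV := integrable_sq_Dv hQ hV hS k j
  have hv := sq_norm_vState_v_sub_le (R := R) hV
  have hmv : ∀ ω, 0 ≤ c.Mbar R.a.M * moveV R (path smp ω) k j + 2 * c.Lg ^ 2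
      * ‖(R.vState (path smp ω) k (j + 1)).v - (R.vState (path smp ω) k j).v‖ ^ 2 := fun ω => by
    have : 0 ≤ moveV R (path smp ω) k j := by unfold moveV; positivity
    positivity
  cases j with
  | zero =>
    have iA : Integrable (fun ω => R.a.alpha ^ 2 * R.sqDx (path smp ω) k
        + R.a.T * (R.a.lam1 * R.a.beta) ^ 2 * R.sqDy (path smp ω) k) P :=
      (iX.const_mul _).add (iY.const_mul _)
    have iB := (iV.const_mul ((R.a.lam2 * R.a.eta) ^ 2)).const_mul (2 * c.Lg ^ 2)
    have h1 := integral_mono_of_nonneg (μ := P) (Filter.Eventually.of_forall hmv)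
      ((iA.const_mul (c.Mbar R.a.M)).add iB) (Filter.Eventually.of_forall fun ω => add_le_add
        (mul_le_mul_of_nonneg_left (moveV_zero_le (path smp ω) k) hMb)
        (mul_le_mul_of_nonneg_left (hv (path smp ω) k 0) (by positivity)))
    refine h1.trans (le_of_eq ?_)
    rw [integral_add' (iA.const_mul (c.Mbar R.a.M)) iB, integral_const_mul, integral_const_mul,
      integral_const_mul, integral_add (iX.const_mul _) (iY.const_mul _), integral_const_mul,
      integral_const_mul, if_pos rfl]
  | succ j =>
    have iB := (iV.const_mul ((R.a.lam2 * R.a.eta) ^ 2)).const_mul (2 * c.Lg ^ 2)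
    have h1 := integral_mono_of_nonneg (μ := P) (Filter.Eventually.of_forall hmv)
      iB (Filter.Eventually.of_forall fun ω => by
        simp only [moveV_succ, mul_zero, zero_add]
        exact mul_le_mul_of_nonneg_left (hv (path smp ω) k (j + 1)) (by positivity))
    refine h1.trans (le_of_eq ?_)
    rw [integral_const_mul, integral_const_mul, if_neg (Nat.succ_ne_zero j), zero_add]

theorem sum_growth_le {n : ℕ} (hn : n ≤ R.a.J) :
    ∑ j ∈ Finset.range n, ∫ ω, (c.Mbar R.a.M * moveV R (path smp ω) k j + 2 * c.Lg ^ 2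
        * ‖(R.vState (path smp ω) k (j + 1)).v - (R.vState (path smp ω) k j).v‖ ^ 2) ∂P
      ≤ growthV R c P smp k := by
  have hX : 0 ≤ ∫ ω, R.sqDx (path smp ω) k ∂P := integral_nonneg fun ω => sqDx_nonneg _ k
  have hY : 0 ≤ ∫ ω, R.sqDy (path smp ω) k ∂P := integral_nonneg fun ω => sqDy_nonneg _ k
  have hMb := c.Mbar_nonneg R.a.M
  refine (Finset.sum_le_sum fun j _ => integral_growth_le hQ hV hS k j).trans ?_
  rw [Finset.sum_add_distrib, ← Finset.mul_sum, ← Finset.mul_sum]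
  unfold growthV
  rw [integral_sqDv hQ hV hS]
  have h1 : ∑ t ∈ Finset.range n, ∫ ω, ‖(R.vState (path smp ω) k t).Dv‖ ^ 2 ∂P
      ≤ ∑ t ∈ Finset.range R.a.J, ∫ ω, ‖(R.vState (path smp ω) k t).Dv‖ ^ 2 ∂P :=
    Finset.sum_le_sum_of_subset_of_nonneg (Finset.range_mono hn)
      fun t _ _ => integral_nonneg fun ω => sq_nonneg _
  rw [Finset.sum_ite_eq']
  refine add_le_add ?_ (by gcongr)
  split_ifs
  · exact le_rfl
  · positivity

theorem integral_errV_le {n : ℕ} (hn : n ≤ R.a.J) : ∫ ω, ‖R.errV (path smp ω) k n‖ ^ 2 ∂P ≤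
    ∫ ω, ‖R.errV (path smp ω) k 0‖ ^ 2 ∂P + (R.a.S2 : ℝ)⁻¹ * growthV R c P smp k := by
  have h : ∀ n, ∫ ω, ‖R.errV (path smp ω) k n‖ ^ 2 ∂P ≤
      ∫ ω, ‖R.errV (path smp ω) k 0‖ ^ 2 ∂P + (R.a.S2 : ℝ)⁻¹ * ∑ j ∈ Finset.range n,
        ∫ ω, (c.Mbar R.a.M * moveV R (path smp ω) k j + 2 * c.Lg ^ 2
        * ‖(R.vState (path smp ω) k (j + 1)).v - (R.vState (path smp ω) k j).v‖ ^ 2) ∂P := by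
    intro n
    induction n with
    | zero => simp
    | succ n ih =>
      have h1 := (vInv_succ hQ hV hS (freshInv hQ hV hS k) (vInv hQ hV hS k n)).2.2
      rw [Finset.sum_range_succ]
      linarith
  have h2 := mul_le_mul_of_nonneg_left (sum_growth_le hQ hV hS k hn)
    (inv_nonneg.2 (Nat.cast_nonneg (α := ℝ) R.a.S2))
  linarith [h n]

theorem integral_errX_le {n : ℕ} (hn : n ≤ R.a.J) : ∫ ω, ‖R.errX (path smp ω) k n‖ ^ 2 ∂P ≤
    ∫ ω, ‖R.errX (path smp ω) k 0‖ ^ 2 ∂P + (R.a.S2 : ℝ)⁻¹ * growthV R c P smp k := by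
  have h : ∀ n, ∫ ω, ‖R.errX (path smp ω) k n‖ ^ 2 ∂P ≤
      ∫ ω, ‖R.errX (path smp ω) k 0‖ ^ 2 ∂P + (R.a.S2 : ℝ)⁻¹ * ∑ j ∈ Finset.range n,
        ∫ ω, (c.Mbar R.a.M * moveV R (path smp ω) k j + 2 * c.Lg ^ 2
        * ‖(R.vState (path smp ω) k (j + 1)).v - (R.vState (path smp ω) k j).v‖ ^ 2) ∂P := by
    intro n
    induction n with
    | zero => simp
    | succ n ih =>
      have h1 := (vInv_succ hQ hV hS (freshInv hQ hV hS k) (vInv hQ hV hS k n)).2.1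
      rw [Finset.sum_range_succ]
      linarith
  have h2 := mul_le_mul_of_nonneg_left (sum_growth_le hQ hV hS k hn)
    (inv_nonneg.2 (Nat.cast_nonneg (α := ℝ) R.a.S2))
  linarith [h n]

end

/-- Sums of errors that are reset every `m` steps. -/
theorem sum_le_of_restart {A w : ℕ → ℝ} {s v : ℝ} {m : ℕ} (hm : 0 < m) (hs : 0 ≤ s)
    (hw : ∀ k, 0 ≤ w k) (h0 : ∀ k, k % m = 0 → A k ≤ v)
    (h1 : ∀ k, (k + 1) % m ≠ 0 → A (k + 1) ≤ A k + s * w k) (K : ℕ) :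
    ∑ k ∈ Finset.range K, A k ≤ K * v + s * m * ∑ k ∈ Finset.range K, w k := by
  -- The growth accumulated since the last restart.
  let B : ℕ → ℝ := fun n => Nat.rec 0 (fun k b => if (k + 1) % m = 0 then 0 else b + s * w k) n
  have hBs : ∀ k, B (k + 1) = if (k + 1) % m = 0 then 0 else B k + s * w k := fun k => rfl
  have hB0 : ∀ k, 0 ≤ B k := by
    intro k
    induction k with
    | zero => exact le_rfl
    | succ k ih =>
      rw [hBs]
      split_ifs
      · exact le_rfl
      · exact add_nonneg ih (mul_nonneg hs (hw k))
  have hAB : ∀ k, A k ≤ v + B k := by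
    intro k
    induction k with
    | zero => simpa [B] using h0 0 (Nat.zero_mod m)
    | succ k ih =>
      by_cases hk : (k + 1) % m = 0
      · have := h0 _ hk
        linarith [hB0 (k + 1)]
      · have := h1 k hk
        rw [hBs, if_neg hk]
        linarith
  -- A summand `s * w k` enters `B` at most `m` times before the next restart. The extra term
  -- reserves the present value of `B` for the `m - n % m` indices from `n` to the end of the block,
  -- which makes the induction close.
  have hsum : ∀ n, ∑ k ∈ Finset.range n, B k + ((m : ℝ) - (n % m : ℕ)) * B n
      ≤ s * m * ∑ k ∈ Finset.range n, w k := by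
    intro n
    induction n with
    | zero => simp [B]
    | succ n ih =>
      have hlt : n % m < m := Nat.mod_lt n hm
      have hlt' : ((n % m : ℕ) : ℝ) + 1 ≤ m := by exact_mod_cast hlt
      rw [Finset.sum_range_succ, Finset.sum_range_succ, hBs]
      split_ifs with hk
      · nlinarith [hB0 n, mul_nonneg (mul_nonneg hs (Nat.cast_nonneg (α := ℝ) m)) (hw n)]
      · have hmod : (n + 1) % m = n % m + 1 := by
          rw [Nat.add_mod_eq_ite]
          rcases Nat.lt_or_ge 1 m with h | h
          · rw [Nat.mod_eq_of_lt h, if_neg]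
            intro hle
            exact hk (by rw [Nat.add_mod_eq_ite, Nat.mod_eq_of_lt h, if_pos hle]; omega)
          · exact absurd (by rw [show m = 1 by omega, Nat.mod_one]) hk
        rw [hmod]
        push_cast
        have h2 : 0 ≤ (((n % m : ℕ) : ℝ) + 1) * (s * w n) :=
          mul_nonneg (by positivity) (mul_nonneg hs (hw n))
        nlinarith
  have h2 : ∑ k ∈ Finset.range K, A k ≤ ∑ k ∈ Finset.range K, (v + B k) :=
    Finset.sum_le_sum fun k _ => hAB k
  rw [Finset.sum_add_distrib, Finset.sum_const, Finset.card_range, nsmul_eq_mul] at h2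
  have h3 : 0 ≤ ((m : ℝ) - (K % m : ℕ)) * B K := by
    refine mul_nonneg (sub_nonneg.2 ?_) (hB0 K)
    exact_mod_cast (Nat.mod_lt K hm).le
  linarith [hsum K]

end Expected

section ExpectedDescent

/-- Telescoping of the three coupled descent inequalities. -/
theorem sum_le_of_coupled_descent {φ d n G X Y W eX eY eV : ℕ → ℝ}
    {α r₁ y A B r₂ w A' B' Mb L l ν s m : ℝ} {T J : ℕ} (K : ℕ)
    (hd0 : ∀ k, 0 ≤ d k) (hn0 : ∀ k, 0 ≤ n k) (hX0 : ∀ k, 0 ≤ X k) (hY0 : ∀ k, 0 ≤ Y k)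
    (hW0 : ∀ k, 0 ≤ W k) (hA : 0 ≤ A) (hA' : 0 ≤ A') (hα : 0 ≤ α) (hMb : 0 ≤ Mb)
    (hr₁ : r₁ ≤ 1) (hm : ∀ k, m ≤ φ k)
    (hd : ∀ k, d (k + 1) ≤ (1 - r₁) * d k - y * Y k + A * eY k + B * X k)
    (hn : ∀ k, n (k + 1) ≤ (1 - r₂) * n k - w * W k
      + A' * (2 * eV k + J * (Mb * (d k + d (k + 1)))) + B' * X k)
    (hφ : ∀ k, φ (k + 1) ≤ φ k - α / 2 * G k - 3 / 8 * α * X k + α * eX k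
      + α * (Mb * d k + 2 * L * n k))
    (heX : ∑ k ∈ Finset.range K, eX k ≤ K * s + ∑ k ∈ Finset.range K,
      (Mb * (α ^ 2 * X k + T * l ^ 2 * Y k) + 2 * L * (ν ^ 2 * W k)))
    (heY : ∑ k ∈ Finset.range K, eY k ≤ T * (K * s + 2 * ∑ k ∈ Finset.range K,
      L * (α ^ 2 * X k + l ^ 2 * Y k)))
    (heV : ∑ k ∈ Finset.range K, eV k ≤ J * (K * s + 2 * ∑ k ∈ Finset.range K,
      (Mb * (α ^ 2 * X k + T * l ^ 2 * Y k) + 2 * L * (ν ^ 2 * W k))))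
    (cX : α * Mb * α ^ 2 + 2 * A * T * L * α ^ 2 + 4 * A' * J * Mb * α ^ 2 + B + B' ≤ 3 / 8 * α)
    (cY : α * Mb * T * l ^ 2 + 2 * A * T * L * l ^ 2 + 4 * A' * J * Mb * T * l ^ 2 ≤ y)
    (cW : α * (2 * L) * ν ^ 2 + 4 * A' * J * (2 * L) * ν ^ 2 ≤ w)
    (cd : α * Mb + 2 * A' * J * Mb ≤ r₁) (cn : α * (2 * L) ≤ r₂) :
    α / 2 * ∑ k ∈ Finset.range K, G k
      ≤ φ 0 + d 0 + n 0 - m + (α + A * T + 2 * A' * J) * (K * s) := by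
  have hdS : d K - d 0 ≤ ∑ k ∈ Finset.range K, (-r₁ * d k - y * Y k + A * eY k + B * X k) := by
    rw [← Finset.sum_range_sub]
    exact Finset.sum_le_sum fun k _ => by linarith [hd k]
  -- Writing `d k + d (k + 1)` as `2 d k` plus a difference lets the shifted gap telescope, so only
  -- `∑ d k` and a boundary term remain.
  have hnS : n K - n 0 ≤ ∑ k ∈ Finset.range K, (-r₂ * n k - w * W k
      + A' * (2 * eV k + J * (Mb * (2 * d k + (d (k + 1) - d k)))) + B' * X k) := by
    rw [← Finset.sum_range_sub]
    refine Finset.sum_le_sum fun k _ => ?_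
    have := hn k
    rw [show d k + d (k + 1) = 2 * d k + (d (k + 1) - d k) by ring] at this
    linarith
  have hφS : φ K - φ 0 ≤ ∑ k ∈ Finset.range K, (- (α / 2) * G k - 3 / 8 * α * X k + α * eX k
      + α * (Mb * d k + 2 * L * n k)) := by
    rw [← Finset.sum_range_sub]
    exact Finset.sum_le_sum fun k _ => by linarith [hφ k]
  have hmS := hm K
  have sd : 0 ≤ ∑ k ∈ Finset.range K, d k := Finset.sum_nonneg fun k _ => hd0 k
  have sn : 0 ≤ ∑ k ∈ Finset.range K, n k := Finset.sum_nonneg fun k _ => hn0 k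
  have sX : 0 ≤ ∑ k ∈ Finset.range K, X k := Finset.sum_nonneg fun k _ => hX0 k
  have sY : 0 ≤ ∑ k ∈ Finset.range K, Y k := Finset.sum_nonneg fun k _ => hY0 k
  have sW : 0 ≤ ∑ k ∈ Finset.range K, W k := Finset.sum_nonneg fun k _ => hW0 k
  simp only [Finset.sum_add_distrib, Finset.sum_sub_distrib, ← Finset.mul_sum]
    at hdS hnS hφS heX heY heV
  rw [← Finset.sum_sub_distrib, Finset.sum_range_sub] at hnS
  have eX' := mul_le_mul_of_nonneg_left heX hα
  have eY' := mul_le_mul_of_nonneg_left heY hA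
  have eV' := mul_le_mul_of_nonneg_left heV (show 0 ≤ 2 * A' by positivity)
  have bX := mul_le_mul_of_nonneg_right cX sX
  have bY := mul_le_mul_of_nonneg_right cY sY
  have bW := mul_le_mul_of_nonneg_right cW sW
  have bd := mul_le_mul_of_nonneg_right cd sd
  have bn := mul_le_mul_of_nonneg_right cn sn
  have hc : 0 ≤ A' * J * Mb := by positivity
  -- The boundary term `A' J Mb (d K - d 0)` has coefficient at most `1`, so the `d K` already on
  -- the left absorbs it.
  have hc1 : A' * J * Mb ≤ 1 := by nlinarith [mul_nonneg hα hMb]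
  have p1 := mul_nonneg (sub_nonneg.2 hc1) (hd0 K)
  have p2 := mul_nonneg hc (hd0 0)
  have p3 := hn0 K
  linarith

variable {p q : ℕ} {Ξ Z Ω : Type*} [MeasurableSpace Ξ] [MeasurableSpace Z] [mΩ : MeasurableSpace Ω]
  {R : Trial p q Ξ Z} {c : Consts}

/-- The smallness conditions on the step sizes that balance the descent inequalities. -/
structure Balanced (c : Consts) (a : Params) : Prop where
  ineqX : a.alpha * c.Mbar a.M * a.alpha ^ 2
    + 2 * (6 * (a.lam1 * a.beta) / c.mu) * a.T * c.Lg ^ 2 * a.alpha ^ 2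
    + 4 * (6 * (a.lam2 * a.eta) / c.mu) * a.J * c.Mbar a.M * a.alpha ^ 2
    + 5 / (a.lam1 * a.beta * c.mu) * (c.Cy ^ 2 * a.alpha ^ 2)
    + 5 / (a.lam2 * a.eta * c.mu) * (c.Cv ^ 2 * a.alpha ^ 2) ≤ 3 / 8 * a.alpha
  ineqY : a.alpha * c.Mbar a.M * a.T * (a.lam1 * a.beta) ^ 2
    + 2 * (6 * (a.lam1 * a.beta) / c.mu) * a.T * c.Lg ^ 2 * (a.lam1 * a.beta) ^ 2
    + 4 * (6 * (a.lam2 * a.eta) / c.mu) * a.J * c.Mbar a.M * a.T * (a.lam1 * a.beta) ^ 2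
      ≤ a.beta / 2 * a.lam1 ^ 2
  ineqV : a.alpha * (2 * c.Lg ^ 2) * (a.lam2 * a.eta) ^ 2
    + 4 * (6 * (a.lam2 * a.eta) / c.mu) * a.J * (2 * c.Lg ^ 2) * (a.lam2 * a.eta) ^ 2
      ≤ a.eta / 2 * a.lam2 ^ 2
  ineq_gapY : a.alpha * c.Mbar a.M + 2 * (6 * (a.lam2 * a.eta) / c.mu) * a.J * c.Mbar a.M
      ≤ a.lam1 * a.beta * c.mu / 4
  ineq_gapV : a.alpha * (2 * c.Lg ^ 2) ≤ a.lam2 * a.eta * c.mu / 4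

variable {P : Measure Ω} {smp : Slot → Ω → Ξ × Z} {K : ℕ} {κ : Ω → Fin K}
  [IsProbabilityMeasure P]

theorem Assumptions.continuous_yStar {Q : Problem p q Ξ Z} (hQ : Assumptions Q c) :
    Continuous Q.yStar := by
  have h0 : 0 ≤ c.Cy := div_nonneg hQ.admissible.Lg_pos.le hQ.admissible.mu_pos.le
  refine (LipschitzWith.of_dist_le_mul (K := ⟨c.Cy, h0⟩) fun x y => ?_).continuous
  rw [dist_eq_norm, dist_eq_norm]
  exact hQ.norm_yStar_sub_le x y

theorem LipReal.continuous {E V : Type*} [NormedAddCommGroup E] [NormedAddCommGroup V] {L : ℝ}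
    {h : E → V} (hL : LipReal L h) : Continuous h := by
  refine (LipschitzWith.of_dist_le_mul (K := L.toNNReal) fun x y => ?_).continuous
  rw [dist_eq_norm, dist_eq_norm]
  exact (hL x y).trans (mul_le_mul_of_nonneg_right (Real.le_coe_toNNReal L) (norm_nonneg _))

theorem Assumptions.continuous_vStar {Q : Problem p q Ξ Z} (hQ : Assumptions Q c) :
    Continuous Q.vStar := LipReal.continuous (L := c.Cv) hQ.norm_vStar_sub_le

theorem Assumptions.continuous_gradPhi {Q : Problem p q Ξ Z} (hQ : Assumptions Q c) :
    Continuous Q.gradPhi :=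
  LipReal.continuous (L := (1 + c.Cy) ^ 2 * (c.Lf + c.Cf / c.mu * c.Lgg)) hQ.norm_gradPhi_sub_le

theorem Assumptions.norm_Phi_sub_le {Q : Problem p q Ξ Z} (hQ : Assumptions Q c) (x x' : Vec p) :
    ‖Q.Phi x - Q.Phi x'‖ ≤ (c.Cf + c.Lg * (c.Cf / c.mu)) * ‖x - x'‖ := by
  refine (convex_univ).norm_image_sub_le_of_norm_fderiv_le (f := Q.Phi)
    (fun z _ => hQ.differentiable_Phi z) (fun z _ => ?_) (Set.mem_univ x') (Set.mem_univ x)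
  rw [(hQ.hasGradientAt_Phi z).hasFDerivAt.fderiv, LinearIsometryEquiv.norm_map]
  exact hQ.norm_gradPhi_le z

section

variable (hQ : Assumptions R.Q c) (hV : R.Valid) (hS : IsSampling R.Q P smp K κ)

include hQ hV hS

section

variable (k : ℕ)

/-- Being Lipschitz, `y*` grows at most linearly, so `y*(x_k)` is square integrable with `x_k`. -/
theorem integrable_gapY : Integrable (fun ω => R.gapY (path smp ω) k) P := by
  have h := startInv hQ hV hS k
  have hC : 0 ≤ c.Cy := div_nonneg hQ.admissible.Lg_pos.le hQ.admissible.mu_pos.le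
  have hm : AEStronglyMeasurable (fun ω => R.Q.yStar (R.start (path smp ω) k).x) P :=
    hQ.continuous_yStar.comp_aestronglyMeasurable h.lx.1
  have h1 : MemLp (fun ω => R.Q.yStar (R.start (path smp ω) k).x) 2 P := by
    refine MemLp.of_le ((h.lx.norm.const_mul c.Cy).add (memLp_const ‖R.Q.yStar 0‖)) hm
      (Filter.Eventually.of_forall fun ω => ?_)
    have h2 := hQ.norm_yStar_sub_le (R.start (path smp ω) k).x 0
    rw [sub_zero] at h2
    have h3 := norm_le_norm_add_norm_sub' (R.Q.yStar (R.start (path smp ω) k).x) (R.Q.yStar 0)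
    refine le_trans ?_ (Real.le_norm_self _)
    simp only [Pi.add_apply]
    linarith
  exact (h.ly.sub h1).integrable_norm_pow two_ne_zero

theorem integrable_gapV : Integrable (fun ω => R.gapV (path smp ω) k) P := by
  have h := startInv hQ hV hS k
  have hm : AEStronglyMeasurable (fun ω => R.Q.vStar (R.start (path smp ω) k).x) P :=
    hQ.continuous_vStar.comp_aestronglyMeasurable h.lx.1
  have hv : AEStronglyMeasurable (fun ω => (R.start (path smp ω) k).v) P :=
    (h.mv.mono (history_le hS k 0) le_rfl).aestronglyMeasurable
  refine Integrable.of_bound ((hv.sub hm).norm.pow 2) ((R.a.M + c.Cf / c.mu) ^ 2)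
    (Filter.Eventually.of_forall fun ω => ?_)
  unfold Trial.gapV
  rw [norm_pow, norm_norm]
  refine pow_le_pow_left₀ (norm_nonneg _) ((norm_sub_le _ _).trans (add_le_add ?_ ?_)) 2
  · exact R.norm_start_v_le _ hV.M_nonneg hV.v0_le hV.J_pos k
  · exact hQ.norm_vStar_le _

theorem integrable_Phi : Integrable (fun ω => R.Q.Phi (R.start (path smp ω) k).x) P := by
  have h := startInv hQ hV hS k
  have hi := h.lx.integrable (by norm_num)
  refine Integrable.mono' ((hi.norm.const_mul (c.Cf + c.Lg * (c.Cf / c.mu))).add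
    (integrable_const ‖R.Q.Phi 0‖)) (hQ.differentiable_Phi.continuous.comp_aestronglyMeasurable
      h.lx.1) (Filter.Eventually.of_forall fun ω => ?_)
  have h2 := hQ.norm_Phi_sub_le (R.start (path smp ω) k).x 0
  rw [sub_zero] at h2
  have h3 := norm_le_norm_add_norm_sub' (R.Q.Phi (R.start (path smp ω) k).x) (R.Q.Phi 0)
  simp only [Pi.add_apply]
  linarith

theorem integrable_sq_gradPhi :
    Integrable (fun ω => ‖R.Q.gradPhi (R.start (path smp ω) k).x‖ ^ 2) P := by
  have h := startInv hQ hV hS k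
  refine Integrable.of_bound
    ((hQ.continuous_gradPhi.comp_aestronglyMeasurable h.lx.1).norm.pow 2)
    ((c.Cf + c.Lg * (c.Cf / c.mu)) ^ 2) (Filter.Eventually.of_forall fun ω => ?_)
  rw [norm_pow, norm_norm]
  exact pow_le_pow_left₀ (norm_nonneg _) (hQ.norm_gradPhi_le _) 2

theorem integral_gapY_succ_le (hA : StepSizes c R.a) :
    ∫ ω, R.gapY (path smp ω) (k + 1) ∂P ≤
      (1 - R.a.lam1 * R.a.beta * c.mu / 4) * ∫ ω, R.gapY (path smp ω) k ∂P
      - R.a.beta / 2 * R.a.lam1 ^ 2 * ∫ ω, R.sqDy (path smp ω) k ∂P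
      + 6 * (R.a.lam1 * R.a.beta) / c.mu
        * ∑ t ∈ Finset.range R.a.T, ∫ ω, ‖R.errY (path smp ω) k t‖ ^ 2 ∂P
      + 5 / (R.a.lam1 * R.a.beta * c.mu) * (c.Cy ^ 2 * R.a.alpha ^ 2)
        * ∫ ω, R.sqDx (path smp ω) k ∂P := by
  have i1 := (integrable_gapY hQ hV hS k).const_mul (1 - R.a.lam1 * R.a.beta * c.mu / 4)
  have i2 := (integrable_sqDy hQ hV hS k).const_mul (R.a.beta / 2 * R.a.lam1 ^ 2)
  have i3 := (integrable_finsetSum (Finset.range R.a.T) fun t _ =>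
    integrable_sq_errY hQ hV hS k t).const_mul (6 * (R.a.lam1 * R.a.beta) / c.mu)
  have i4 := (integrable_sqDx hQ hV hS k).const_mul
    (5 / (R.a.lam1 * R.a.beta * c.mu) * (c.Cy ^ 2 * R.a.alpha ^ 2))
  have h := integral_mono (integrable_gapY hQ hV hS (k + 1)) (((i1.sub i2).add i3).add i4)
    fun ω => (gapY_succ_le (path smp ω) hQ hV hA k).trans_eq (by
      simp only [Pi.add_apply, Pi.sub_apply]; ring)
  rwa [integral_add' ((i1.sub i2).add i3) i4, integral_add' (i1.sub i2) i3, integral_sub' i1 i2,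
    integral_const_mul, integral_const_mul, integral_const_mul, integral_const_mul,
    integral_finsetSum _ fun t _ => integrable_sq_errY hQ hV hS k t] at h

theorem integral_gapV_succ_le (hA : StepSizes c R.a) (hM : c.Cf / c.mu ≤ R.a.M) :
    ∫ ω, R.gapV (path smp ω) (k + 1) ∂P ≤
      (1 - R.a.lam2 * R.a.eta * c.mu / 4) * ∫ ω, R.gapV (path smp ω) k ∂P
      - R.a.eta / 2 * R.a.lam2 ^ 2 * ∫ ω, R.sqDv (path smp ω) k ∂P
      + 6 * (R.a.lam2 * R.a.eta) / c.mu
        * (2 * ∑ j ∈ Finset.range R.a.J, ∫ ω, ‖R.errV (path smp ω) k j‖ ^ 2 ∂P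
        + R.a.J * (c.Mbar R.a.M
          * (∫ ω, R.gapY (path smp ω) k ∂P + ∫ ω, R.gapY (path smp ω) (k + 1) ∂P)))
      + 5 / (R.a.lam2 * R.a.eta * c.mu) * (c.Cv ^ 2 * R.a.alpha ^ 2)
        * ∫ ω, R.sqDx (path smp ω) k ∂P := by
  have i1 := (integrable_gapV hQ hV hS k).const_mul (1 - R.a.lam2 * R.a.eta * c.mu / 4)
  have i2 := (integrable_sqDv hQ hV hS k).const_mul (R.a.eta / 2 * R.a.lam2 ^ 2)
  have i3 := (integrable_finsetSum (Finset.range R.a.J) fun t _ =>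
    integrable_sq_errV hQ hV hS k t).const_mul (6 * (R.a.lam2 * R.a.eta) / c.mu * 2)
  have i5 := (integrable_gapY hQ hV hS k).const_mul
    (6 * (R.a.lam2 * R.a.eta) / c.mu * (R.a.J * c.Mbar R.a.M))
  have i6 := (integrable_gapY hQ hV hS (k + 1)).const_mul
    (6 * (R.a.lam2 * R.a.eta) / c.mu * (R.a.J * c.Mbar R.a.M))
  have i4 := (integrable_sqDx hQ hV hS k).const_mul
    (5 / (R.a.lam2 * R.a.eta * c.mu) * (c.Cv ^ 2 * R.a.alpha ^ 2))
  have h := integral_mono (integrable_gapV hQ hV hS (k + 1))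
    (((((i1.sub i2).add i3).add i5).add i6).add i4)
    fun ω => (gapV_succ_le (path smp ω) hQ hV hA hM k).trans_eq (by
      simp only [Pi.add_apply, Pi.sub_apply]; ring)
  rw [integral_add' ((((i1.sub i2).add i3).add i5).add i6) i4,
    integral_add' (((i1.sub i2).add i3).add i5) i6, integral_add' ((i1.sub i2).add i3) i5,
    integral_add' (i1.sub i2) i3, integral_sub' i1 i2,
    integral_const_mul, integral_const_mul, integral_const_mul, integral_const_mul,
    integral_const_mul, integral_const_mul,
    integral_finsetSum _ fun t _ => integrable_sq_errV hQ hV hS k t] at h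
  exact h.trans_eq (by ring)

theorem integral_Phi_succ_le (hA : StepSizes c R.a) :
    ∫ ω, R.Q.Phi (R.start (path smp ω) (k + 1)).x ∂P ≤
      ∫ ω, R.Q.Phi (R.start (path smp ω) k).x ∂P
      - R.a.alpha / 2 * ∫ ω, ‖R.Q.gradPhi (R.start (path smp ω) k).x‖ ^ 2 ∂P
      - 3 / 8 * R.a.alpha * ∫ ω, R.sqDx (path smp ω) k ∂P
      + R.a.alpha * ∫ ω, ‖R.errX (path smp ω) k 0‖ ^ 2 ∂P
      + R.a.alpha * (c.Mbar R.a.M * ∫ ω, R.gapY (path smp ω) k ∂P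
        + 2 * c.Lg ^ 2 * ∫ ω, R.gapV (path smp ω) k ∂P) := by
  have i1 := integrable_Phi hQ hV hS k
  have i2 := (integrable_sq_gradPhi hQ hV hS k).const_mul (R.a.alpha / 2)
  have i3 := (integrable_sqDx hQ hV hS k).const_mul (3 / 8 * R.a.alpha)
  have i4 := (integrable_sq_errX hQ hV hS k 0).const_mul R.a.alpha
  have i5 := (integrable_gapY hQ hV hS k).const_mul (R.a.alpha * c.Mbar R.a.M)
  have i6 := (integrable_gapV hQ hV hS k).const_mul (R.a.alpha * (2 * c.Lg ^ 2))
  have h := integral_mono (integrable_Phi hQ hV hS (k + 1))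
    (((((i1.sub i2).sub i3).add i4).add i5).add i6)
    fun ω => (Phi_succ_le (path smp ω) hQ hV hA k).trans_eq (by
      simp only [Pi.add_apply, Pi.sub_apply]; ring)
  rw [integral_add' ((((i1.sub i2).sub i3).add i4).add i5) i6,
    integral_add' (((i1.sub i2).sub i3).add i4) i5, integral_add' ((i1.sub i2).sub i3) i4,
    integral_sub' (i1.sub i2) i3, integral_sub' i1 i2,
    integral_const_mul, integral_const_mul, integral_const_mul, integral_const_mul,
    integral_const_mul] at h
  exact h.trans_eq (by ring)

end

/-- Each iteration adds `growthV/S₂` and a restart occurs every `q₁` iterations; the factor `q₁/S₂`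
is `1`. -/
theorem sum_errX_le (hq : R.a.S2 = R.a.q1) (n : ℕ) :
    ∑ k ∈ Finset.range n, ∫ ω, ‖R.errX (path smp ω) k 0‖ ^ 2 ∂P
      ≤ n * (c.sigSq R.a.M / R.a.S1) + ∑ k ∈ Finset.range n, growthV R c P smp k := by
  have hq1 : 0 < R.a.q1 := hq ▸ hV.S2_pos
  have h := sum_le_of_restart (A := fun k => ∫ ω, ‖R.errX (path smp ω) k 0‖ ^ 2 ∂P)
    (w := growthV R c P smp) (s := (R.a.S2 : ℝ)⁻¹) (v := c.sigSq R.a.M / R.a.S1) hq1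
    (by positivity) growthV_nonneg
    (fun k hk => (refresh_error hQ hV hS hk (startInv hQ hV hS k)).2.2.1)
    (fun k hk => by
      simp only [R.errX_succ_zero _ hV.J_pos k hk]
      exact integral_errX_le hQ hV hS k le_rfl) n
  rwa [hq, inv_mul_cancel₀ (by positivity), one_mul] at h

/-- Every inner error is at most the error at the start of the iteration plus one growth term, as
`S₂ ≥ 1`. The initial errors sum to one further total of the growth, hence the factor `2`. -/
theorem sum_errV_le (hq : R.a.S2 = R.a.q1) (n : ℕ) :
    ∑ k ∈ Finset.range n, ∑ j ∈ Finset.range R.a.J, ∫ ω, ‖R.errV (path smp ω) k j‖ ^ 2 ∂P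
      ≤ R.a.J * (n * (c.sigSq R.a.M / R.a.S1)
        + 2 * ∑ k ∈ Finset.range n, growthV R c P smp k) := by
  have hq1 : 0 < R.a.q1 := hq ▸ hV.S2_pos
  have h := sum_le_of_restart (A := fun k => ∫ ω, ‖R.errV (path smp ω) k 0‖ ^ 2 ∂P)
    (w := growthV R c P smp) (s := (R.a.S2 : ℝ)⁻¹) (v := c.sigSq R.a.M / R.a.S1) hq1
    (by positivity) growthV_nonneg
    (fun k hk => (refresh_error hQ hV hS hk (startInv hQ hV hS k)).2.2.2)
    (fun k hk => by
      simp only [R.errV_succ_zero _ hV.J_pos k hk]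
      exact integral_errV_le hQ hV hS k le_rfl) n
  rw [hq, inv_mul_cancel₀ (by positivity), one_mul] at h
  have hS1 : (R.a.S2 : ℝ)⁻¹ ≤ 1 := Nat.cast_inv_le_one _
  have h2 : ∀ k, ∑ j ∈ Finset.range R.a.J, ∫ ω, ‖R.errV (path smp ω) k j‖ ^ 2 ∂P
      ≤ R.a.J * (∫ ω, ‖R.errV (path smp ω) k 0‖ ^ 2 ∂P + growthV R c P smp k) := fun k => by
    refine (Finset.sum_le_card_nsmul _ _ _ fun j hj =>
      (integral_errV_le hQ hV hS k (Finset.mem_range.1 hj).le).trans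
        (add_le_add_right (mul_le_of_le_one_left (growthV_nonneg k) hS1) _)).trans_eq ?_
    rw [Finset.card_range, nsmul_eq_mul]
  refine (Finset.sum_le_sum fun k _ => h2 k).trans ?_
  rw [← Finset.mul_sum, Finset.sum_add_distrib]
  exact mul_le_mul_of_nonneg_left (by linarith) (Nat.cast_nonneg _)

theorem sum_errY_le (hq : R.a.S2 = R.a.q1) (n : ℕ) :
    ∑ k ∈ Finset.range n, ∑ t ∈ Finset.range R.a.T, ∫ ω, ‖R.errY (path smp ω) k t‖ ^ 2 ∂P
      ≤ R.a.T * (n * (c.sigSq R.a.M / R.a.S1)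
        + 2 * ∑ k ∈ Finset.range n, growthY R c P smp k) := by
  have hq1 : 0 < R.a.q1 := hq ▸ hV.S2_pos
  have h := sum_le_of_restart (A := fun k => ∫ ω, ‖R.errY (path smp ω) k 0‖ ^ 2 ∂P)
    (w := growthY R c P smp) (s := (R.a.S2 : ℝ)⁻¹) (v := c.sigSq R.a.M / R.a.S1) hq1
    (by positivity) growthY_nonneg
    (fun k hk => (refresh_error hQ hV hS hk (startInv hQ hV hS k)).2.1)
    (fun k hk => by
      simp only [R.errY_succ_zero _ hV.T_pos k hk]
      exact integral_errY_le hQ hV hS k le_rfl) n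
  rw [hq, inv_mul_cancel₀ (by positivity), one_mul] at h
  have hS1 : (R.a.S2 : ℝ)⁻¹ ≤ 1 := Nat.cast_inv_le_one _
  have h2 : ∀ k, ∑ t ∈ Finset.range R.a.T, ∫ ω, ‖R.errY (path smp ω) k t‖ ^ 2 ∂P
      ≤ R.a.T * (∫ ω, ‖R.errY (path smp ω) k 0‖ ^ 2 ∂P + growthY R c P smp k) := fun k => by
    refine (Finset.sum_le_card_nsmul _ _ _ fun j hj =>
      (integral_errY_le hQ hV hS k (Finset.mem_range.1 hj).le).trans
        (add_le_add_right (mul_le_of_le_one_left (growthY_nonneg k) hS1) _)).trans_eq ?_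
    rw [Finset.card_range, nsmul_eq_mul]
  refine (Finset.sum_le_sum fun k _ => h2 k).trans ?_
  rw [← Finset.mul_sum, Finset.sum_add_distrib]
  exact mul_le_mul_of_nonneg_left (by linarith) (Nat.cast_nonneg _)

/-- All three gap inequalities are telescoped together. The fields of `Balanced` say that the
collected coefficients of `‖D^x‖²`, `‖D^y‖²`, `‖D^v‖²` and of the two gaps are not positive. -/
theorem sum_sq_gradPhi_le (hA : StepSizes c R.a) (hB : Balanced c R.a)
    (hM : c.Cf / c.mu ≤ R.a.M) (hq : R.a.S2 = R.a.q1) {m : ℝ} (hm : ∀ x, m ≤ R.Q.Phi x) (n : ℕ) :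
    R.a.alpha / 2 * ∑ k ∈ Finset.range n, ∫ ω, ‖R.Q.gradPhi (R.start (path smp ω) k).x‖ ^ 2 ∂P
      ≤ R.Q.Phi R.x0 + ‖R.y0 - R.Q.yStar R.x0‖ ^ 2 + ‖R.v0 - R.Q.vStar R.x0‖ ^ 2 - m
        + (R.a.alpha + 6 * (R.a.lam1 * R.a.beta) / c.mu * R.a.T
          + 2 * (6 * (R.a.lam2 * R.a.eta) / c.mu) * R.a.J) * (n * (c.sigSq R.a.M / R.a.S1)) := by
  have hμ := hQ.admissible.mu_pos
  have hl1 := hA.lam1_pos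
  have hl2 := hA.lam2_pos
  have hβ := hA.beta_pos
  have hη := hA.eta_pos
  have hα := hA.alpha_pos
  have h := sum_le_of_coupled_descent n
    (φ := fun k => ∫ ω, R.Q.Phi (R.start (path smp ω) k).x ∂P)
    (d := fun k => ∫ ω, R.gapY (path smp ω) k ∂P) (n := fun k => ∫ ω, R.gapV (path smp ω) k ∂P)
    (X := fun k => ∫ ω, R.sqDx (path smp ω) k ∂P) (Y := fun k => ∫ ω, R.sqDy (path smp ω) k ∂P)
    (W := fun k => ∫ ω, R.sqDv (path smp ω) k ∂P)
    (fun k => integral_nonneg fun ω => sq_nonneg _) (fun k => integral_nonneg fun ω => sq_nonneg _)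
    (fun k => integral_nonneg fun ω => sqDx_nonneg _ k)
    (fun k => integral_nonneg fun ω => sqDy_nonneg _ k)
    (fun k => integral_nonneg fun ω => sqDv_nonneg _ k)
    (by positivity) (by positivity) hα.le (c.Mbar_nonneg R.a.M)
    ((small_rate hμ hQ.admissible.Lg_pos hl1 hA.lam1_le hA.beta_lt).trans (by norm_num))
    (m := m) (fun k => ?_)
    (fun k => integral_gapY_succ_le hQ hV hS k hA)
    (fun k => integral_gapV_succ_le hQ hV hS k hA hM)
    (fun k => integral_Phi_succ_le hQ hV hS k hA)
    (sum_errX_le hQ hV hS hq n) (sum_errY_le hQ hV hS hq n) (sum_errV_le hQ hV hS hq n)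
    hB.ineqX hB.ineqY hB.ineqV hB.ineq_gapY hB.ineq_gapV
  · refine h.trans_eq ?_
    have e1 : ∀ ω, R.start (path smp ω) 0 = ⟨R.x0, R.y0, R.v0, 0, 0, 0, 0⟩ := fun ω => rfl
    simp only [Trial.gapY, Trial.gapV, e1, integral_const, probReal_univ, one_smul]
  · have := integral_mono (μ := P) (integrable_const m) (integrable_Phi hQ hV hS k) fun ω => hm _
    simpa using this

end

end ExpectedDescent

/-! ### The prescribed step sizes satisfy the conditions of the analysis -/

section PrescribedStepSizes

namespace Consts

variable {c : Consts} {M β η : ℝ} {T J : ℕ}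

theorem Admissible.Mbar_pos (hc : c.Admissible) (M : ℝ) : 0 < c.Mbar M := by
  have := hc.Lf_pos
  unfold Mbar
  positivity

theorem Admissible.LPhi_pos (hc : c.Admissible) : 0 < c.LPhi := by
  have h1 := hc.Lf_pos
  have h2 := hc.Lgg_nonneg
  have h3 := hc.mu_pos
  have h4 := hc.Cf_nonneg
  have h5 := hc.Lg_pos
  unfold LPhi
  positivity

theorem C3_ge (M : ℝ) (hJ : 0 < J) : 1 + 2 * (T : ℝ) ^ 2 ≤ C3 M T J := by
  have h1 : (1 : ℝ) ≤ J := by exact_mod_cast hJ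
  unfold C3
  nlinarith [sq_nonneg ((J : ℝ) * M)]

theorem Admissible.lam1_pos (hc : c.Admissible) (hβ : 0 < β) (hT : 0 < T) (hJ : 0 < J) :
    0 < c.lam1 M β T J 1 := by
  have h1 := hc.mu_pos
  have h2 := hc.Lg_pos
  have h3 : 0 < C3 M T J := lt_of_lt_of_le (by positivity) (C3_ge M hJ)
  have h4 : (0 : ℝ) < T := by exact_mod_cast hT
  unfold lam1
  refine lt_min ?_ ?_ <;> positivity

theorem Admissible.lam2_pos (hc : c.Admissible) (hβ : 0 < β) (hη : 0 < η) (hT : 0 < T)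
    (hJ : 0 < J) : 0 < c.lam2 M β η T J 1 := by
  have h1 := hc.mu_pos
  have h2 := hc.Lg_pos
  have h3 := hc.Mbar_pos M
  have h4 : (0 : ℝ) < T := by exact_mod_cast hT
  have h5 : (0 : ℝ) < J := by exact_mod_cast hJ
  have h6 := hc.lam1_pos (M := M) hβ hT hJ
  unfold lam2
  refine lt_min ?_ (lt_min ?_ ?_) <;> positivity

theorem Admissible.alpha_pos (hc : c.Admissible) (hβ : 0 < β) (hη : 0 < η) (hT : 0 < T)
    (hJ : 0 < J) : 0 < c.alpha M β η T J 1 := by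
  have h1 := hc.mu_pos
  have h2 := hc.Lg_pos
  have h3 := hc.Mbar_pos M
  have h4 : (0 : ℝ) < T := by exact_mod_cast hT
  have h5 : (0 : ℝ) < J := by exact_mod_cast hJ
  have h6 := hc.lam1_pos (M := M) hβ hT hJ
  have h7 := hc.lam2_pos (M := M) hβ hη hT hJ
  have h8 := hc.LPhi_pos
  have h9 : 0 < C3 M T J := lt_of_lt_of_le (by positivity) (C3_ge M hJ)
  have h10 : 0 < c.C4 M β T J 1 := by unfold C4; positivity
  have h11 : 0 < c.C5 M β η T J 1 := by unfold C5; positivity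
  unfold alpha
  refine lt_min ?_ (lt_min ?_ (lt_min ?_ (lt_min ?_ (lt_min ?_ (lt_min ?_ ?_))))) <;> positivity

theorem half_pow_le {m n : ℕ} (h : m ≤ n) : (1 / 2 : ℝ) ^ n ≤ (1 / 2 : ℝ) ^ m :=
  pow_le_pow_of_le_one (by norm_num) (by norm_num) h

theorem Admissible.lam1_mul_le (hc : c.Admissible) (hβ : 0 < β) (hT : 0 < T) (hJ : 0 < J) :
    c.lam1 M β T J 1 * (T * c.Lg ^ 2 * β ^ 2) ≤ c.mu / 384 := by
  have h1 := hc.mu_pos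
  have h2 := hc.Lg_pos
  have h4 : (1 : ℝ) ≤ T := by exact_mod_cast hT
  have h3 : 3 ≤ C3 M T J := le_trans (by nlinarith) (C3_ge (T := T) M hJ)
  have h5 : c.lam1 M β T J 1 ≤ _ := min_le_right _ _
  rw [le_div_iff₀ (by positivity)] at h5
  -- For `T ≥ 1` the power of `1/2` is at most `1/128`; with `C₃ ≥ 3` this gives `1/384`.
  have h6 := half_pow_le (show 7 ≤ 2 * T + 5 by omega)
  have h7 := mul_le_mul_of_nonneg_right h6 h1.le
  have h8 := mul_le_mul_of_nonneg_left h3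
    (mul_nonneg (hc.lam1_pos (M := M) hβ hT hJ).le
      (show 0 ≤ (T : ℝ) * c.Lg ^ 2 * β ^ 2 by positivity))
  norm_num at h7
  linarith

theorem Admissible.lam2_mul_le (hc : c.Admissible) (hβ : 0 < β) (hη : 0 < η) (hT : 0 < T)
    (hJ : 0 < J) : c.lam2 M β η T J 1 * (J * (c.Lg ^ 2 * η ^ 2 + T * c.Mbar M * β * η))
      ≤ c.mu / 1024 := by
  have h1 := hc.mu_pos
  have h2 := hc.Lg_pos
  have h3 := hc.Mbar_pos M
  have h4 : (0 : ℝ) < J := by exact_mod_cast hJ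
  have h5 : c.lam2 M β η T J 1 ≤ _ := (min_le_right _ _).trans (min_le_right _ _)
  rw [le_div_iff₀ (by positivity)] at h5
  -- The smallest exponent occurs at `T = J = 1`.
  have h6 := half_pow_le (show 10 ≤ 2 * (T + J) + 6 by omega)
  have h7 := mul_le_mul_of_nonneg_right h6 h1.le
  norm_num at h7
  linarith

theorem Admissible.lam2_mul_Mbar_le (hc : c.Admissible) (hη : 0 < η) (hJ : 0 < J) :
    c.lam2 M β η T J 1 * (128 * c.Mbar M * J * η) ≤ c.mu ^ 2 * c.lam1 M β T J 1 * β := by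
  have h3 := hc.Mbar_pos M
  have h4 : (0 : ℝ) < J := by exact_mod_cast hJ
  have h5 : c.lam2 M β η T J 1 ≤ _ := (min_le_right _ _).trans (min_le_left _ _)
  rwa [le_div_iff₀ (by positivity)] at h5

theorem Admissible.alpha_mul_le (hc : c.Admissible) (hβ : 0 < β) (hη : 0 < η) (hT : 0 < T)
    (hJ : 0 < J) :
    c.alpha M β η T J 1 * (96 * c.Cy ^ 2 + 8 * c.Mbar M) ≤ c.mu * c.lam1 M β T J 1 * β ∧
    c.alpha M β η T J 1 * (48 * (c.Lg ^ 2 + c.Cv ^ 2)) ≤ c.mu * c.lam2 M β η T J 1 * η ∧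
    c.alpha M β η T J 1 ^ 2 * c.Mbar M ≤ 1 / 144 ∧
    c.alpha M β η T J 1 * (192 * c.lam1 M β T J 1 * β * c.Lg ^ 2 * (1 + C3 M T J)) ≤ c.mu ∧
    c.alpha M β η T J 1 * (192 * c.lam2 M β η T J 1 * η * c.Mbar M * (1 + c.Cy ^ 2 + J)) ≤ c.mu ∧
    c.alpha M β η T J 1 * (c.Mbar M * T * β + c.Lg ^ 2 * η) ≤ 1 / 128 := by
  have h1 := hc.mu_pos
  have h2 := hc.Lg_pos
  have h3 := hc.Mbar_pos M
  have h4 : (0 : ℝ) < T := by exact_mod_cast hT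
  have h5 : (0 : ℝ) < J := by exact_mod_cast hJ
  have h6 := hc.lam1_pos (M := M) hβ hT hJ
  have h7 := hc.lam2_pos (M := M) hβ hη hT hJ
  have h9 : 0 < C3 M T J := lt_of_lt_of_le (by positivity) (C3_ge M hJ)
  have hα := hc.alpha_pos (M := M) hβ hη hT hJ
  have key : c.alpha M β η T J 1 ≤ min _ (min _ (min _ (min _ (min _ (min _ _))))) := le_rfl
  simp only [le_min_iff] at key
  obtain ⟨k1, k2, -, k4, k5, k6, k7⟩ := key
  rw [le_div_iff₀ (by positivity)] at k1 k2 k4 k7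
  rw [le_div_iff₀ (by unfold C4; positivity)] at k5
  rw [le_div_iff₀ (by unfold C5; positivity)] at k6
  refine ⟨k1, k2, ?_, ?_, ?_, ?_⟩
  · rw [Real.sqrt_one] at k4
    have := pow_le_pow_left₀ (by positivity) k4 2
    rw [mul_pow, mul_pow, Real.sq_sqrt h3.le] at this
    linarith
  · simpa [C4] using k5
  · simpa [C5] using k6
  · have h6 := half_pow_le (show 7 ≤ 2 * (T + J) + 3 by omega)
    norm_num at h6 k7 ⊢
    linarith

/-- The smoothness constant proved for `Φ` is at most `(1 + C_y)² h`, and other members of the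
minimum defining `α` control it. For `C_y ≤ 1` the bound `α²M̄₁ ≤ 1/144` suffices. For `C_y ≥ 1` the
arithmetic-geometric mean inequality puts `64 C_y h` below `96 C_y² + 8 M̄₁`, and `λ₁(μ + L_g) ≤
1/2` supplies the missing factor `1 + C_y`. -/
theorem Admissible.alpha_mul_Lhyp_le (hc : c.Admissible) (hM : c.Cf / c.mu ≤ M)
    (hβ : 0 < β) (hβ1 : β < 1) (hη : 0 < η) (hT : 0 < T) (hJ : 0 < J) :
    c.alpha M β η T J 1 * c.Lhyp ≤ 1 / 4 := by
  have h1 := hc.mu_pos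
  have h2 := hc.Lg_pos
  have hα := hc.alpha_pos (M := M) hβ hη hT hJ
  have hl := hc.lam1_pos (M := M) hβ hT hJ
  obtain ⟨k1, -, k3, -⟩ := hc.alpha_mul_le (M := M) hβ hη hT hJ
  have hLgg := hc.Lgg_nonneg
  have hM0 : 0 ≤ M := le_trans (div_nonneg hc.Cf_nonneg h1.le) hM
  set h := c.Lf + M * c.Lgg with hh
  have hh0 : 0 ≤ h := by have := hc.Lf_pos; positivity
  have hsq : h ^ 2 ≤ c.Mbar M / 2 := c.sq_le_Mbar M
  have hy : 0 < c.Cy := div_pos h2 h1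
  set a := c.alpha M β η T J 1
  have hle : c.Lhyp ≤ (1 + c.Cy) ^ 2 * h := by
    unfold Lhyp
    rw [hh]
    gcongr
  refine (mul_le_mul_of_nonneg_left hle hα.le).trans ?_
  rcases le_total c.Cy 1 with hc1 | hc1
  · have e1 : (a * h) ^ 2 ≤ (1 / 16) ^ 2 := by
      rw [mul_pow]
      have := mul_le_mul_of_nonneg_left hsq (sq_nonneg a)
      norm_num
      linarith
    have e2 : a * h ≤ 1 / 16 := le_of_sq_le_sq e1 (by norm_num)
    have e3 : (1 + c.Cy) ^ 2 ≤ 4 := by nlinarith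
    have e4 := mul_le_mul_of_nonneg_left e3 (mul_nonneg hα.le hh0)
    linarith
  · have e1 : 64 * c.Cy * h ≤ 96 * c.Cy ^ 2 + 8 * c.Mbar M := by
      nlinarith [sq_nonneg (h - 2 * c.Cy)]
    have e2 := mul_le_mul_of_nonneg_left e1 hα.le
    have e3 : c.lam1 M β T J 1 ≤ _ := min_le_left _ _
    rw [le_div_iff₀ (by positivity)] at e3
    have e5 : c.mu * c.lam1 M β T J 1 * (1 + c.Cy) ≤ 1 / 2 := by
      have : c.mu * (1 + c.Cy) = c.mu + c.Lg := by unfold Cy; field_simp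
      nlinarith
    have e6 : c.mu * c.lam1 M β T J 1 * β ≤ c.mu * c.lam1 M β T J 1 :=
      mul_le_of_le_one_right (by positivity) hβ1.le
    have e7 : a * (64 * c.Cy * h) * (1 + c.Cy) ≤ 1 / 2 :=
      (mul_le_mul_of_nonneg_right (e2.trans (k1.trans e6)) (by positivity)).trans e5
    have e8 := mul_le_mul_of_nonneg_left hc1
      (show 0 ≤ a * h * (1 + c.Cy) by positivity)
    nlinarith

variable {S1 S2 q1 : ℕ}

theorem Admissible.stepSizes (hc : c.Admissible) (hM : c.Cf / c.mu ≤ M)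
    (hβ : 0 < β) (hβ1 : β < 1) (hη : 0 < η) (hη1 : η < 1) (hT : 0 < T) (hJ : 0 < J)
    (hr : (S2 : ℝ) / q1 = 1) : StepSizes c (c.params M β η T J S1 S2 q1) := by
  simp only [params, hr]
  exact
    { beta_pos := hβ
      beta_lt := hβ1
      eta_pos := hη
      eta_lt := hη1
      lam1_pos := hc.lam1_pos hβ hT hJ
      lam1_le := min_le_left _ _
      lam2_pos := hc.lam2_pos hβ hη hT hJ
      lam2_le := min_le_left _ _
      alpha_pos := hc.alpha_pos hβ hη hT hJ
      alpha_le := hc.alpha_mul_Lhyp_le hM hβ hβ1 hη hT hJ }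

/-- Each product of step sizes and constants that occurs is at most an explicit fraction (`b1` to
`b7`, `k3`, `k6`). After the common factor of a condition is removed, only a comparison of numbers
is left. -/
theorem Admissible.balanced (hc : c.Admissible) (hβ : 0 < β) (hη : 0 < η) (hT : 0 < T)
    (hJ : 0 < J) (hr : (S2 : ℝ) / q1 = 1) : Balanced c (c.params M β η T J S1 S2 q1) := by
  simp only [params, hr]
  have hμ := hc.mu_pos
  have hL := hc.Lg_pos
  have hMb := hc.Mbar_pos M
  have hl1 := hc.lam1_pos (M := M) hβ hT hJ
  have hl2 := hc.lam2_pos (M := M) hβ hη hT hJ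
  have hα := hc.alpha_pos (M := M) hβ hη hT hJ
  have a1 := hc.lam1_mul_le (M := M) hβ hT hJ
  have a2 := hc.lam2_mul_le (M := M) hβ hη hT hJ
  have a3 := hc.lam2_mul_Mbar_le (M := M) (β := β) (T := T) hη hJ
  obtain ⟨k1, k2, k3, k4, k5, k6⟩ := hc.alpha_mul_le (M := M) hβ hη hT hJ
  have hT1 : (1 : ℝ) ≤ T := by exact_mod_cast hT
  have hJ1 : (1 : ℝ) ≤ J := by exact_mod_cast hJ
  have hC3 : 2 * (T : ℝ) ≤ 1 + C3 M T J := by nlinarith [C3_ge (T := T) M hJ]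
  set l1 := c.lam1 M β T J 1
  set l2 := c.lam2 M β η T J 1
  set a := c.alpha M β η T J 1
  have b1 : 6 * (l1 * β) / c.mu * (T * c.Lg ^ 2 * β) ≤ 6 / 384 := by
    rw [div_mul_eq_mul_div, div_le_iff₀ hμ]; linarith
  have b2 : 6 * (l2 * η) / c.mu * (J * (c.Lg ^ 2 * η + T * c.Mbar M * β)) ≤ 6 / 1024 := by
    rw [div_mul_eq_mul_div, div_le_iff₀ hμ]; linarith
  have b3 : 6 * (l2 * η) / c.mu * (J * c.Mbar M) ≤ 6 / 128 * (c.mu * l1 * β) := by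
    rw [div_mul_eq_mul_div, div_le_iff₀ hμ]; linarith
  have b4 : 6 * (l1 * β) / c.mu * (T * c.Lg ^ 2 * a) ≤ 6 / 384 := by
    rw [div_mul_eq_mul_div, div_le_iff₀ hμ]
    have := mul_le_mul_of_nonneg_left hC3 (show 0 ≤ a * (192 * l1 * β * c.Lg ^ 2) by positivity)
    linarith
  have b5 : 6 * (l2 * η) / c.mu * (J * c.Mbar M * a) ≤ 6 / 192 := by
    rw [div_mul_eq_mul_div, div_le_iff₀ hμ]
    have : 0 ≤ a * (192 * l2 * η * c.Mbar M) * (1 + c.Cy ^ 2) := by positivity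
    linarith
  have b6 : 5 / (l1 * β * c.mu) * (c.Cy ^ 2 * a) ≤ 5 / 96 := by
    rw [div_mul_eq_mul_div, div_le_iff₀ (by positivity)]
    have : 0 ≤ a * c.Mbar M := by positivity
    linarith
  have b7 : 5 / (l2 * η * c.mu) * (c.Cv ^ 2 * a) ≤ 5 / 48 := by
    rw [div_mul_eq_mul_div, div_le_iff₀ (by positivity)]
    have : 0 ≤ a * c.Lg ^ 2 := by positivity
    linarith
  have hA : 0 ≤ 6 * (l1 * β) / c.mu := by positivity
  have hA' : 0 ≤ 6 * (l2 * η) / c.mu := by positivity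
  constructor <;> dsimp only <;> generalize 6 * (l1 * β) / c.mu = A at * <;>
    generalize 6 * (l2 * η) / c.mu = A' at *
  · generalize 5 / (l1 * β * c.mu) = B at *
    generalize 5 / (l2 * η * c.mu) = B' at *
    -- The common factor is `α`; numerically `1/144 + 12/384 + 24/192 + 5/96 + 5/48 < 3/8`.
    have := mul_le_mul_of_nonneg_left (show a ^ 2 * c.Mbar M + 2 * (A * (T * c.Lg ^ 2 * a))
      + 4 * (A' * (J * c.Mbar M * a)) + B * (c.Cy ^ 2 * a) + B' * (c.Cv ^ 2 * a) ≤ 3 / 8 by linarith)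
      hα.le
    linarith
  · have h0 : 0 ≤ A' * (J * (c.Lg ^ 2 * η)) := by positivity
    have h1 : 0 ≤ a * (c.Lg ^ 2 * η) := by positivity
    have := mul_le_mul_of_nonneg_left (show a * c.Mbar M * T * β + 2 * (A * (T * c.Lg ^ 2 * β))
      + 4 * (A' * (J * (T * c.Mbar M * β))) ≤ 1 / 2 by linarith) (show 0 ≤ l1 ^ 2 * β by positivity)
    linarith
  · have h0 : 0 ≤ A' * (J * (T * c.Mbar M * β)) := by positivity
    have h1 : 0 ≤ a * (c.Mbar M * T * β) := by positivity
    have := mul_le_mul_of_nonneg_left (show a * (2 * c.Lg ^ 2) * η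
      + 8 * (A' * (J * (c.Lg ^ 2 * η))) ≤ 1 / 2 by linarith) (show 0 ≤ l2 ^ 2 * η by positivity)
    linarith
  · have : 0 ≤ a * c.Cy ^ 2 := by positivity
    have : 0 ≤ c.mu * l1 * β := by positivity
    linarith
  · have : 0 ≤ a * c.Cv ^ 2 := by positivity
    have : 0 ≤ c.mu * l2 * η := by positivity
    linarith

end Consts

end PrescribedStepSizes

/-! ### The number of evaluations -/

section Evaluations

variable {p q : ℕ} {Ξ Z : Type*} [MeasurableSpace Ξ] [MeasurableSpace Z]

namespace Count

theorem total_add (a b : Count) : (a + b).total = a.total + b.total := by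
  change (a.gradF + b.gradF) + (a.gradG + b.gradG) + (a.jacVec + b.jacVec)
    + (a.hessVec + b.hessVec) = _
  unfold total
  ring

theorem total_times (n : ℕ) (a : Count) : (times n a).total = n * a.total := by
  unfold total times
  ring

end Count

variable (Q : Problem p q Ξ Z) (a : Params) (σ : Slot → Ξ × Z)

theorem total_yLoop (k : ℕ) (xNew : Vec p) (s : YState p q) (t : ℕ) :
    (yLoop Q a σ k xNew s t).count.total = s.count.total + t * (2 * a.S2) := by
  induction t with
  | zero => simp [yLoop]
  | succ t ih =>
    simp only [yLoop, yStep, evalDy, Count.total_add, Count.total_times, ih]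
    simp only [Count.total]
    ring

/-- Two directions at two points, each costing one gradient of `F` and one matrix-vector product per
sample: eight evaluations. -/
theorem total_vLoop (k : ℕ) (xNew : Vec p) (yNew : Vec q) (s : VState p q) (j : ℕ) :
    (vLoop Q a σ k xNew yNew s j).count.total = s.count.total + j * (8 * a.S2) := by
  induction j with
  | zero => simp [vLoop]
  | succ j ih =>
    simp only [vLoop, vStep, evalDx, evalDv, Count.total_add, Count.total_times, ih]
    simp only [Count.total]
    ring

theorem total_refresh (k : ℕ) (s : State p q) :
    (refresh Q a σ k s).count.total
      = s.count.total + if k % a.q1 = 0 then 5 * a.S1 else 0 := by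
  unfold refresh
  split_ifs
  · simp only [evalDx, evalDy, evalDv, Count.total_add, Count.total_times]
    simp only [Count.total]
    ring
  · rfl

theorem total_run_succ (x0 : Vec p) (y0 v0 : Vec q) (k : ℕ) :
    (run Q a x0 y0 v0 σ (k + 1)).count.total = (run Q a x0 y0 v0 σ k).count.total
      + (if k % a.q1 = 0 then 5 * a.S1 else 0) + (2 * a.T + 8 * a.J) * a.S2 := by
  simp only [run, outerStep, total_vLoop, total_yLoop, total_refresh]
  ring

/-- The quotient is `⌈k/q₁⌉`, the number of restarts before iteration `k`; a restart costs `2 + 1 +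
2` evaluations per sample. -/
theorem total_run_le (hq : 0 < a.q1) (x0 : Vec p) (y0 v0 : Vec q) (k : ℕ) :
    (run Q a x0 y0 v0 σ k).count.total
      ≤ k * ((2 * a.T + 8 * a.J) * a.S2) + (k + (a.q1 - 1)) / a.q1 * (5 * a.S1) := by
  induction k with
  | zero => exact Nat.zero_le _
  | succ k ih =>
    rw [total_run_succ]
    have h : (k + (a.q1 - 1)) / a.q1 * (5 * a.S1) + (if k % a.q1 = 0 then 5 * a.S1 else 0)
        ≤ (k + 1 + (a.q1 - 1)) / a.q1 * (5 * a.S1) := by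
      split_ifs with hk
      · obtain ⟨m, rfl⟩ := Nat.dvd_of_mod_eq_zero hk
        rw [Nat.mul_add_div hq, Nat.div_eq_of_lt (Nat.sub_lt hq one_pos),
          show a.q1 * m + 1 + (a.q1 - 1) = a.q1 * (m + 1) by
            rw [mul_add_one]; omega, Nat.mul_div_cancel_left _ hq, add_zero, add_one_mul]
      · exact Nat.mul_le_mul_right _ (Nat.div_le_div_right (by omega))
    rw [add_one_mul]
    omega

/-- Put `X = C/ε`. As `√S₁ ≤ q₁ ≤ 2√S₁`, the inner loops cost at most `(2T + 8J) · 2X√X` and the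
restarts at most `5(K√S₁ + S₁) ≤ 10X√X`. The last `S₁`, from rounding up, uses `X ≥ 1`. -/
theorem total_run_le_rpow {C ε : ℝ} {K : ℕ} (hC : 0 ≤ C) (hε : 0 < ε) (hK : (K : ℝ) ≤ C / ε)
    (hS1 : 1 ≤ a.S1) (hS1C : (a.S1 : ℝ) ≤ C / ε) (hS2 : a.S2 = a.q1) (hq : a.q1 = ⌈√(a.S1 : ℝ)⌉₊)
    (x0 : Vec p) (y0 v0 : Vec q) :
    ((run Q a x0 y0 v0 σ K).count.total : ℝ)
      ≤ (4 * a.T + 16 * a.J + 10) * C ^ (3 / 2 : ℝ) * ε ^ (-(3 / 2) : ℝ) := by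
  have hs1 : (1 : ℝ) ≤ a.S1 := by exact_mod_cast hS1
  set s := √(a.S1 : ℝ) with hs
  have h1 : 1 ≤ s := Real.one_le_sqrt.2 hs1
  have hsq : s * s = a.S1 := Real.mul_self_sqrt (by positivity)
  have hqs : s ≤ a.q1 := by rw [hq]; exact Nat.le_ceil _
  have hq2 : (a.q1 : ℝ) ≤ 2 * s := by
    rw [hq]
    have := (Nat.ceil_lt_add_one (zero_le_one.trans h1)).le
    linarith
  have hq0 : (0 : ℝ) < a.q1 := by linarith
  have hq0' : 0 < a.q1 := by exact_mod_cast hq0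
  set X := C / ε with hX
  have hX0 : 0 ≤ X := by positivity
  have hX1 : 1 ≤ √X := Real.one_le_sqrt.2 (hs1.trans hS1C)
  have hsX : s ≤ √X := Real.sqrt_le_sqrt hS1C
  have e : C ^ (3 / 2 : ℝ) * ε ^ (-(3 / 2) : ℝ) = X * √X := by
    rw [Real.rpow_neg hε.le, ← div_eq_mul_inv, ← Real.div_rpow hC hε.le, Real.sqrt_eq_rpow,
      show (3 / 2 : ℝ) = 1 + 1 / 2 by norm_num, Real.rpow_add_of_nonneg hX0 (by norm_num)
        (by norm_num), Real.rpow_one]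
  rw [mul_assoc, e]
  have hrun : ((run Q a x0 y0 v0 σ K).count.total : ℝ)
      ≤ K * ((2 * a.T + 8 * a.J) * a.S2) + ((K + (a.q1 - 1)) / a.q1 : ℕ) * (5 * a.S1) := by
    exact_mod_cast total_run_le Q a σ hq0' x0 y0 v0 K
  have hdiv : (((K + (a.q1 - 1)) / a.q1 : ℕ) : ℝ) * a.S1 ≤ X * √X * 2 := by
    have h3 : (((K + (a.q1 - 1)) / a.q1 : ℕ) : ℝ) ≤ K / a.q1 + 1 := by
      refine Nat.cast_div_le.trans ?_
      rw [div_add_one hq0.ne']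
      gcongr
      rw [Nat.cast_add]
      gcongr
      omega
    have h4 : (K : ℝ) / a.q1 * a.S1 ≤ X * √X := by
      rw [div_mul_eq_mul_div, div_le_iff₀ hq0, ← hsq]
      calc (K : ℝ) * (s * s) = K * s * s := by ring
        _ ≤ X * √X * a.q1 := by gcongr
    have h5 : (a.S1 : ℝ) ≤ X * √X := hS1C.trans (le_mul_of_one_le_right hX0 hX1)
    have h6 := mul_le_mul_of_nonneg_right h3 (zero_le_one.trans hs1)
    linarith
  have hmain : (K : ℝ) * ((2 * a.T + 8 * a.J) * a.S2)
      ≤ X * ((2 * a.T + 8 * a.J) * (2 * √X)) := by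
    rw [hS2]
    gcongr
    linarith
  linarith

end Evaluations

/-! ### The output of the algorithm -/

section Output

variable {p q : ℕ} {Ξ Z Ω : Type*} [MeasurableSpace Ξ] [MeasurableSpace Z] [mΩ : MeasurableSpace Ω]
  {R : Trial p q Ξ Z} {c : Consts} {P : Measure Ω} {smp : Slot → Ω → Ξ × Z} {K : ℕ}
  {κ : Ω → Fin K} [IsProbabilityMeasure P]

omit [IsProbabilityMeasure P] in
/-- An independent uniform index averages. -/
theorem integral_index (hS : IsSampling R.Q P smp K κ) {h : ℕ → Ω → ℝ}
    (hi : ∀ k, Integrable (h k) P)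
    (hm : ∀ k, Measurable[MeasurableSpace.comap (fun ω s => smp s ω) MeasurableSpace.pi] (h k)) :
    Integrable (fun ω => h (κ ω) ω) P ∧
      ∫ ω, h (κ ω) ω ∂P = (K : ℝ)⁻¹ * ∑ k ∈ Finset.range K, ∫ ω, h k ω ∂P := by
  have hset : ∀ k : Fin K, MeasurableSet (κ ⁻¹' {k}) := fun k =>
    hS.measurable_index (measurableSet_singleton k)
  have e : (fun ω => h (κ ω) ω)
      = fun ω => ∑ k : Fin K, (κ ⁻¹' {k}).indicator (fun _ => (1 : ℝ)) ω * h k ω := by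
    funext ω
    rw [Finset.sum_eq_single (κ ω)]
    · simp
    · intro k _ hk
      have hω : ω ∉ κ ⁻¹' {k} := fun h => hk (Set.mem_singleton_iff.1 h).symm
      rw [Set.indicator_of_notMem hω, zero_mul]
    · intro h
      exact absurd (Finset.mem_univ _) h
  have hint : ∀ k : Fin K,
      Integrable (fun ω => (κ ⁻¹' {k}).indicator (fun _ => (1 : ℝ)) ω * h k ω) P := fun k => by
    have := (hi k).indicator (hset k)
    refine this.congr (Filter.Eventually.of_forall fun ω => ?_)
    by_cases hω : ω ∈ κ ⁻¹' {k} <;> simp [Set.indicator, hω]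
  have hval : ∀ k : Fin K, ∫ ω, (κ ⁻¹' {k}).indicator (fun _ => (1 : ℝ)) ω * h k ω ∂P
      = (K : ℝ)⁻¹ * ∫ ω, h k ω ∂P := fun k => by
    -- The event `κ = k` is independent of everything determined by the samples, so its probability
    -- `1/K` factors out.
    have hind : IndepFun ((κ ⁻¹' {k}).indicator fun _ => (1 : ℝ)) (h k) P := by
      rw [IndepFun_iff_Indep]
      have h0 := (IndepFun_iff_Indep _ _ _).1 hS.indep_index
      refine indep_of_indep_of_le_left (indep_of_indep_of_le_right h0 (hm k).comap_le) ?_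
      have h1 : Measurable[MeasurableSpace.comap κ inferInstance]
          ((κ ⁻¹' {k}).indicator fun _ => (1 : ℝ)) :=
        Measurable.indicator measurable_const ⟨{k}, measurableSet_singleton k, rfl⟩
      exact h1.comap_le
    rw [hind.integral_fun_mul_eq_mul_integral
      ((measurable_const.indicator (hset k)).aestronglyMeasurable) (hi k).1,
      integral_indicator_const _ (hset k), measureReal_def, hS.uniform_index k]
    simp
  rw [e]
  refine ⟨integrable_finsetSum _ fun k _ => hint k, ?_⟩
  rw [integral_finsetSum _ fun k _ => hint k, Finset.sum_congr rfl fun k _ => hval k,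
    ← Finset.mul_sum, Fin.sum_univ_eq_sum_range fun k => ∫ ω, h k ω ∂P]

theorem isEpsStationary_output (hQ : Assumptions R.Q c) (hV : R.Valid)
    (hS : IsSampling R.Q P smp K κ) {ε : ℝ}
    (h : (K : ℝ)⁻¹ * ∑ k ∈ Finset.range K,
      ∫ ω, ‖R.Q.gradPhi (R.start (path smp ω) k).x‖ ^ 2 ∂P ≤ ε) :
    IsEpsStationary R.Q P (fun ω => (R.start (path smp ω) (κ ω)).x) ε := by
  have h1 := integral_index hS (h := fun k ω => ‖R.Q.gradPhi (R.start (path smp ω) k).x‖ ^ 2)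
    (integrable_sq_gradPhi hQ hV hS) fun k => by
      have h2 := (startInv hQ hV hS k).mx.mono (past_le_comap smp _) le_rfl
      have h3 := hQ.continuous_gradPhi.measurable.comp h2
      have h4 : Measurable fun x : Vec p => ‖x‖ ^ 2 := (continuous_norm.pow 2).measurable
      exact h4.comp h3
  refine ⟨hQ.differentiable_Phi, ?_, ?_⟩
  · simp only [hQ.gradient_Phi]
    exact h1.1
  · simp only [hQ.gradient_Phi]
    exact h1.2.trans_le h

end Output

end ALSSpider

/-! ### Choice of the constants and conclusion -/

theorem corollary1 {p q : ℕ} {Ξ Z : Type*} [MeasurableSpace Ξ] [MeasurableSpace Z]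
    (Q : Problem p q Ξ Z) (c : Consts) (hQ : Assumptions Q c)
    (M : ℝ) (hM : c.Cf / c.mu ≤ M)
    (β η : ℝ) (hβ : 0 < β) (hβ1 : β < 1) (hη : 0 < η) (hη1 : η < 1)
    (T J : ℕ) (hT : 0 < T) (hJ : 0 < J)
    (x0 : Vec p) (y0 v0 : Vec q) (hv0 : ‖v0‖ ≤ M) :
    ∃ b : ℝ, 0 < b ∧ ∀ C : ℝ, b ≤ C → ∃ B : ℝ,
      ∀ ε : ℝ, 0 < ε → ε ≤ 1 →
      ∀ K S1 S2 q1 : ℕ,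
        b / ε ≤ (K : ℝ) → (K : ℝ) ≤ C / ε →
        b / ε ≤ (S1 : ℝ) → (S1 : ℝ) ≤ C / ε →
        S2 = q1 → q1 = ⌈√(S1 : ℝ)⌉₊ →
      ∀ {Ω : Type*} [MeasurableSpace Ω] (P : Measure Ω) [IsProbabilityMeasure P]
        (smp : Slot → Ω → Ξ × Z) (κ : Ω → Fin K),
        IsSampling Q P smp K κ →
        IsEpsStationary Q P
          (fun ω =>
            (run Q (c.params M β η T J S1 S2 q1) x0 y0 v0 (fun s => smp s ω) (κ ω)).x) ε ∧
        ∀ ω : Ω,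
          ((run Q (c.params M β η T J S1 S2 q1) x0 y0 v0 (fun s => smp s ω) K).count.total : ℝ)
            ≤ B * ε ^ (-(3 / 2) : ℝ) := by
  have hc := hQ.admissible
  obtain ⟨m, hm⟩ := hQ.regular.bddBelow_Phi
  have hm : ∀ x, m ≤ Q.Phi x := fun x => hm ⟨x, rfl⟩
  have hM0 : 0 ≤ M := (div_nonneg hc.Cf_nonneg hc.mu_pos.le).trans hM
  -- Since `S₂ = q₁`, the ratio `r` is `1` and the step sizes do not depend on `ε`, `K` or `S₁`.
  -- Hence neither do `D`, `N` and `b`.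
  set α := c.alpha M β η T J 1
  set D := Q.Phi x0 + ‖y0 - Q.yStar x0‖ ^ 2 + ‖v0 - Q.vStar x0‖ ^ 2 - m
  set N := (α + 6 * (c.lam1 M β T J 1 * β) / c.mu * T
    + 2 * (6 * (c.lam2 M β η T J 1 * η) / c.mu) * J) * c.sigSq M with hN
  have hα : 0 < α := hc.alpha_pos hβ hη hT hJ
  have hD : 0 ≤ D := by
    have h1 := hm x0
    have h2 : 0 ≤ ‖y0 - Q.yStar x0‖ ^ 2 + ‖v0 - Q.vStar x0‖ ^ 2 := by positivity
    linarith
  have hN0 : 0 ≤ N := by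
    have h1 := hc.mu_pos
    have h2 := hc.lam1_pos (M := M) hβ hT hJ
    have h3 := hc.lam2_pos (M := M) hβ hη hT hJ
    have h4 : 0 ≤ c.sigSq M := by unfold Consts.sigSq; positivity
    positivity
  -- The second entry makes `2/α (D + N)/b ≤ 1`; the first makes `K` and `S₁` positive when `ε ≤ 1`.
  set b := max 1 (2 / α * (D + N)) with hb
  have hb1 : 1 ≤ b := le_max_left _ _
  refine ⟨b, by linarith, fun C hC => ⟨(4 * T + 16 * J + 10) * C ^ (3 / 2 : ℝ), ?_⟩⟩
  intro ε hε hε1 K S1 S2 q1 hK hKC hS1 hS1C hS2 hq1 Ω _ P _ smp κ hS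
  have hbε : 1 ≤ b / ε := (one_le_div hε).2 (hε1.trans hb1)
  have hKpos : (0 : ℝ) < K := by linarith
  have hS1' : (1 : ℝ) ≤ S1 := hbε.trans hS1
  have hS1pos : 0 < S1 := by exact_mod_cast zero_lt_one.trans_le hS1'
  have hq1pos : 0 < q1 := by
    rw [hq1, Nat.ceil_pos]
    exact Real.sqrt_pos.2 (by linarith)
  have hr : (S2 : ℝ) / q1 = 1 := by rw [hS2]; exact div_self (by positivity)
  refine ⟨?_, fun ω => total_run_le_rpow Q (c.params M β η T J S1 S2 q1) _ (by linarith) hε hKC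
    hS1pos hS1C hS2 hq1 x0 y0 v0⟩
  have hV : Trial.Valid (⟨Q, c.params M β η T J S1 S2 q1, x0, y0, v0⟩ : Trial p q Ξ Z) :=
    { T_pos := hT
      J_pos := hJ
      S1_pos := hS1pos
      S2_pos := hS2 ▸ hq1pos
      M_nonneg := hM0
      v0_le := hv0 }
  refine isEpsStationary_output (R := ⟨Q, c.params M β η T J S1 S2 q1, x0, y0, v0⟩) hQ hV hS ?_
  have h := sum_sq_gradPhi_le (R := ⟨Q, c.params M β η T J S1 S2 q1, x0, y0, v0⟩) hQ hV hS
    (hc.stepSizes hM hβ hβ1 hη hη1 hT hJ hr) (hc.balanced hβ hη hT hJ hr) hM hS2 hm K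
  set G := ∑ k ∈ Finset.range K, ∫ ω, ‖Q.gradPhi (Trial.start
    ⟨Q, c.params M β η T J S1 S2 q1, x0, y0, v0⟩ (path smp ω) k).x‖ ^ 2 ∂P
  have h1 : α / 2 * G ≤ D + N * (K / S1) := by
    clear_value G
    simp only [Consts.params, hr] at h
    refine h.trans_eq ?_
    rw [hN]
    ring
  have hdiv : ∀ n : ℝ, b / ε ≤ n → n⁻¹ ≤ ε / b := fun n hn => by
    rw [← inv_div]
    exact inv_anti₀ (by positivity) hn
  -- After division by `αK/2` the initial gap decays like `1/K` and the variance of the large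
  -- batches like `1/S₁`; both reciprocals are at most `ε/b`.
  have h2 : (K : ℝ)⁻¹ * G ≤ 2 / α * (D * (K : ℝ)⁻¹ + N * (S1 : ℝ)⁻¹) := by
    have e : (K : ℝ)⁻¹ * G = 2 / α * (K : ℝ)⁻¹ * (α / 2 * G) := by field_simp
    have e2 : 2 / α * (D * (K : ℝ)⁻¹ + N * (S1 : ℝ)⁻¹)
      = 2 / α * (K : ℝ)⁻¹ * (D + N * (K / S1)) := by field_simp
    rw [e, e2]
    gcongr
  refine h2.trans ?_
  calc 2 / α * (D * (K : ℝ)⁻¹ + N * (S1 : ℝ)⁻¹)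
      ≤ 2 / α * (D * (ε / b) + N * (ε / b)) := by
        gcongr
        · exact hdiv _ hK
        · exact hdiv _ hS1
    _ = 2 / α * (D + N) / b * ε := by ring
    _ ≤ 1 * ε := by
        gcongr
        exact (div_le_one (by linarith)).2 (le_max_right _ _)
    _ = ε := one_mul ε
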